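/- Let $N\ge 0$, let $K$ be a field, and let $x_1,\dots,x_{N-1}$, $y_1,\dots,y_{N-2}\in K$. **Okada algebra.** $O_N(X,Y)$ is the unital associative $K$-algebra generated by $e_1,\dots,e_{N-1}$ with relations $e_i^2=x_ie_i$; $e_ie_j=e_je_i$ for $|i-j|\ge 2$; $e_{i+1}e_ie_{i+1}=y_ie_{i+1}$ for $1\le i\le N-2$. For $\sigma\in S_N$ put $c_i=\#\{j<i:\sigma^{-1}(j)>\sigma^{-1}(i)\}$ and $e_\sigma=\prod_{i=1}^{N}e_{i-1}e_{i-2}\cdots e_{i-c_i}$ (factors from left to right, with increasing $i$). **Diagrams.** Order the nodes $1<\dots<N<\overline N<\dots<\overline 1$, with $|a|=|\overline a|=a$. An Okada arc-diagram of rank $N$ is a non-crossing perfect matching of the $2N$ nodes with a height label $h\ge 1$ on every arc, such that the label of an arc $\{a,b\}$ is at most $\min(|a|,|b|)$ and has the same parity as it, and an arc $\{a<b\}$ nested in an arc $\{c<d\}$ (that is, $c<a<b<d$) has the larger label. An arc $\{a,\overline b\}$ is called propagating. The mirror $D^\star$ exchanges $a$ and $\overline a$ for all $a$. The identity diagram has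 the arcs $\{a,\overline a\}$ with label $a$; for $1\le i<N$ the diagram $G_i$ has the arcs $\{j,\overline j\}$ with label $j$ $(j\ne i,i+1)$ and the arcs $\{i,i+1\}$, $\{\overline i,\overline{i+1}\}$ with label $i$. The composition $C\circ D$ identifies each node $\overline a$ of $C$ with the node $a$ of $D$; every resulting arc or loop is labelled by the minimum of the labels of its constituents. $[C\circ D]$ is the diagram obtained by deleting the loops, and $\ell_k$ is the number of loops of label $k$. For a diagram $D$ let $b_i(D)$ be half the number of nodes $u$ such that the arc at $u$ has label $\le i$ and $i<|u|$. Define $m_0=0$ and $m_i=b_i(C)+b_i(D)-b_i([C\circ D])-\ell_i-m_{i-1}$. The diagram algebra $A_N(X,Y)$ is the $K$-vector space with basis the Okada arc-diagrams of rank $N$, with the bilinear product $$C\cdot D=\prod_{k=1}^{N-1}x_k^{\ell_k}\ \prod_{k=1}^{N-2}y_k^{m_k}\ [C\circ D].$$ (For $y_1=\dots=y_{N-2}=1$ only the factor recording the loops remains.) The mirror map is extended linearly. **Half diagrams.** An Okada half arc-diagram of rank $N$ is the left half $\langle D|$ of an Okada arc-diagram $D$ cut in the middle: labelled full arcs $\{a,b\}$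 and labelled half arcs (the cut propagating arcs) on $\{1,\dots,N\}$. Put $|D\rangle=\langle D^\star|$. For two half diagrams $L,R$ with the same set of half arc labels, the gluing $L\bowtie R$ is the unique Okada arc-diagram $D$ with $\langle D|=L$ and $|D\rangle=R$. The $r$-restriction of a half diagram $H$ keeps the full arcs inside $\{1,\dots,r\}$, and turns each full arc $\{a,b\}$ with $a\le r<b$ and each half arc at $a\le r$ into a half arc at $a$ with the same label. The chain of $H$ is $(C_0,\dots,C_N)$, where $C_r$ is the set of half arc labels of the $r$-restriction of $H$, regarded as a Fibonacci set of rank $r$ (a set $\{s_1<\dots<s_k\}\subseteq\{1,\dots,r\}$ with $k\equiv r$ and $s_l\equiv l$ modulo $2$; the rank is part of the data). **Fomin's correspondence.** For $\sigma\in S_N$ define Fibonacci sets $\Lambda_{i,j}$, $0\le i,j\le N$, by $\Lambda_{i,0}=\Lambda_{0,j}=\emptyset$ (of rank $0$) and the following rule for $t=\Lambda_{i-1,j-1}$, $p=\Lambda_{i-1,j}$, $q=\Lambda_{i,j-1}$, $z=\Lambda_{i,j}$: if $p=q=t$, then $z=t\cup\{\operatorname{rank}t+1\}$ (of rank $\operatorname{rank}t+1$)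 when $\sigma(i)=j$, and $z=t$ otherwise; if $p=t\ne q$, then $z=q$; if $q=t\neq p$, then $z=p$; if $p\ne t\ne q$, then $z$ is the set $t$ regarded with rank $\operatorname{rank}t+2$. Fomin's correspondence sends $\sigma$ to the pair of saturated chains $P_\sigma=(\Lambda_{N,j})_{0\le j\le N}$ and $Q_\sigma=(\Lambda_{i,N})_{0\le i\le N}$ of the Young–Fibonacci lattice. **Theorem.** There is a unique linear map $\Theta:O_N(X,Y)\to A_N(X,Y)$ that takes the unit to the identity diagram, is multiplicative and satisfies $\Theta(e_i)=G_i$ for $1\le i<N$. For every $\sigma\in S_N$ there are a unique half diagram $L_\sigma$ with chain $P_\sigma$ and a unique half diagram $R_\sigma$ with chain $Q_\sigma$; the gluings $L_\sigma\bowtie R_\sigma$ and $R_\sigma\bowtie L_\sigma$ exist and are unique; and $$\Theta(e_\sigma)=L_\sigma\bowtie R_\sigma,\qquad \Theta(e_\sigma)^\star=\Theta(e_{\sigma^{-1}})=R_\sigma\bowtie L_\sigma .$$ -/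

import Mathlib

/-! ### Okada arc-diagrams -/

/-- The `2N` boundary nodes of a rank `N` arc-diagram. The node `Sum.inl a` is the positive
(left) node `a + 1` and `Sum.inr a` is the overlined (right) node with number `a + 1`. -/
abbrev Node (N : ℕ) := Fin N ⊕ Fin N

/-- The absolute value `|a| ∈ {1, …, N}` of a node. -/
def Node.level {N : ℕ} : Node N → ℕ
  | Sum.inl a => a.val + 1
  | Sum.inr a => a.val + 1

/-- The position of a node in the total order `1 < 2 < ⋯ < N < N̄ < ⋯ < 2̄ < 1̄`. -/
def Node.pos {N : ℕ} : Node N → ℕ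
  | Sum.inl a => a.val
  | Sum.inr a => 2 * N - 1 - a.val

/-- A rank `N` Okada arc-diagram: a non-crossing perfect matching of the nodes (given by the
fixed-point free involution `partner`) with a height label on each arc (given as a function on
nodes which takes the same value on both ends of an arc). -/
@[ext]
structure OkadaDiagram (N : ℕ) where
  partner : Node N → Node N
  label : Node N → ℕ
  partner_ne : ∀ a, partner a ≠ a
  partner_partner : ∀ a, partner (partner a) = a
  noncrossing : ∀ a c, ¬ (Node.pos a < Node.pos c ∧ Node.pos c < Node.pos (partner a) ∧
    Node.pos (partner a) < Node.pos (partner c))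
  label_partner : ∀ a, label (partner a) = label a
  one_le_label : ∀ a, 1 ≤ label a
  label_le : ∀ a, label a ≤ min (Node.level a) (Node.level (partner a))
  label_parity : ∀ a, label a % 2 = min (Node.level a) (Node.level (partner a)) % 2
  label_nested : ∀ a c, Node.pos c < Node.pos a → Node.pos a < Node.pos (partner a) →
    Node.pos (partner a) < Node.pos (partner c) → label c < label a

/-- The reflection exchanging the left and the right boundary. -/
def Node.mirror {N : ℕ} : Node N → Node N
  | Sum.inl a => Sum.inr a
  | Sum.inr a => Sum.inl a

theorem Node.mirror_mirror {N : ℕ} (a : Node N) : a.mirror.mirror = a := by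
  cases a <;> rfl

theorem Node.level_mirror {N : ℕ} (a : Node N) : a.mirror.level = a.level := by
  cases a <;> rfl

theorem Node.pos_mirror {N : ℕ} (a : Node N) : a.mirror.pos + a.pos = 2 * N - 1 := by
  rcases a with a | a <;> have := a.isLt <;> simp only [Node.mirror, Node.pos] <;> omega

/-- The identity diagram, with the arcs `a — ā` labelled `a`. -/
def OkadaDiagram.id (N : ℕ) : OkadaDiagram N where
  partner := Node.mirror
  label := Node.level
  partner_ne a := by cases a <;> simp [Node.mirror]
  partner_partner := Node.mirror_mirror
  noncrossing a c := by
    have h1 := Node.pos_mirror a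
    have h2 := Node.pos_mirror c
    omega
  label_partner := Node.level_mirror
  one_le_label a := by cases a <;> simp [Node.level]
  label_le a := by simp [Node.level_mirror]
  label_parity a := by simp [Node.level_mirror]
  label_nested a c h1 h2 h3 := by
    rcases a with a | a <;> rcases c with c | c <;> have := a.isLt <;> have := c.isLt <;>
      simp only [Node.mirror, Node.pos, Node.level] at * <;> omega

/-- The mirror of an Okada arc-diagram. -/
def OkadaDiagram.mirror {N : ℕ} (D : OkadaDiagram N) : OkadaDiagram N where
  partner a := (D.partner a.mirror).mirror
  label a := D.label a.mirror
  partner_ne a h := D.partner_ne a.mirror (by rw [← Node.mirror_mirror (D.partner _), h])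
  partner_partner a := by simp [Node.mirror_mirror, D.partner_partner]
  noncrossing a c := by
    have h := D.noncrossing (D.partner c.mirror) (D.partner a.mirror)
    simp only [D.partner_partner] at h
    have h1 := Node.pos_mirror a
    have h2 := Node.pos_mirror c
    have h3 := Node.pos_mirror (D.partner a.mirror)
    have h4 := Node.pos_mirror (D.partner c.mirror)
    omega
  label_partner a := by simp [Node.mirror_mirror, D.label_partner]
  one_le_label a := D.one_le_label _
  label_le a := by simpa [Node.level_mirror] using D.label_le a.mirror
  label_parity a := by simpa [Node.level_mirror] using D.label_parity a.mirror
  label_nested a c g1 g2 g3 := by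
    have h := D.label_nested (D.partner a.mirror) (D.partner c.mirror)
    simp only [D.partner_partner, D.label_partner] at h
    have h1 := Node.pos_mirror a
    have h2 := Node.pos_mirror c
    have h3 := Node.pos_mirror (D.partner a.mirror)
    have h4 := Node.pos_mirror (D.partner c.mirror)
    apply h <;> omega

/-- The transposition of the levels `i` and `i + 1` of `{1, …, N}` (with `1 ≤ i < N`). -/
def elemSwap {N : ℕ} (i : ℕ) (hi : 1 ≤ i ∧ i < N) (a : Fin N) : Fin N :=
  if a.val + 1 = i then ⟨i, hi.2⟩ else if a.val = i then ⟨i - 1, by omega⟩ else a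

/-- The matching of the elementary diagram `G i`. -/
def elemPartner {N : ℕ} (i : ℕ) (hi : 1 ≤ i ∧ i < N) : Node N → Node N
  | Sum.inl a => if a.val + 1 = i ∨ a.val = i then Sum.inl (elemSwap i hi a) else Sum.inr a
  | Sum.inr a => if a.val + 1 = i ∨ a.val = i then Sum.inr (elemSwap i hi a) else Sum.inl a

/-- The height labels of the elementary diagram `G i`. -/
def elemLabel {N : ℕ} (i : ℕ) : Node N → ℕ
  | Sum.inl a => if a.val = i then i else a.val + 1
  | Sum.inr a => if a.val = i then i else a.val + 1

/-- The elementary Okada arc-diagram `G i`, `1 ≤ i < N`: it has the arcs `j — j̄` labelled `j` for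
`j ≠ i, i + 1`, and the two arcs `i — i+1` on the left and on the right, both labelled `i`. -/
def OkadaDiagram.elem {N : ℕ} (i : ℕ) (hi : 1 ≤ i ∧ i < N) : OkadaDiagram N where
  partner := elemPartner i hi
  label := elemLabel i
  partner_ne a h := by
    rcases a with a | a <;> simp only [elemPartner, elemSwap] at h <;> split_ifs at h <;>
      simp [Fin.ext_iff] at h <;> omega
  partner_partner a := by
    rcases a with a | a <;> simp only [elemPartner, elemSwap] <;> split_ifs <;>
      simp [elemPartner, elemSwap, Fin.ext_iff] <;> grind
  noncrossing a c := by
    rcases a with a | a <;> rcases c with c | c <;> have := a.isLt <;> have := c.isLt <;>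
      simp only [elemPartner, elemSwap] <;> split_ifs <;> simp only [Node.pos] <;> omega
  label_partner a := by
    rcases a with a | a <;> simp only [elemPartner, elemSwap, elemLabel] <;> split_ifs <;>
      simp only [Node.level, elemLabel] at * <;> (try split_ifs) <;> omega
  one_le_label a := by
    rcases a with a | a <;> simp only [elemLabel] <;> split_ifs <;> omega
  label_le a := by
    rcases a with a | a <;> simp only [elemPartner, elemSwap, elemLabel] <;> split_ifs <;>
      simp only [Node.level, elemLabel] at * <;> (try split_ifs) <;> omega
  label_parity a := by
    rcases a with a | a <;> simp only [elemPartner, elemSwap, elemLabel] <;> split_ifs <;>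
      simp only [Node.level, elemLabel] at * <;> (try split_ifs) <;> omega
  label_nested a c := by
    rcases a with a | a <;> rcases c with c | c <;> have := a.isLt <;> have := c.isLt <;>
      simp only [elemPartner, elemSwap, elemLabel] <;> split_ifs <;>
      simp only [Node.pos] at * <;> omega

/-! ### Composition of arc-diagrams -/

/-- The nodes of the concatenation of two diagrams: left, merged (middle) and right nodes. -/
abbrev Node3 (N : ℕ) := Fin N ⊕ Fin N ⊕ Fin N

/-- The nodes of the first (left) diagram inside the concatenation. -/
def inFst {N : ℕ} : Node N → Node3 N
  | Sum.inl a => Sum.inl a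
  | Sum.inr a => Sum.inr (Sum.inl a)

/-- The nodes of the second (right) diagram inside the concatenation. -/
def inSnd {N : ℕ} : Node N → Node3 N
  | Sum.inl a => Sum.inr (Sum.inl a)
  | Sum.inr a => Sum.inr (Sum.inr a)

/-- The outer boundary nodes of the concatenation. -/
def inOuter {N : ℕ} : Node N → Node3 N
  | Sum.inl a => Sum.inl a
  | Sum.inr a => Sum.inr (Sum.inr a)

/-- The graph obtained by merging the right nodes of `C` with the left nodes of `D`; its edges are
the arcs of `C` and of `D`, and its connected components are the arcs and loops of `C ∘ D`. -/
def concatGraph {N : ℕ} (C D : OkadaDiagram N) : SimpleGraph (Node3 N) :=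
  SimpleGraph.fromRel fun p q =>
    (∃ u, p = inFst u ∧ q = inFst (C.partner u)) ∨ (∃ u, p = inSnd u ∧ q = inSnd (D.partner u))

/-- The height label of an arc or loop of `C ∘ D`: the minimum of the labels of the arcs of `C`
and of `D` which comprise it. -/
noncomputable def concatHeight {N : ℕ} (C D : OkadaDiagram N)
    (γ : (concatGraph C D).ConnectedComponent) : ℕ :=
  sInf ({h | ∃ u, (concatGraph C D).connectedComponentMk (inFst u) = γ ∧ h = C.label u} ∪
    {h | ∃ u, (concatGraph C D).connectedComponentMk (inSnd u) = γ ∧ h = D.label u})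

/-- `E` is the diagram `[C ∘ D]` obtained from the concatenation by removing all loops. -/
def IsComposition {N : ℕ} (C D E : OkadaDiagram N) : Prop :=
  (∀ u v : Node N, u ≠ v →
    (E.partner u = v ↔ (concatGraph C D).Reachable (inOuter u) (inOuter v))) ∧
  ∀ u : Node N,
    E.label u = concatHeight C D ((concatGraph C D).connectedComponentMk (inOuter u))

theorem IsComposition.unique {N : ℕ} {C D E E' : OkadaDiagram N} (h : IsComposition C D E)
    (h' : IsComposition C D E') : E = E' := by
  refine OkadaDiagram.ext (funext fun u => ?_) (funext fun u => by rw [h.2, h'.2])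
  have := (h'.1 u (E'.partner u) (E'.partner_ne u).symm).1 rfl
  exact (h.1 u (E'.partner u) (E'.partner_ne u).symm).2 this

/-- The number of loops of height `k` in `C ∘ D`. -/
noncomputable def loopCount {N : ℕ} (C D : OkadaDiagram N) (k : ℕ) : ℕ :=
  {γ : (concatGraph C D).ConnectedComponent |
    (∀ u : Node N, (concatGraph C D).connectedComponentMk (inOuter u) ≠ γ) ∧
      concatHeight C D γ = k}.ncard

/-- The number of U-turn boxes in row `i` of the normal form of the fully packed loop configuration
of `D`. In this normal form an arc `a — b` of height `h` goes monotonically from level `|a|` to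
level `h` and from there to level `|b|`; a U-turn box in row `i` consists of two passages between
the levels `i` and `i + 1`. -/
def boxCount {N : ℕ} (D : OkadaDiagram N) (i : ℕ) : ℕ :=
  (Finset.univ.filter fun u : Node N => D.label u ≤ i ∧ i < u.level).card / 2

/-- The number of factors `y i` produced when the concatenation of the normal forms of `C` and `D`
is rewritten to the normal form of `E = [C ∘ D]`. A factor `y i` is produced by each removal of two
U-turn boxes, one in row `i + 1` and one in row `i` (the relation `e_{i+1} e_i e_{i+1} = y_i e_{i+1}`),
and a factor `x i` by each removal of a loop of height `i` and one U-turn box in row `i`. Hence the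
number of boxes lost in row `i` is `loopCount C D i + yCount i + yCount (i - 1)`. -/
noncomputable def yCount {N : ℕ} (C D E : OkadaDiagram N) : ℕ → ℕ
  | 0 => 0
  | i + 1 => boxCount C (i + 1) + boxCount D (i + 1) -
      (boxCount E (i + 1) + loopCount C D (i + 1) + yCount C D E i)

/-- The underlying vector space of the diagram algebra, with basis the Okada arc-diagrams. -/
abbrev OkArc (K : Type*) [Field K] (N : ℕ) := OkadaDiagram N →₀ K

open Classical in
/-- The product `C · D = X^ℓ Y^m [C ∘ D]` of two basis diagrams. (The concatenation of two Okada
arc-diagrams always determines an Okada arc-diagram, so the second branch is never used.) -/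
noncomputable def diagramMul {K : Type*} [Field K] {N : ℕ} (x y : ℕ → K) (C D : OkadaDiagram N) :
    OkArc K N :=
  if h : ∃ E, IsComposition C D E then
    Finsupp.single h.choose
      ((∏ k ∈ Finset.Icc 1 (N - 1), x k ^ loopCount C D k) *
        ∏ k ∈ Finset.Icc 1 (N - 2), y k ^ yCount C D h.choose k)
  else 0

/-- The product of the diagram algebra with parameters `x`, `y`, extended bilinearly. -/
noncomputable def OkArc.mul {K : Type*} [Field K] {N : ℕ} (x y : ℕ → K) (f g : OkArc K N) :
    OkArc K N :=
  f.sum fun C a => g.sum fun D b => (a * b) • diagramMul x y C D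

/-- The linear extension of the mirror map. -/
noncomputable def OkArc.mirror {K : Type*} [Field K] {N : ℕ} : OkArc K N →ₗ[K] OkArc K N :=
  Finsupp.lmapDomain K K OkadaDiagram.mirror

/-! ### The Okada algebra -/

/-- The indices `1 ≤ i ≤ N - 1` of the generators. -/
abbrev GenIdx (N : ℕ) := {i : ℕ // 1 ≤ i ∧ i < N}

/-- The defining relations of the Okada algebra. -/
inductive OkadaRel {K : Type*} [Field K] (N : ℕ) (x y : ℕ → K) :
    FreeAlgebra K (GenIdx N) → FreeAlgebra K (GenIdx N) → Prop
  | sq (i : GenIdx N) : OkadaRel N x y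
      (FreeAlgebra.ι K i * FreeAlgebra.ι K i) (x i.val • FreeAlgebra.ι K i)
  | comm (i j : GenIdx N) (h : i.val + 2 ≤ j.val ∨ j.val + 2 ≤ i.val) : OkadaRel N x y
      (FreeAlgebra.ι K i * FreeAlgebra.ι K j) (FreeAlgebra.ι K j * FreeAlgebra.ι K i)
  | contract (i j : GenIdx N) (h : j.val = i.val + 1) : OkadaRel N x y
      (FreeAlgebra.ι K j * FreeAlgebra.ι K i * FreeAlgebra.ι K j) (y i.val • FreeAlgebra.ι K j)

/-- The Okada algebra of rank `N` with parameters `x 1, …, x (N-1)` and `y 1, …, y (N-2)`. -/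
abbrev OkadaAlgebra {K : Type*} [Field K] (N : ℕ) (x y : ℕ → K) := RingQuot (OkadaRel N x y)

/-- The generator `e_i` (only used for `1 ≤ i < N`). -/
noncomputable def OkadaAlgebra.gen {K : Type*} [Field K] (N : ℕ) (x y : ℕ → K) (i : ℕ) :
    OkadaAlgebra N x y :=
  if h : 1 ≤ i ∧ i < N then RingQuot.mkAlgHom K (OkadaRel N x y) (FreeAlgebra.ι K ⟨i, h⟩) else 1

/-- The entry of index `i + 1` of the code of `σ`: the number of `j < i` such that
`σ⁻¹ j > σ⁻¹ i`. -/
def permCode {N : ℕ} (σ : Equiv.Perm (Fin N)) (i : Fin N) : ℕ :=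
  (Finset.univ.filter fun j : Fin N => j < i ∧ σ⁻¹ i < σ⁻¹ j).card

/-- The element `e_σ`, the product over `i = 1, …, N` (increasing from left to right) of
`e_{i-1} e_{i-2} ⋯ e_{i-c_i}`, where `(c_1, …, c_N)` is the code of `σ`. Below, `i : Fin N` stands
for the index `i + 1`. -/
noncomputable def OkadaAlgebra.permElem {K : Type*} [Field K] {N : ℕ} (x y : ℕ → K)
    (σ : Equiv.Perm (Fin N)) : OkadaAlgebra N x y :=
  ((List.finRange N).map fun i =>
    ((List.range (permCode σ i)).map fun k => OkadaAlgebra.gen N x y (i.val - k)).prod).prod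

/-- The map `Θ` from the Okada algebra to the diagram algebra: the extension of `e_i ↦ G_i` to a
linear map compatible with the units and the products. -/
def IsTheta {K : Type*} [Field K] {N : ℕ} (x y : ℕ → K)
    (Θ : OkadaAlgebra N x y →ₗ[K] OkArc K N) : Prop :=
  Θ 1 = Finsupp.single (OkadaDiagram.id N) 1 ∧
  (∀ a b, Θ (a * b) = OkArc.mul x y (Θ a) (Θ b)) ∧
  ∀ (i : ℕ) (hi : 1 ≤ i ∧ i < N),
    Θ (OkadaAlgebra.gen N x y i) = Finsupp.single (OkadaDiagram.elem i hi) 1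

/-! ### Half arc-diagrams -/

/-- A rank `N` Okada half arc-diagram on the nodes `1, …, N` (the node `a + 1` is `a : Fin N`).
A fixed point of the involution `partner` carries a half arc (a propagating arc with a free end),
the other nodes are joined by full arcs. -/
@[ext]
structure HalfDiagram (N : ℕ) where
  partner : Fin N → Fin N
  label : Fin N → ℕ
  partner_partner : ∀ a, partner (partner a) = a
  noncrossing : ∀ a c, ¬ (a < c ∧ c < partner a ∧ partner a < partner c)
  /-- A half arc does not cross a full arc. -/
  half_noncrossing : ∀ a c, partner c = c → ¬ (a < c ∧ c < partner a)
  label_partner : ∀ a, label (partner a) = label a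
  one_le_label : ∀ a, 1 ≤ label a
  label_le : ∀ a, label a ≤ min (a.val + 1) ((partner a).val + 1)
  label_parity : ∀ a, label a % 2 = min (a.val + 1) ((partner a).val + 1) % 2
  label_nested : ∀ a c, c < a → a < partner a → partner a < partner c → label c < label a
  /-- Every (full or half) arc above a half arc is nested in it. -/
  label_half : ∀ a c, partner c = c → c < a → label c < label a

theorem Node.pos_lt {N : ℕ} (a : Node N) : a.pos < 2 * N := by
  rcases a with a | a <;> have := a.isLt <;> simp only [Node.pos] <;> omega

theorem Node.pos_injective {N : ℕ} : Function.Injective (Node.pos (N := N)) := by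
  intro a b h
  rcases a with a | a <;> rcases b with b | b <;> have := a.isLt <;> have := b.isLt <;>
    simp only [Node.pos] at h <;> simp [Fin.ext_iff] <;> omega

theorem Node.exists_pos {N : ℕ} (k : ℕ) (hk : k < 2 * N) : ∃ a : Node N, a.pos = k := by
  by_cases h : k < N
  · exact ⟨Sum.inl ⟨k, h⟩, rfl⟩
  · exact ⟨Sum.inr ⟨2 * N - 1 - k, by omega⟩, by simp only [Node.pos]; omega⟩

/-- The two ends of an arc have positions of different parity. -/
theorem OkadaDiagram.pos_partner {N : ℕ} (D : OkadaDiagram N) (a : Node N)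
    (ha : a.pos < (D.partner a).pos) : (D.partner a).pos % 2 ≠ a.pos % 2 := by
  classical
  let s : Finset (Node N) := Finset.univ.filter fun u => a.pos < u.pos ∧ u.pos < (D.partner a).pos
  have hs : s.card = (Finset.Ioo a.pos (D.partner a).pos).card := by
    refine Finset.card_bij (fun u _ => u.pos) ?_ ?_ ?_
    · intro u hu
      simpa [s] using hu
    · intro u _ v _ h
      exact Node.pos_injective h
    · intro k hk
      have hk' := Finset.mem_Ioo.1 hk
      obtain ⟨u, rfl⟩ := Node.exists_pos (N := N) k (hk'.2.trans (Node.pos_lt _))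
      exact ⟨u, by simpa [s] using hk, rfl⟩
  have hz : ∑ _u ∈ s, (1 : ZMod 2) = 0 := by
    refine Finset.sum_involution (fun u _ => D.partner u) ?_ ?_ ?_ ?_
    · intro u _; decide
    · intro u _ _; exact D.partner_ne u
    · intro u hu
      have hu' : a.pos < u.pos ∧ u.pos < (D.partner a).pos := by simpa [s] using hu
      have h1 := D.noncrossing a u
      have h2 := D.noncrossing (D.partner u) a
      rw [D.partner_partner] at h2
      have n1 : (D.partner u).pos ≠ a.pos := fun h => by
        have h3 := Node.pos_injective h
        have h4 : u = D.partner a := by rw [← h3, D.partner_partner]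
        rw [h4] at hu'; omega
      have n2 : (D.partner u).pos ≠ (D.partner a).pos := fun h => by
        have h3 := Node.pos_injective h
        have h4 : u = a := by rw [← D.partner_partner u, h3, D.partner_partner]
        rw [h4] at hu'; omega
      simp only [s, Finset.mem_filter, Finset.mem_univ, true_and]
      omega
    · intro u _; exact D.partner_partner u
  rw [Finset.sum_const, nsmul_one, ZMod.natCast_eq_zero_iff, hs, Nat.card_Ioo] at hz
  omega

/-- The partner map of the left half of a diagram: the node itself if its arc is propagating. -/
def leftPartner {N : ℕ} (D : OkadaDiagram N) (a : Fin N) : Fin N :=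
  match D.partner (Sum.inl a) with
  | Sum.inl b => b
  | Sum.inr _ => a

theorem leftPartner_cases {N : ℕ} (D : OkadaDiagram N) (a : Fin N) :
    (D.partner (Sum.inl a) = Sum.inl (leftPartner D a) ∧ leftPartner D a ≠ a) ∨
    (∃ b, D.partner (Sum.inl a) = Sum.inr b ∧ leftPartner D a = a ∧
      (a.val + 1) % 2 = (b.val + 1) % 2) := by
  rcases h : D.partner (Sum.inl a) with b | b
  · left
    have : leftPartner D a = b := by simp [leftPartner, h]
    refine ⟨by rw [this], ?_⟩
    rw [this]
    rintro rfl
    exact D.partner_ne _ h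
  · right
    refine ⟨b, rfl, by simp [leftPartner, h], ?_⟩
    have := D.pos_partner (Sum.inl a)
    rw [h] at this
    have h1 := a.isLt
    have h2 := b.isLt
    simp only [Node.pos] at this
    omega

/-- The left half (bra) of an Okada arc-diagram, obtained by cutting it in the middle. -/
def OkadaDiagram.bra {N : ℕ} (D : OkadaDiagram N) : HalfDiagram N where
  partner := leftPartner D
  label a := D.label (Sum.inl a)
  partner_partner a := by
    rcases leftPartner_cases D a with ⟨h, -⟩ | ⟨b, -, h, -⟩
    · have := D.partner_partner (Sum.inl a)
      rw [h] at this
      have hb : ∀ b, D.partner (Sum.inl b) = Sum.inl a → leftPartner D b = a := fun b hb => by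
        simp [leftPartner, hb]
      exact hb _ this
    · rw [h, h]
  noncrossing a c := by
    have hx := D.noncrossing (Sum.inl a) (Sum.inl c)
    rcases leftPartner_cases D a with ⟨h, -⟩ | ⟨b, h0, h, -⟩ <;>
      rcases leftPartner_cases D c with ⟨h', -⟩ | ⟨b', h0', h', -⟩
    · rw [h, h'] at hx
      exact hx
    all_goals rintro ⟨h1, h2, h3⟩; simp only [h, h', Fin.lt_def] at *; omega
  half_noncrossing a c hc := by
    have hx := D.noncrossing (Sum.inl a) (Sum.inl c)
    rintro ⟨h1, h2⟩
    rcases leftPartner_cases D a with ⟨h, -⟩ | ⟨b, h0, h, -⟩ <;>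
      rcases leftPartner_cases D c with ⟨h', hne⟩ | ⟨b', h0', h', -⟩
    · exact hne hc
    · apply hx
      rw [h, h0']
      have := (leftPartner D a).isLt
      have := b'.isLt
      simp only [Node.pos, Fin.lt_def] at *
      omega
    all_goals rw [h] at h2; exact absurd h1 (not_lt.2 h2.le)
  label_partner a := by
    have hl := D.label_partner (Sum.inl a)
    rcases leftPartner_cases D a with ⟨h, -⟩ | ⟨b, h0, h, -⟩
    · rwa [h] at hl
    · rw [h]
  one_le_label a := D.one_le_label _
  label_le a := by
    have hl := D.label_le (Sum.inl a)
    rcases leftPartner_cases D a with ⟨h, -⟩ | ⟨b, h0, h, -⟩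
    · rw [h] at hl
      exact hl
    · rw [h0] at hl
      rw [h]
      simp only [Node.level] at hl
      omega
  label_parity a := by
    have hl := D.label_parity (Sum.inl a)
    rcases leftPartner_cases D a with ⟨h, -⟩ | ⟨b, h0, h, hp⟩
    · rw [h] at hl
      exact hl
    · rw [h0] at hl
      rw [h]
      simp only [Node.level] at hl
      omega
  label_nested a c h1 h2 h3 := by
    have hx := D.label_nested (Sum.inl a) (Sum.inl c)
    rcases leftPartner_cases D a with ⟨h, -⟩ | ⟨b, h0, h, -⟩ <;>
      rcases leftPartner_cases D c with ⟨h', -⟩ | ⟨b', h0', h', -⟩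
    · rw [h, h'] at hx
      exact hx h1 h2 h3
    all_goals simp only [h, h', Fin.lt_def] at *; omega
  label_half a c hc hca := by
    rcases leftPartner_cases D c with ⟨-, hne⟩ | ⟨d, hd, -, -⟩
    · exact absurd hc hne
    have key : ∀ a : Fin N, c < a → Node.pos (Sum.inl a) < (D.partner (Sum.inl a)).pos →
        D.label (Sum.inl c) < D.label (Sum.inl a) := by
      intro a hca ha
      have hx := D.label_nested (Sum.inl a) (Sum.inl c)
      have hy := D.noncrossing (Sum.inl c) (Sum.inl a)
      have hne : (D.partner (Sum.inl a)).pos ≠ (D.partner (Sum.inl c)).pos := fun h => by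
        have h1 := congrArg D.partner (Node.pos_injective h)
        rw [D.partner_partner, D.partner_partner] at h1
        exact hca.ne' (Sum.inl.inj h1)
      have h1 := a.isLt
      have h2 := d.isLt
      rw [hd] at hx hy hne
      have hca' : Node.pos (Sum.inl c) < Node.pos (Sum.inl a) := hca
      have : Node.pos (Sum.inl a) < Node.pos (Sum.inr d) := by
        simp only [Node.pos]; omega
      apply hx hca' ha
      omega
    rcases leftPartner_cases D a with ⟨h, hne⟩ | ⟨b, h0, h, -⟩
    · rcases lt_or_gt_of_ne hne with hlt | hlt
      · have hl := D.label_partner (Sum.inl a)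
        rw [← hl, h]
        have hpp := D.partner_partner (Sum.inl a)
        rw [h] at hpp
        apply key
        · by_contra hcon
          have hne2 : c ≠ leftPartner D a := by
            rintro rfl
            rw [hpp] at hd
            cases hd
          have hx := D.noncrossing (Sum.inl (leftPartner D a)) (Sum.inl c)
          have h1 := a.isLt
          have h2 := d.isLt
          rw [hpp, hd] at hx
          simp only [Node.pos, Fin.lt_def, Fin.ext_iff, ne_eq] at *
          omega
        · rw [hpp]
          exact hlt
      · apply key a hca
        rw [h]
        exact hlt
    · apply key a hca
      rw [h0]
      have h1 := a.isLt
      have h2 := b.isLt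
      simp only [Node.pos]
      omega

/-- The ket of `D`: the bra of its mirror. -/
def OkadaDiagram.ket {N : ℕ} (D : OkadaDiagram N) : HalfDiagram N := D.mirror.bra

/-- `D` is the gluing of the half diagrams `L` and `R`. -/
def IsGluing {N : ℕ} (L R : HalfDiagram N) (D : OkadaDiagram N) : Prop :=
  D.bra = L ∧ D.ket = R

/-- The set of the height labels of the propagating (half) arcs. -/
def HalfDiagram.propLabels {N : ℕ} (H : HalfDiagram N) : Finset ℕ :=
  (Finset.univ.filter fun a => H.partner a = a).image H.label

/-- The `r`-restriction: full arcs inside `{1, …, r}` are kept, and a half arc at `a ≤ r` or a full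
arc `a — b` with `a ≤ r < b` gives a half arc at `a` with the same label. -/
def HalfDiagram.restrict {N : ℕ} (H : HalfDiagram N) (r : ℕ) (hr : r ≤ N) : HalfDiagram r where
  partner a := if h : (H.partner (a.castLE hr)).val < r then ⟨_, h⟩ else a
  label a := H.label (a.castLE hr)
  partner_partner a := by
    have := H.partner_partner (a.castLE hr)
    by_cases h : (H.partner (a.castLE hr)).val < r
    · simp [h, this]
    · simp [h]
  noncrossing a c := by
    have := H.noncrossing (a.castLE hr) (c.castLE hr)
    split_ifs <;> simp only [Fin.lt_def, Fin.val_castLE] at * <;> omega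
  half_noncrossing a c hc := by
    have h1 := H.noncrossing (a.castLE hr) (c.castLE hr)
    have h2 := H.half_noncrossing (a.castLE hr) (c.castLE hr)
    split_ifs at * <;> simp only [Fin.lt_def, Fin.ext_iff, Fin.val_castLE] at * <;> omega
  label_partner a := by
    have h1 := H.label_partner (a.castLE hr)
    split_ifs
    · exact h1
    · rfl
  one_le_label a := H.one_le_label _
  label_le a := by
    have h1 := H.label_le (a.castLE hr)
    split_ifs <;> simp only [Fin.val_castLE] at * <;> omega
  label_parity a := by
    have h1 := H.label_parity (a.castLE hr)
    split_ifs <;> simp only [Fin.val_castLE] at * <;> omega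
  label_nested a c := by
    have h1 := H.label_nested (a.castLE hr) (c.castLE hr)
    split_ifs <;> simp only [Fin.lt_def, Fin.val_castLE] at * <;> omega
  label_half a c hc hca := by
    by_cases hcc : H.partner (c.castLE hr) = c.castLE hr
    · exact H.label_half _ _ hcc hca
    have hd : r ≤ (H.partner (c.castLE hr)).val := by
      by_contra hlt
      rw [dif_pos (not_le.1 hlt)] at hc
      exact hcc (by ext; simpa [Fin.ext_iff] using hc)
    have ha := a.isLt
    have e1 := H.partner_partner (a.castLE hr)
    have e2 := H.partner_partner (c.castLE hr)
    have e3 := H.label_partner (a.castLE hr)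
    have h1 := H.half_noncrossing (c.castLE hr) (a.castLE hr)
    have h2 := H.noncrossing (c.castLE hr) (a.castLE hr)
    have h3 := H.noncrossing (H.partner (a.castLE hr)) (c.castLE hr)
    have h4 := H.label_nested (a.castLE hr) (c.castLE hr)
    have h5 := H.label_nested (H.partner (a.castLE hr)) (c.castLE hr)
    have n1 : (H.partner (a.castLE hr)).val ≠ (H.partner (c.castLE hr)).val := fun h => by
      rw [Fin.ext h, e2] at e1
      exact hca.ne (Fin.castLE_injective hr e1)
    have n2 : (H.partner (a.castLE hr)).val ≠ c.val := fun h => by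
      have h6 : H.partner (a.castLE hr) = c.castLE hr := Fin.ext h
      have h7 : (H.partner (c.castLE hr)).val = a.val := by rw [← h6, e1]; rfl
      omega
    rw [e1] at h3 h5
    rw [e3] at h5
    simp only [Fin.lt_def, Fin.ext_iff, Fin.val_castLE] at *
    omega

/-! ### Fibonacci sets and Fomin's correspondence -/

/-- A Fibonacci set of rank `N`: a subset `{s_1 < ⋯ < s_k}` of `{1, …, N}` such that `k ≡ N` and
`s_ℓ ≡ ℓ` modulo `2`. The rank is part of the data. -/
@[ext]
structure FibSet where
  rank : ℕ
  carrier : Finset ℕ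
  subset : carrier ⊆ Finset.Icc 1 rank
  card_parity : carrier.card % 2 = rank % 2
  parity : ∀ s ∈ carrier, s % 2 = (carrier.filter (· ≤ s)).card % 2

/-- The empty Fibonacci set of rank `0`. -/
def FibSet.empty : FibSet := ⟨0, ∅, by simp, by simp, by simp⟩

/-- The Fibonacci set with Fibonacci word `1w`, where `w` is the word of `S`. -/
def FibSet.addOne (S : FibSet) : FibSet where
  rank := S.rank + 1
  carrier := insert (S.rank + 1) S.carrier
  subset := by
    have := S.subset
    intro s hs
    rcases Finset.mem_insert.1 hs with rfl | hs
    · simp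
    · have := Finset.mem_Icc.1 (this hs)
      simp; omega
  card_parity := by
    have h : S.rank + 1 ∉ S.carrier := fun h => by
      have := Finset.mem_Icc.1 (S.subset h); omega
    have := S.card_parity
    rw [Finset.card_insert_of_notMem h]; omega
  parity := by
    have h : S.rank + 1 ∉ S.carrier := fun h => by
      have := Finset.mem_Icc.1 (S.subset h); omega
    intro s hs
    rcases Finset.mem_insert.1 hs with rfl | hs
    · rw [Finset.filter_true_of_mem, Finset.card_insert_of_notMem h]
      · have := S.card_parity; omega
      · intro t ht
        rcases Finset.mem_insert.1 ht with rfl | ht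
        · exact le_rfl
        · have := Finset.mem_Icc.1 (S.subset ht); omega
    · have h2 := Finset.mem_Icc.1 (S.subset hs)
      rw [Finset.filter_insert, if_neg (by omega)]
      exact S.parity s hs

/-- The Fibonacci set with Fibonacci word `2w`, where `w` is the word of `S`. -/
def FibSet.addTwo (S : FibSet) : FibSet where
  rank := S.rank + 2
  carrier := S.carrier
  subset := S.subset.trans (Finset.Icc_subset_Icc le_rfl (by omega))
  card_parity := by have := S.card_parity; omega
  parity := S.parity

open Classical in
/-- Fomin's local rule for the Young–Fibonacci lattice: the fourth corner of a cell with lower left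
corner `t` and neighbouring corners `p`, `q`, where `mark` says that the
cell is marked. -/
noncomputable def fominRule (mark : Prop) (t p q : FibSet) : FibSet :=
  if p = t ∧ q = t then (if mark then t.addOne else t)
  else if p = t then q
  else if q = t then p
  else t.addTwo

/-- The growth diagram of `σ`: the cell in column `i` and row `j` is marked if `σ i = j`. -/
noncomputable def fominGrowth {N : ℕ} (σ : Equiv.Perm (Fin N)) : ℕ → ℕ → FibSet
  | 0, _ => FibSet.empty
  | _ + 1, 0 => FibSet.empty
  | i + 1, j + 1 => fominRule (∃ h : i < N, (σ ⟨i, h⟩).val = j)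
      (fominGrowth σ i j) (fominGrowth σ i (j + 1)) (fominGrowth σ (i + 1) j)
termination_by i j => (i, j)

/-- The first chain of the pair assigned to `σ` (the analogue of the insertion tableau): the right
boundary of the growth diagram, indexed by the values of `σ`. -/
noncomputable def fominP {N : ℕ} (σ : Equiv.Perm (Fin N)) (j : ℕ) : FibSet := fominGrowth σ N j

/-- The second chain of the pair assigned to `σ` (the analogue of the recording tableau): the upper
boundary of the growth diagram, indexed by the positions of `σ`. -/
noncomputable def fominQ {N : ℕ} (σ : Equiv.Perm (Fin N)) (i : ℕ) : FibSet := fominGrowth σ i N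

/-- The chain of the half diagram `H`, the sequence of the Fibonacci sets of rank `r` formed by the
propagating labels of the `r`-restrictions of `H` for `0 ≤ r ≤ N`, is `C`. -/
def HalfDiagram.HasChain {N : ℕ} (H : HalfDiagram N) (C : ℕ → FibSet) : Prop :=
  ∀ (r : ℕ) (hr : r ≤ N), (C r).rank = r ∧ (C r).carrier = (H.restrict r hr).propLabels

/-!
The composition of a diagram `D` with `G i` on the right is a surgery on the two arcs at the right
nodes of levels `i` and `i + 1`, and it closes at most one loop. Following the vertex sets of the
loops and counting the passages of strands through the rows shows that this surgery is compatible
with the composition `C ∘ D`, with its loops and with the exponents `m`. Every diagram arises from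
the empty one by insertions of arcs joining adjacent positions, and such an insertion amounts to
adding a propagating arc and multiplying by some `G i`. So every diagram is a product of elementary
diagrams in which neither a loop nor a parameter `y` ever appears, and by induction along such a
product, compositions exist and `(v · w) · G i = v · (w · G i)`. The right multiplications by the
`G i` satisfy the relations of the Okada algebra, and `Θ` is the resulting action on the identity
diagram.

For the correspondence, `e_σ` is built up by inserting one arc for each value of `σ`, in increasing
order. Deleting the largest value of `σ` changes the growth diagram in the same way as deleting the
inserted arc changes the labels of the arcs that cross a cut, so the halves of the diagram of `e_σ`
have the chains `P` and `Q`. A half diagram is determined by its chain and a diagram by its halves,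
and passing from `σ` to its inverse transposes the growth diagram, which exchanges the two halves.
-/

/-! ### Diagrams in terms of positions -/

theorem Node.level_eq {N : ℕ} (a : Node N) : a.level = min (a.pos + 1) (2 * N - a.pos) := by
  rcases a with a | a <;> have := a.isLt <;> simp only [Node.level, Node.pos] <;> omega

/-- The node at position `k`, the inverse of `Node.pos`. -/
def Node.ofPos {N : ℕ} (k : ℕ) (hk : k < 2 * N) : Node N :=
  if h : k < N then Sum.inl ⟨k, h⟩ else Sum.inr ⟨2 * N - 1 - k, by omega⟩

theorem Node.pos_ofPos {N : ℕ} (k : ℕ) (hk : k < 2 * N) : (Node.ofPos k hk).pos = k := by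
  unfold Node.ofPos
  split_ifs <;> simp only [Node.pos]
  omega

theorem Node.ofPos_pos {N : ℕ} (u : Node N) : Node.ofPos u.pos u.pos_lt = u :=
  Node.pos_injective (Node.pos_ofPos _ _)

theorem Node.forall_pos {N : ℕ} {Q : ℕ → Prop} (h : ∀ u : Node N, Q u.pos) (k : ℕ)
    (hk : k < 2 * N) : Q k :=
  Node.pos_ofPos k hk ▸ h (Node.ofPos k hk)

theorem mem_uIoo_iff {α : Type*} [LinearOrder α] {u v y : α} :
    y ∈ Set.uIoo u v ↔ u < y ∧ y < v ∨ v < y ∧ y < u := by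
  rw [Set.uIoo_eq_union]
  rfl

/-- The axioms of an Okada arc-diagram of rank `N` for a partner map `P` and a labelling `L` of the
positions `0, …, 2N - 1` of the nodes. The ends of an arc have positions of opposite parity since
the matching is non-crossing, and so the smaller of the levels of the ends has the parity of the
larger position. -/
structure IsArcSystem (N : ℕ) (P L : ℕ → ℕ) : Prop where
  lt : ∀ k < 2 * N, P k < 2 * N
  partner_parity : ∀ k < 2 * N, P k % 2 ≠ k % 2
  partner_partner : ∀ k < 2 * N, P (P k) = k
  noncrossing : ∀ u < 2 * N, ∀ v < 2 * N, v ∈ Set.uIoo u (P u) → P v ∈ Set.uIoo u (P u)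
  label_partner : ∀ k < 2 * N, L (P k) = L k
  one_le : ∀ k < 2 * N, 1 ≤ L k
  le : ∀ k < 2 * N, L k ≤ k + 1 ∧ L k ≤ 2 * N - k
  label_parity : ∀ k < 2 * N, L k % 2 = max k (P k) % 2
  nested : ∀ u < 2 * N, ∀ v < 2 * N, v ∈ Set.uIoo u (P u) → L u < L v

namespace IsArcSystem

variable {N : ℕ} {P L : ℕ → ℕ}

theorem partner_ne (h : IsArcSystem N P L) {k : ℕ} (hk : k < 2 * N) : P k ≠ k :=
  fun e => h.partner_parity k hk (congrArg (· % 2) e)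

theorem partner_inj (h : IsArcSystem N P L) {u v : ℕ} (hu : u < 2 * N) (hv : v < 2 * N) :
    P u = P v ↔ u = v :=
  ⟨fun e => by rw [← h.partner_partner u hu, e, h.partner_partner v hv], congrArg P⟩

theorem partner_eq_iff (h : IsArcSystem N P L) {u v : ℕ} (hu : u < 2 * N) (hv : v < 2 * N) :
    P u = v ↔ u = P v := by
  rw [← h.partner_inj hu (h.lt v hv), h.partner_partner v hv]

theorem partner_mem_uIoo (h : IsArcSystem N P L) {u v : ℕ} (hu : u < 2 * N) (hv : v < 2 * N) :
    P v ∈ Set.uIoo u (P u) ↔ v ∈ Set.uIoo u (P u) :=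
  ⟨fun hm => h.partner_partner v hv ▸ h.noncrossing u hu _ (h.lt v hv) hm,
    h.noncrossing u hu v hv⟩

/-- The diagram given by an arc system. -/
def toDiagram (h : IsArcSystem N P L) : OkadaDiagram N where
  partner u := Node.ofPos (P u.pos) (h.lt _ u.pos_lt)
  label u := L u.pos
  partner_ne u e := h.partner_ne u.pos_lt (by
    rw [← Node.pos_ofPos (P u.pos) (h.lt _ u.pos_lt), e])
  partner_partner u := Node.pos_injective (by
    rw [Node.pos_ofPos, Node.pos_ofPos, h.partner_partner _ u.pos_lt])
  noncrossing u v := by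
    have hm := h.partner_mem_uIoo u.pos_lt v.pos_lt
    simp only [Node.pos_ofPos, mem_uIoo_iff] at hm ⊢
    omega
  label_partner u := by rw [Node.pos_ofPos, h.label_partner _ u.pos_lt]
  one_le_label u := h.one_le _ u.pos_lt
  label_le u := by
    have hu := h.le _ u.pos_lt
    have hPu := h.le _ (h.lt _ u.pos_lt)
    rw [h.label_partner _ u.pos_lt] at hPu
    rw [Node.level_eq, Node.level_eq, Node.pos_ofPos]
    omega
  label_parity u := by
    have hp := h.partner_parity _ u.pos_lt
    have hlt := h.lt _ u.pos_lt
    rw [Node.level_eq, Node.level_eq, Node.pos_ofPos, h.label_parity _ u.pos_lt]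
    have := u.pos_lt
    rcases lt_or_gt_of_ne (h.partner_ne u.pos_lt) with _ | _ <;>
      rcases lt_or_ge u.pos N with _ | _ <;> rcases lt_or_ge (P u.pos) N with _ | _ <;> omega
  label_nested u v h₁ h₂ h₃ := by
    simp only [Node.pos_ofPos] at h₂ h₃
    exact h.nested _ v.pos_lt _ u.pos_lt (Set.mem_uIoo_of_lt h₁ (h₂.trans h₃))

end IsArcSystem

namespace OkadaDiagram

variable {N : ℕ}

/-- The partner map in terms of positions. Positions outside the diagram are fixed. -/
def partnerAt (D : OkadaDiagram N) (k : ℕ) : ℕ :=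
  if h : k < 2 * N then (D.partner (Node.ofPos k h)).pos else k

/-- The labelling in terms of positions. Positions outside the diagram have the label `0`. -/
def labelAt (D : OkadaDiagram N) (k : ℕ) : ℕ :=
  if h : k < 2 * N then D.label (Node.ofPos k h) else 0

theorem partnerAt_of_le (D : OkadaDiagram N) {k : ℕ} (hk : 2 * N ≤ k) : D.partnerAt k = k :=
  dif_neg hk.not_gt

theorem labelAt_of_le (D : OkadaDiagram N) {k : ℕ} (hk : 2 * N ≤ k) : D.labelAt k = 0 :=
  dif_neg hk.not_gt

theorem partnerAt_pos (D : OkadaDiagram N) (u : Node N) :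
    D.partnerAt u.pos = (D.partner u).pos := by
  rw [partnerAt, dif_pos u.pos_lt, Node.ofPos_pos]

theorem labelAt_pos (D : OkadaDiagram N) (u : Node N) : D.labelAt u.pos = D.label u := by
  rw [labelAt, dif_pos u.pos_lt, Node.ofPos_pos]

theorem pos_partner_parity (D : OkadaDiagram N) (u : Node N) :
    (D.partner u).pos % 2 ≠ u.pos % 2 := by
  have h₁ := D.pos_partner u
  have h₂ := D.pos_partner (D.partner u)
  rw [D.partner_partner] at h₂
  have := Node.pos_injective.ne (D.partner_ne u)
  omega

theorem pos_partner_mem_uIoo (D : OkadaDiagram N) (u v : Node N)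
    (hv : v.pos ∈ Set.uIoo u.pos (D.partner u).pos) :
    (D.partner v).pos ∈ Set.uIoo u.pos (D.partner u).pos := by
  have hu' : (D.partner v).pos ≠ u.pos := fun e => by
    rw [← Node.pos_injective e, D.partner_partner] at hv
    exact Set.right_notMem_uIoo hv
  have hpu : (D.partner v).pos ≠ (D.partner u).pos := fun e => by
    have := congrArg D.partner (Node.pos_injective e)
    rw [D.partner_partner, D.partner_partner] at this
    exact Set.left_notMem_uIoo (this ▸ hv)
  have h₁ := D.noncrossing u v
  have h₂ := D.noncrossing (D.partner u) v
  have h₃ := D.noncrossing (D.partner v) u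
  have h₄ := D.noncrossing (D.partner v) (D.partner u)
  rw [D.partner_partner] at h₂ h₃
  rw [D.partner_partner, D.partner_partner] at h₄
  rw [mem_uIoo_iff] at hv ⊢
  omega

theorem label_lt_of_mem_uIoo (D : OkadaDiagram N) (u v : Node N)
    (hv : v.pos ∈ Set.uIoo u.pos (D.partner u).pos) : D.label u < D.label v := by
  have hpv := D.pos_partner_mem_uIoo u v hv
  have hne := Node.pos_injective.ne (D.partner_ne v)
  have h₁ := D.label_nested v u
  have h₂ := D.label_nested v (D.partner u)
  have h₃ := D.label_nested (D.partner v) u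
  have h₄ := D.label_nested (D.partner v) (D.partner u)
  simp only [D.partner_partner, D.label_partner] at h₁ h₂ h₃ h₄
  rw [mem_uIoo_iff] at hv hpv
  omega

theorem isArcSystem (D : OkadaDiagram N) : IsArcSystem N D.partnerAt D.labelAt where
  lt := Node.forall_pos fun u => by rw [partnerAt_pos]; exact Node.pos_lt _
  partner_parity := Node.forall_pos fun u => by rw [partnerAt_pos]; exact D.pos_partner_parity u
  partner_partner := Node.forall_pos fun u => by
    rw [partnerAt_pos, partnerAt_pos, D.partner_partner]
  noncrossing := Node.forall_pos fun u => Node.forall_pos fun v => by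
    rw [partnerAt_pos, partnerAt_pos]; exact D.pos_partner_mem_uIoo u v
  label_partner := Node.forall_pos fun u => by
    rw [partnerAt_pos, labelAt_pos, labelAt_pos, D.label_partner]
  one_le := Node.forall_pos fun u => by rw [labelAt_pos]; exact D.one_le_label u
  le := Node.forall_pos fun u => by
    have := D.label_le u
    rw [Node.level_eq] at this
    rw [labelAt_pos]; omega
  label_parity := Node.forall_pos fun u => by
    have hpar := D.pos_partner_parity u
    have hu := u.pos_lt
    have hpu := (D.partner u).pos_lt
    rw [labelAt_pos, partnerAt_pos, D.label_parity, Node.level_eq, Node.level_eq]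
    rcases lt_or_ge u.pos (D.partner u).pos with _ | _ <;>
      rcases lt_or_ge u.pos N with _ | _ <;> rcases lt_or_ge (D.partner u).pos N with _ | _ <;>
      omega
  nested := Node.forall_pos fun u => Node.forall_pos fun v => by
    rw [partnerAt_pos, labelAt_pos, labelAt_pos]; exact D.label_lt_of_mem_uIoo u v

theorem partnerAt_toDiagram {P L : ℕ → ℕ} (h : IsArcSystem N P L) {k : ℕ} (hk : k < 2 * N) :
    h.toDiagram.partnerAt k = P k := by
  rw [partnerAt, dif_pos hk]
  simp only [IsArcSystem.toDiagram, Node.pos_ofPos]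

theorem labelAt_toDiagram {P L : ℕ → ℕ} (h : IsArcSystem N P L) {k : ℕ} (hk : k < 2 * N) :
    h.toDiagram.labelAt k = L k := by
  rw [labelAt, dif_pos hk]
  simp only [IsArcSystem.toDiagram, Node.pos_ofPos]

theorem ext_pos {D E : OkadaDiagram N} (hp : ∀ k < 2 * N, D.partnerAt k = E.partnerAt k)
    (hl : ∀ k < 2 * N, D.labelAt k = E.labelAt k) : D = E := by
  refine OkadaDiagram.ext (funext fun u => Node.pos_injective ?_) (funext fun u => ?_)
  · rw [← partnerAt_pos, ← partnerAt_pos, hp _ u.pos_lt]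
  · rw [← labelAt_pos, ← labelAt_pos, hl _ u.pos_lt]

end OkadaDiagram

/-! ### Surgery on two arcs -/

/-- The partner map after the arcs at the positions `a` and `b` are replaced by the arcs
`{a, b}` and `{P a, P b}`. -/
def surgeryPartner (P : ℕ → ℕ) (a b k : ℕ) : ℕ :=
  if k = a then b else if k = b then a else if k = P a then P b else if k = P b then P a else P k

/-- The labels after the arcs at the positions `a` and `b` are replaced by the arc `{a, b}` with
label `i` and the arc `{P a, P b}` with the minimum of the two old labels. -/
def surgeryLabel (P L : ℕ → ℕ) (a b i k : ℕ) : ℕ :=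
  if k = a ∨ k = b then i else if k = P a ∨ k = P b then min (L a) (L b) else L k

theorem mem_uIoo_succ_iff {u v a : ℕ} (h₁ : u ≠ a) (h₂ : u ≠ a + 1) (h₃ : v ≠ a)
    (h₄ : v ≠ a + 1) : a + 1 ∈ Set.uIoo u v ↔ a ∈ Set.uIoo u v := by
  simp only [mem_uIoo_iff]; omega

theorem notMem_uIoo_succ {a y : ℕ} : y ∉ Set.uIoo a (a + 1) := by
  simp only [mem_uIoo_iff]; omega

theorem mem_uIoo_iff_xor {a u v y : ℕ} (h₁ : y ≠ a) (h₂ : y ≠ a + 1) (h₃ : y ≠ u)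
    (h₄ : y ≠ v) :
    y ∈ Set.uIoo u v ↔ ¬ (y ∈ Set.uIoo a u ↔ y ∈ Set.uIoo (a + 1) v) := by
  simp only [mem_uIoo_iff]; omega

namespace IsArcSystem

variable {N : ℕ} {P L : ℕ → ℕ} {a i : ℕ}

theorem surgery_cases (h : IsArcSystem N P L) (i k : ℕ) (hb : a + 1 < 2 * N)
    (hab : P a ≠ a + 1) :
    (k = a ∧ surgeryPartner P a (a + 1) k = a + 1 ∧ surgeryLabel P L a (a + 1) i k = i) ∨
    (k = a + 1 ∧ surgeryPartner P a (a + 1) k = a ∧ surgeryLabel P L a (a + 1) i k = i) ∨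
    (k = P a ∧ surgeryPartner P a (a + 1) k = P (a + 1) ∧
      surgeryLabel P L a (a + 1) i k = min (L a) (L (a + 1))) ∨
    (k = P (a + 1) ∧ surgeryPartner P a (a + 1) k = P a ∧
      surgeryLabel P L a (a + 1) i k = min (L a) (L (a + 1))) ∨
    (k ≠ a ∧ k ≠ a + 1 ∧ k ≠ P a ∧ k ≠ P (a + 1) ∧ surgeryPartner P a (a + 1) k = P k ∧
      surgeryLabel P L a (a + 1) i k = L k) := by
  have ha : a < 2 * N := by omega
  have hba : P (a + 1) ≠ a := fun e => hab ((h.partner_eq_iff hb ha).1 e).symm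
  have hna := h.partner_ne ha
  have hnb := h.partner_ne hb
  have hpp : P a ≠ P (a + 1) := fun e => by simp [h.partner_inj ha hb] at e
  unfold surgeryPartner surgeryLabel
  by_cases h₁ : k = a
  · simp [h₁]
  by_cases h₂ : k = a + 1
  · simp [h₂]
  by_cases h₃ : k = P a
  · subst h₃; simp [hna, hab]
  by_cases h₄ : k = P (a + 1)
  · subst h₄; simp [hba, hnb, hpp.symm]
  · simp [h₁, h₂, h₃, h₄]

theorem partner_ne_of_ne (h : IsArcSystem N P L) (hb : a + 1 < 2 * N) {k : ℕ}
    (hk : k < 2 * N) (h₁ : k ≠ a) (h₂ : k ≠ a + 1) (h₃ : k ≠ P a) (h₄ : k ≠ P (a + 1)) :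
    P k ≠ a ∧ P k ≠ a + 1 ∧ P k ≠ P a ∧ P k ≠ P (a + 1) := by
  have ha : a < 2 * N := by omega
  rw [Ne, Ne, Ne, Ne, h.partner_eq_iff hk ha, h.partner_eq_iff hk hb, h.partner_inj hk ha,
    h.partner_inj hk hb]
  exact ⟨h₃, h₄, h₁, h₂⟩

theorem surgeryPartner_surgeryPartner (h : IsArcSystem N P L) (hb : a + 1 < 2 * N)
    (hab : P a ≠ a + 1) {k : ℕ} (hk : k < 2 * N) :
    surgeryPartner P a (a + 1) (surgeryPartner P a (a + 1) k) = k ∧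
      surgeryLabel P L a (a + 1) i (surgeryPartner P a (a + 1) k) =
        surgeryLabel P L a (a + 1) i k := by
  have ha : a < 2 * N := by omega
  have hba : P (a + 1) ≠ a := fun e => hab ((h.partner_eq_iff hb ha).1 e).symm
  have hna := h.partner_ne ha
  have hnb := h.partner_ne hb
  have hpp : P a ≠ P (a + 1) := fun e => by simp [h.partner_inj ha hb] at e
  have hc := fun k => h.surgery_cases i k hb hab
  rcases hc k with ⟨hk', hP, hL⟩ | ⟨hk', hP, hL⟩ | ⟨hk', hP, hL⟩ | ⟨hk', hP, hL⟩ |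
    ⟨h₁, h₂, h₃, h₄, hP, hL⟩ <;> rw [hL, hP]
  · have := hc (a + 1); omega
  · have := hc a; omega
  · have := hc (P (a + 1)); omega
  · have := hc (P a); omega
  · have hne := h.partner_ne_of_ne hb hk h₁ h₂ h₃ h₄
    have hPk := hc (P k)
    rw [h.partner_partner k hk, h.label_partner k hk] at hPk
    omega

theorem mem_uIoo_of_disjoint (h : IsArcSystem N P L) (hb : a + 1 < 2 * N) {k : ℕ}
    (hk : k < 2 * N) (h₁ : k ≠ a) (h₂ : k ≠ a + 1) (h₃ : k ≠ P a) (h₄ : k ≠ P (a + 1)) :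
    (a + 1 ∈ Set.uIoo k (P k) ↔ a ∈ Set.uIoo k (P k)) ∧
      (P a ∈ Set.uIoo k (P k) ↔ a ∈ Set.uIoo k (P k)) ∧
      (P (a + 1) ∈ Set.uIoo k (P k) ↔ a ∈ Set.uIoo k (P k)) := by
  obtain ⟨hPa, hPb, -⟩ := h.partner_ne_of_ne hb hk h₁ h₂ h₃ h₄
  have hsucc := mem_uIoo_succ_iff h₁ h₂ hPa hPb
  exact ⟨hsucc, h.partner_mem_uIoo hk (by omega), (h.partner_mem_uIoo hk hb).trans hsucc⟩

theorem partner_mem_uIoo_partner_partner (h : IsArcSystem N P L) (hb : a + 1 < 2 * N) {k : ℕ}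
    (hk : k < 2 * N) (h₁ : k ≠ a) (h₂ : k ≠ a + 1) (h₃ : k ≠ P a) (h₄ : k ≠ P (a + 1)) :
    P k ∈ Set.uIoo (P a) (P (a + 1)) ↔ k ∈ Set.uIoo (P a) (P (a + 1)) := by
  obtain ⟨hPa, hPb, hPPa, hPPb⟩ := h.partner_ne_of_ne hb hk h₁ h₂ h₃ h₄
  rw [mem_uIoo_iff_xor h₁ h₂ h₃ h₄, mem_uIoo_iff_xor hPa hPb hPPa hPPb,
    h.partner_mem_uIoo (by omega) hk, h.partner_mem_uIoo hb hk]

theorem surgeryPartner_noncrossing (h : IsArcSystem N P L) (hb : a + 1 < 2 * N)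
    (hab : P a ≠ a + 1) {u v : ℕ} (hu : u < 2 * N) (hv : v < 2 * N)
    (huv : v ∈ Set.uIoo u (surgeryPartner P a (a + 1) u)) :
    surgeryPartner P a (a + 1) v ∈ Set.uIoo u (surgeryPartner P a (a + 1) u) := by
  have ha : a < 2 * N := by omega
  have hba : P (a + 1) ≠ a := fun e => hab ((h.partner_eq_iff hb ha).1 e).symm
  have hcap := mem_uIoo_succ_iff (h.partner_ne ha) hab hba (h.partner_ne hb)
  have hnew (hv' : v ∈ Set.uIoo (P a) (P (a + 1))) :
      surgeryPartner P a (a + 1) v ∈ Set.uIoo (P a) (P (a + 1)) := by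
    rcases h.surgery_cases 0 v hb hab with ⟨rfl, hP, -⟩ | ⟨rfl, hP, -⟩ | ⟨rfl, -⟩ | ⟨rfl, -⟩ |
      ⟨h₁, h₂, h₃, h₄, hP, -⟩
    · rwa [hP, hcap]
    · rwa [hP, ← hcap]
    · exact absurd hv' Set.left_notMem_uIoo
    · exact absurd hv' Set.right_notMem_uIoo
    · rwa [hP, h.partner_mem_uIoo_partner_partner hb hv h₁ h₂ h₃ h₄]
  rcases h.surgery_cases 0 u hb hab with ⟨rfl, hP, -⟩ | ⟨rfl, hP, -⟩ | ⟨rfl, hP, -⟩ |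
    ⟨rfl, hP, -⟩ | ⟨h₁, h₂, h₃, h₄, hP, -⟩ <;> rw [hP] at huv ⊢
  · exact absurd huv notMem_uIoo_succ
  · exact absurd (Set.uIoo_comm a (a + 1) ▸ huv) notMem_uIoo_succ
  · exact hnew huv
  · rw [Set.uIoo_comm] at huv ⊢
    exact hnew huv
  · obtain ⟨hsucc, hPa, hPb⟩ := h.mem_uIoo_of_disjoint hb hu h₁ h₂ h₃ h₄
    rcases h.surgery_cases 0 v hb hab with ⟨rfl, hQ, -⟩ | ⟨rfl, hQ, -⟩ | ⟨rfl, hQ, -⟩ |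
      ⟨rfl, hQ, -⟩ | ⟨-, -, -, -, hQ, -⟩ <;> rw [hQ]
    · exact hsucc.2 huv
    · exact hsucc.1 huv
    · exact hPb.2 (hPa.1 huv)
    · exact hPa.2 (hPb.1 huv)
    · exact h.noncrossing u hu v hv huv

/-- If the two arcs lie on the same side of `a`, then they are nested and their labels have
different parity. -/
theorem min_max_label_parity (h : IsArcSystem N P L) (hb : a + 1 < 2 * N) (hab : P a ≠ a + 1) :
    min (L a) (L (a + 1)) % 2 = max (P a) (P (a + 1)) % 2 ∧
      max (L a) (L (a + 1)) % 2 = a % 2 := by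
  have ha : a < 2 * N := by omega
  have hpa := h.partner_parity a ha
  have hpb := h.partner_parity _ hb
  have hla := h.label_parity a ha
  have hlb := h.label_parity _ hb
  have hba : P (a + 1) ≠ a := fun e => hab ((h.partner_eq_iff hb ha).1 e).symm
  have hma := h.partner_mem_uIoo ha hb
  have hmb := h.partner_mem_uIoo hb ha
  have hna := h.nested a ha _ hb
  have hnb := h.nested _ hb a ha
  simp only [mem_uIoo_iff] at hma hmb hna hnb
  rcases lt_or_gt_of_ne hab with _ | _ <;> rcases lt_or_gt_of_ne hba with _ | _ <;> omega

theorem surgeryLabel_nested (h : IsArcSystem N P L) (hb : a + 1 < 2 * N) (hab : P a ≠ a + 1)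
    (hi : ∀ k ∈ ({a, a + 1} : Set ℕ), k ∈ Set.uIoo (P a) (P (a + 1)) →
      min (L a) (L (a + 1)) < i) (hle : L (a + 1) ≤ i)
    {u v : ℕ} (hu : u < 2 * N) (hv : v < 2 * N)
    (huv : v ∈ Set.uIoo u (surgeryPartner P a (a + 1) u)) :
    surgeryLabel P L a (a + 1) i u < surgeryLabel P L a (a + 1) i v := by
  have ha : a < 2 * N := by omega
  have hnew (hv' : v ∈ Set.uIoo (P a) (P (a + 1))) :
      min (L a) (L (a + 1)) < surgeryLabel P L a (a + 1) i v := by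
    rcases h.surgery_cases i v hb hab with ⟨rfl, -, hM⟩ | ⟨rfl, -, hM⟩ | ⟨rfl, -⟩ | ⟨rfl, -⟩ |
      ⟨h₁, h₂, h₃, h₄, -, hM⟩
    · rw [hM]; exact hi _ (by simp) hv'
    · rw [hM]; exact hi _ (by simp) hv'
    · exact absurd hv' Set.left_notMem_uIoo
    · exact absurd hv' Set.right_notMem_uIoo
    · rw [hM, min_lt_iff]
      rw [mem_uIoo_iff_xor h₁ h₂ h₃ h₄] at hv'
      have := h.nested a ha v hv
      have := h.nested _ hb v hv
      tauto
  rcases h.surgery_cases i u hb hab with ⟨rfl, hP, -⟩ | ⟨rfl, hP, -⟩ | ⟨rfl, hP, hL⟩ |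
    ⟨rfl, hP, hL⟩ | ⟨h₁, h₂, h₃, h₄, hP, hL⟩ <;> rw [hP] at huv
  · exact absurd huv notMem_uIoo_succ
  · exact absurd (Set.uIoo_comm a (a + 1) ▸ huv) notMem_uIoo_succ
  · exact hL ▸ hnew huv
  · exact hL ▸ hnew (Set.uIoo_comm (P a) _ ▸ huv)
  · obtain ⟨hsucc, hPa, hPb⟩ := h.mem_uIoo_of_disjoint hb hu h₁ h₂ h₃ h₄
    have hua := h.nested u hu a ha
    have hub := h.nested u hu _ hb
    rw [hL]
    rcases h.surgery_cases i v hb hab with ⟨rfl, -, hM⟩ | ⟨rfl, -, hM⟩ | ⟨rfl, -, hM⟩ |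
      ⟨rfl, -, hM⟩ | ⟨-, -, -, -, -, hM⟩ <;> rw [hM]
    · exact (hub (hsucc.2 huv)).trans_le hle
    · exact (hub huv).trans_le hle
    · exact lt_min (hua (hPa.1 huv)) (hub (hsucc.2 (hPa.1 huv)))
    · exact lt_min (hua (hPb.1 huv)) (hub (hsucc.2 (hPb.1 huv)))
    · exact h.nested u hu v hv huv

theorem surgery_of_partner_eq (h : IsArcSystem N P L) (hi : 1 ≤ i) (hiN : i < N)
    (ha : a + i + 1 = 2 * N) (hab : P a = a + 1) :
    IsArcSystem N (surgeryPartner P a (a + 1)) (surgeryLabel P L a (a + 1) i) := by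
  have hba : P (a + 1) = a := ((h.partner_eq_iff (by omega) (by omega)).1 hab).symm
  have hP : surgeryPartner P a (a + 1) = P := funext fun k => by
    unfold surgeryPartner; split_ifs <;> simp_all
  have hL (k) : surgeryLabel P L a (a + 1) i k = if k = a ∨ k = a + 1 then i else L k := by
    unfold surgeryLabel
    rw [hab, hba]
    split_ifs <;> first | rfl | omega
  have hk (k) (hk : k < 2 * N) : (P k = a ↔ k = a + 1) ∧ (P k = a + 1 ↔ k = a) := by
    rw [h.partner_eq_iff hk (by omega), h.partner_eq_iff hk (by omega), hab, hba]
    exact ⟨Iff.rfl, Iff.rfl⟩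
  rw [hP]
  refine ⟨h.lt, h.partner_parity, h.partner_partner, h.noncrossing, fun k hlt => ?_,
    fun k hlt => ?_, fun k hlt => ?_, fun k hlt => ?_, fun u hu v hv huv => ?_⟩ <;>
    rw [hL]
  · have := hk k hlt
    rw [hL, h.label_partner k hlt]
    split_ifs <;> first | rfl | omega
  · have := h.one_le k hlt
    split_ifs <;> omega
  · have := h.le k hlt
    split_ifs <;> omega
  · split_ifs with e
    · rcases e with rfl | rfl <;> omega
    · exact h.label_parity k hlt
  · have hlt := h.nested u hu v hv huv
    have hle := h.le (a + 1) (by omega)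
    have hlab := h.label_partner a (by omega)
    rw [hab] at hlab
    rw [mem_uIoo_iff] at huv
    have : ¬ (u = a ∨ u = a + 1) := by rintro (rfl | rfl) <;> omega
    rw [hL, if_neg this]
    split_ifs with e
    · rcases e with rfl | rfl <;> omega
    · exact hlt

theorem surgery (h : IsArcSystem N P L) (hi : 1 ≤ i) (hiN : i < N) (ha : a + i + 1 = 2 * N) :
    IsArcSystem N (surgeryPartner P a (a + 1)) (surgeryLabel P L a (a + 1) i) := by
  by_cases hab : P a = a + 1
  · exact h.surgery_of_partner_eq hi hiN ha hab
  have hb : a + 1 < 2 * N := by omega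
  have ha' : a < 2 * N := by omega
  have hc := fun k => h.surgery_cases i k hb hab
  have hlb := h.le _ hb
  have hlPa := h.le _ (h.lt a ha')
  have hlPb := h.le _ (h.lt _ hb)
  rw [h.label_partner a ha'] at hlPa
  rw [h.label_partner _ hb] at hlPb
  refine ⟨fun k hk => ?_, fun k hk => ?_,
    fun k hk => (h.surgeryPartner_surgeryPartner (i := i) hb hab hk).1,
    fun u hu v hv => h.surgeryPartner_noncrossing hb hab hu hv,
    fun k hk => (h.surgeryPartner_surgeryPartner hb hab hk).2, fun k hk => ?_, fun k hk => ?_,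
    fun k hk => ?_, fun u hu v hv => h.surgeryLabel_nested hb hab ?_ (by omega) hu hv⟩
  · have := h.lt k hk
    have := h.lt a ha'
    have := h.lt _ hb
    rcases hc k with _ | _ | _ | _ | _ <;> omega
  · have := h.partner_parity k hk
    have := h.partner_parity a ha'
    have := h.partner_parity _ hb
    rcases hc k with _ | _ | _ | _ | _ <;> omega
  · have := h.one_le k hk
    have := h.one_le a ha'
    have := h.one_le _ hb
    rcases hc k with _ | _ | _ | _ | _ <;> omega
  · have := h.le k hk
    rcases hc k with _ | _ | _ | _ | _ <;> omega
  · have := h.label_parity k hk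
    have := (h.min_max_label_parity hb hab).1
    rcases hc k with _ | _ | _ | _ | _ <;> omega
  · have hma := h.partner_mem_uIoo ha' hb
    have hna := h.partner_ne ha'
    have hnb := h.partner_ne hb
    intro k hk hmem
    have hk : k = a ∨ k = a + 1 := hk
    simp only [mem_uIoo_iff] at hma hmem
    omega

end IsArcSystem

/-! ### Multiplication by an elementary diagram -/

namespace OkadaDiagram

variable {N : ℕ}

/-- The right node of level `i + 1`. -/
def hiNode (i : ℕ) (hi : 1 ≤ i ∧ i < N) : Node N := Sum.inr ⟨i, hi.2⟩

/-- The right node of level `i`. -/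
def loNode (i : ℕ) (hi : 1 ≤ i ∧ i < N) : Node N := Sum.inr ⟨i - 1, by omega⟩

theorem hiNode_ne_loNode {i : ℕ} (hi : 1 ≤ i ∧ i < N) : hiNode i hi ≠ loNode i hi := by
  simp only [hiNode, loNode, ne_eq, Sum.inr.injEq, Fin.mk.injEq]
  omega

theorem pos_hiNode {i : ℕ} (hi : 1 ≤ i ∧ i < N) : (hiNode i hi).pos = 2 * N - 1 - i := rfl

theorem pos_loNode {i : ℕ} (hi : 1 ≤ i ∧ i < N) : (loNode i hi).pos = 2 * N - 1 - i + 1 := by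
  simp only [loNode, Node.pos]
  omega

/-- The composition of `D` with the elementary diagram `G i` on the right. -/
def mulElem (D : OkadaDiagram N) (i : ℕ) (hi : 1 ≤ i ∧ i < N) : OkadaDiagram N :=
  (D.isArcSystem.surgery hi.1 hi.2 (show 2 * N - 1 - i + i + 1 = 2 * N by omega)).toDiagram

theorem partnerAt_mulElem (D : OkadaDiagram N) {i a : ℕ} (hi : 1 ≤ i ∧ i < N)
    (ha : a + i + 1 = 2 * N) :
    (D.mulElem i hi).partnerAt = surgeryPartner D.partnerAt a (a + 1) := by
  obtain rfl : a = 2 * N - 1 - i := by omega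
  funext k
  rcases lt_or_ge k (2 * N) with hk | hk
  · exact partnerAt_toDiagram _ hk
  · have h₁ := D.isArcSystem.lt (2 * N - 1 - i) (by omega)
    have h₂ := D.isArcSystem.lt (2 * N - 1 - i + 1) (by omega)
    rw [partnerAt_of_le _ hk, surgeryPartner, if_neg (by omega), if_neg (by omega),
      if_neg (by omega), if_neg (by omega), partnerAt_of_le _ hk]

theorem labelAt_mulElem (D : OkadaDiagram N) {i a : ℕ} (hi : 1 ≤ i ∧ i < N)
    (ha : a + i + 1 = 2 * N) :
    (D.mulElem i hi).labelAt = surgeryLabel D.partnerAt D.labelAt a (a + 1) i := by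
  obtain rfl : a = 2 * N - 1 - i := by omega
  funext k
  rcases lt_or_ge k (2 * N) with hk | hk
  · exact labelAt_toDiagram _ hk
  · have h₁ := D.isArcSystem.lt (2 * N - 1 - i) (by omega)
    have h₂ := D.isArcSystem.lt (2 * N - 1 - i + 1) (by omega)
    rw [labelAt_of_le _ hk, surgeryLabel, if_neg (by omega), if_neg (by omega),
      labelAt_of_le _ hk]

theorem mulElem_partner (D : OkadaDiagram N) {i : ℕ} (hi : 1 ≤ i ∧ i < N) (u : Node N) :
    (D.mulElem i hi).partner u =
      if u = hiNode i hi then loNode i hi else if u = loNode i hi then hiNode i hi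
      else if u = D.partner (hiNode i hi) then D.partner (loNode i hi)
      else if u = D.partner (loNode i hi) then D.partner (hiNode i hi) else D.partner u := by
  apply Node.pos_injective
  rw [← partnerAt_pos, partnerAt_mulElem D hi (show 2 * N - 1 - i + i + 1 = 2 * N by omega),
    ← pos_loNode hi, ← pos_hiNode hi]
  unfold surgeryPartner
  simp only [partnerAt_pos, Node.pos_injective.eq_iff]
  split_ifs <;> rfl

theorem mulElem_label (D : OkadaDiagram N) {i : ℕ} (hi : 1 ≤ i ∧ i < N) (u : Node N) :
    (D.mulElem i hi).label u =
      if u = hiNode i hi ∨ u = loNode i hi then i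
      else if u = D.partner (hiNode i hi) ∨ u = D.partner (loNode i hi) then
        min (D.label (hiNode i hi)) (D.label (loNode i hi)) else D.label u := by
  rw [← labelAt_pos, labelAt_mulElem D hi (show 2 * N - 1 - i + i + 1 = 2 * N by omega),
    ← pos_loNode hi, ← pos_hiNode hi]
  unfold surgeryLabel
  simp only [partnerAt_pos, labelAt_pos, Node.pos_injective.eq_iff]

theorem id_mulElem {i : ℕ} (hi : 1 ≤ i ∧ i < N) :
    (OkadaDiagram.id N).mulElem i hi = elem i hi := by
  apply OkadaDiagram.ext <;> funext u
  · rw [mulElem_partner]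
    rcases u with ⟨u, hu⟩ | ⟨u, hu⟩ <;>
      simp only [hiNode, loNode, OkadaDiagram.id, elem, Node.mirror, elemPartner, elemSwap,
        reduceCtorEq, if_false, Sum.inl.injEq, Sum.inr.injEq, Fin.mk.injEq] <;>
      split_ifs <;> first | rfl | omega
  · rw [mulElem_label]
    rcases u with ⟨u, hu⟩ | ⟨u, hu⟩ <;>
      simp only [hiNode, loNode, OkadaDiagram.id, elem, Node.mirror, elemLabel, Node.level,
        reduceCtorEq, if_false, Sum.inl.injEq, Sum.inr.injEq, Fin.mk.injEq, false_or] <;>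
      split_ifs <;> omega

theorem partner_eq_comm (D : OkadaDiagram N) {u v : Node N} : D.partner u = v ↔ D.partner v = u :=
  ⟨fun h => by rw [← h, D.partner_partner], fun h => by rw [← h, D.partner_partner]⟩

theorem partner_inj (D : OkadaDiagram N) {u v : Node N} : D.partner u = D.partner v ↔ u = v :=
  ⟨fun h => by rw [← D.partner_partner u, h, D.partner_partner], fun h => by rw [h]⟩

theorem mulElem_partner_of_loop {D : OkadaDiagram N} {i : ℕ} {hi : 1 ≤ i ∧ i < N}
    (hl : D.partner (hiNode i hi) = loNode i hi) : (D.mulElem i hi).partner = D.partner := by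
  funext u
  have hl' := D.partner_eq_comm.1 hl
  rw [mulElem_partner, hl, hl']
  split_ifs <;> simp_all

theorem mulElem_partner_of_ne (D : OkadaDiagram N) {i : ℕ} {hi : 1 ≤ i ∧ i < N} {u : Node N}
    (h₁ : u ≠ hiNode i hi) (h₂ : u ≠ loNode i hi) (h₃ : D.partner u ≠ hiNode i hi)
    (h₄ : D.partner u ≠ loNode i hi) : (D.mulElem i hi).partner u = D.partner u := by
  rw [ne_eq, D.partner_eq_comm, eq_comm] at h₃ h₄
  rw [mulElem_partner, if_neg h₁, if_neg h₂, if_neg h₃, if_neg h₄]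

theorem mulElem_partner_hiNode (D : OkadaDiagram N) {i : ℕ} (hi : 1 ≤ i ∧ i < N) :
    (D.mulElem i hi).partner (hiNode i hi) = loNode i hi := by
  rw [mulElem_partner, if_pos rfl]

theorem mulElem_partner_partner_hiNode {D : OkadaDiagram N} {i : ℕ} {hi : 1 ≤ i ∧ i < N}
    (hl : D.partner (hiNode i hi) ≠ loNode i hi) :
    (D.mulElem i hi).partner (D.partner (hiNode i hi)) = D.partner (loNode i hi) := by
  rw [mulElem_partner, if_neg (D.partner_ne _), if_neg hl, if_pos rfl]

theorem mulElem_partner_loNode (D : OkadaDiagram N) {i : ℕ} (hi : 1 ≤ i ∧ i < N) :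
    (D.mulElem i hi).partner (loNode i hi) = hiNode i hi :=
  (D.mulElem i hi).partner_eq_comm.1 (D.mulElem_partner_hiNode hi)

theorem mulElem_label_of_mem_cap (D : OkadaDiagram N) {i : ℕ} {hi : 1 ≤ i ∧ i < N} {u : Node N}
    (hu : u = hiNode i hi ∨ u = loNode i hi) : (D.mulElem i hi).label u = i := by
  rw [mulElem_label, if_pos hu]

theorem mulElem_label_partner_hiNode {D : OkadaDiagram N} {i : ℕ} {hi : 1 ≤ i ∧ i < N}
    (hl : D.partner (hiNode i hi) ≠ loNode i hi) :
    (D.mulElem i hi).label (D.partner (hiNode i hi)) =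
      min (D.label (hiNode i hi)) (D.label (loNode i hi)) := by
  rw [mulElem_label, if_neg (not_or.2 ⟨D.partner_ne _, hl⟩), if_pos (Or.inl rfl)]

theorem mulElem_label_of_ne (D : OkadaDiagram N) {i : ℕ} {hi : 1 ≤ i ∧ i < N} {u : Node N}
    (h₁ : u ≠ hiNode i hi) (h₂ : u ≠ loNode i hi) (h₃ : D.partner u ≠ hiNode i hi)
    (h₄ : D.partner u ≠ loNode i hi) : (D.mulElem i hi).label u = D.label u := by
  rw [ne_eq, D.partner_eq_comm, eq_comm] at h₃ h₄
  rw [mulElem_label, if_neg (not_or.2 ⟨h₁, h₂⟩), if_neg (not_or.2 ⟨h₃, h₄⟩)]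

theorem mulElem_label_le (D : OkadaDiagram N) {i : ℕ} {hi : 1 ≤ i ∧ i < N} {u : Node N}
    (hu : ¬ (u = hiNode i hi ∨ u = loNode i hi)) : (D.mulElem i hi).label u ≤ D.label u := by
  rw [mulElem_label, if_neg hu]
  split_ifs with h
  · rcases h with rfl | rfl <;> rw [D.label_partner]
    exacts [min_le_left _ _, min_le_right _ _]
  · rfl

theorem min_label_le_mulElem_label (D : OkadaDiagram N) {i : ℕ} {hi : 1 ≤ i ∧ i < N} {u : Node N}
    (hu : ¬ (u = hiNode i hi ∨ u = loNode i hi)) :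
    min (D.label u) (min (D.label (hiNode i hi)) (D.label (loNode i hi))) ≤
      (D.mulElem i hi).label u := by
  rw [mulElem_label, if_neg hu]
  split_ifs
  exacts [min_le_right _ _, min_le_left _ _]

theorem label_le_level (D : OkadaDiagram N) (u : Node N) : D.label u ≤ u.level :=
  (D.label_le u).trans (min_le_left _ _)

/-- The number of loops of label `k` in the composition of `D` with `G i`, which is `0` or `1`. -/
def loopAt (D : OkadaDiagram N) (i : ℕ) (hi : 1 ≤ i ∧ i < N) (k : ℕ) : ℕ :=
  if D.partner (hiNode i hi) = loNode i hi ∧ D.label (hiNode i hi) = k then 1 else 0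

end OkadaDiagram

/-! ### Connectivity in the concatenation of two diagrams -/

section Concat

open OkadaDiagram

variable {N : ℕ} {C D F : OkadaDiagram N}

theorem reachable_equivalence (C D : OkadaDiagram N) : Equivalence (concatGraph C D).Reachable :=
  (concatGraph C D).reachable_is_equivalence

theorem reachable_inFst (C D : OkadaDiagram N) (u : Node N) :
    (concatGraph C D).Reachable (inFst u) (inFst (C.partner u)) := by
  by_cases h : inFst u = inFst (C.partner u)
  · rw [← h]
  · refine SimpleGraph.Adj.reachable ?_
    rw [concatGraph, SimpleGraph.fromRel_adj]
    exact ⟨h, Or.inl (Or.inl ⟨u, rfl, rfl⟩)⟩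

theorem reachable_inSnd (C D : OkadaDiagram N) (u : Node N) :
    (concatGraph C D).Reachable (inSnd u) (inSnd (D.partner u)) := by
  by_cases h : inSnd u = inSnd (D.partner u)
  · rw [← h]
  · refine SimpleGraph.Adj.reachable ?_
    rw [concatGraph, SimpleGraph.fromRel_adj]
    exact ⟨h, Or.inl (Or.inr ⟨u, rfl, rfl⟩)⟩

theorem rel_of_reachable {R : Node3 N → Node3 N → Prop} (hR : Equivalence R)
    (hfst : ∀ u, R (inFst u) (inFst (C.partner u)))
    (hsnd : ∀ u, R (inSnd u) (inSnd (D.partner u)))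
    {p q : Node3 N} (h : (concatGraph C D).Reachable p q) : R p q := by
  obtain ⟨w⟩ := h
  induction w with
  | nil => exact hR.refl _
  | cons hadj _ ih =>
    refine hR.trans ?_ ih
    rw [concatGraph, SimpleGraph.fromRel_adj] at hadj
    rcases hadj.2 with (⟨u, rfl, rfl⟩ | ⟨u, rfl, rfl⟩) | (⟨u, rfl, rfl⟩ | ⟨u, rfl, rfl⟩)
    · exact hfst u
    · exact hsnd u
    · exact hR.symm (hfst u)
    · exact hR.symm (hsnd u)

/-- The height of the arc or loop of `C ∘ D` through the vertex `v`. -/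
noncomputable def heightAt (C D : OkadaDiagram N) (v : Node3 N) : ℕ :=
  concatHeight C D ((concatGraph C D).connectedComponentMk v)

theorem le_heightAt {v : Node3 N} {t : ℕ} : t ≤ heightAt C D v ↔
    (∀ u, (concatGraph C D).Reachable (inFst u) v → t ≤ C.label u) ∧
    (∀ u, (concatGraph C D).Reachable (inSnd u) v → t ≤ D.label u) := by
  unfold heightAt concatHeight
  simp only [SimpleGraph.ConnectedComponent.eq]
  rw [le_csInf_iff ⟨0, fun _ _ => Nat.zero_le _⟩]
  · constructor
    · exact fun h => ⟨fun u hu => h _ (Or.inl ⟨u, hu, rfl⟩), fun u hu => h _ (Or.inr ⟨u, hu, rfl⟩)⟩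
    · rintro ⟨hfst, hsnd⟩ b (⟨u, hu, rfl⟩ | ⟨u, hu, rfl⟩)
      exacts [hfst u hu, hsnd u hu]
  · rcases v with v | v | v
    · exact ⟨_, Or.inl ⟨Sum.inl v, SimpleGraph.Reachable.rfl, rfl⟩⟩
    · exact ⟨_, Or.inl ⟨Sum.inr v, SimpleGraph.Reachable.rfl, rfl⟩⟩
    · exact ⟨_, Or.inr ⟨Sum.inr v, SimpleGraph.Reachable.rfl, rfl⟩⟩

theorem heightAt_congr {v w : Node3 N} (h : (concatGraph C D).Reachable v w) :
    heightAt C D v = heightAt C D w := by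
  unfold heightAt
  rw [SimpleGraph.ConnectedComponent.eq.2 h]

/-- The vertex sets of the loops of label `k`. In contrast to connected components, the vertex
sets can be compared between different concatenations. -/
def loopSets (C D : OkadaDiagram N) (k : ℕ) : Set (Set (Node3 N)) :=
  {S | ∃ v, S = {w | (concatGraph C D).Reachable w v} ∧
    (∀ u, ¬ (concatGraph C D).Reachable (inOuter u) v) ∧ heightAt C D v = k}

theorem loopCount_eq_ncard_loopSets (C D : OkadaDiagram N) (k : ℕ) :
    loopCount C D k = (loopSets C D k).ncard := by
  rw [loopCount, ← Set.ncard_image_of_injective _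
    (SimpleGraph.ConnectedComponent.supp_injective (G := concatGraph C D))]
  congr 1
  ext S
  constructor
  · rintro ⟨γ, ⟨hinner, hk⟩, rfl⟩
    induction γ using SimpleGraph.ConnectedComponent.ind with
    | h v =>
      refine ⟨v, ?_, fun u hu => hinner u (SimpleGraph.ConnectedComponent.eq.2 hu), hk⟩
      ext w
      simp
  · rintro ⟨v, rfl, hinner, hk⟩
    refine ⟨(concatGraph C D).connectedComponentMk v,
      ⟨fun u hu => hinner u (SimpleGraph.ConnectedComponent.eq.1 hu), hk⟩, ?_⟩
    ext w
    simp

theorem IsComposition.reachable_iff (h : IsComposition C D F) {u v : Node N} :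
    (concatGraph C D).Reachable (inOuter u) (inOuter v) ↔ u = v ∨ F.partner u = v := by
  by_cases huv : u = v
  · simp [huv]
  · rw [h.1 u v huv]
    simp [huv]

theorem inSnd_injective : Function.Injective (inSnd (N := N)) := by
  rintro (a | a) (b | b) h <;> simp_all [inSnd]

theorem inOuter_injective : Function.Injective (inOuter (N := N)) := by
  rintro (a | a) (b | b) h <;> simp_all [inOuter]

theorem inFst_ne_inSnd_inr (u : Node N) (a : Fin N) : inFst u ≠ inSnd (Sum.inr a) := by
  rcases u with u | u <;> simp [inFst, inSnd]

end Concat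

/-- The relation obtained from an equivalence relation by merging the classes of `a` and `b`. -/
def MergeRel {α : Type*} (r : α → α → Prop) (a b u v : α) : Prop :=
  r u v ∨ (r u a ∧ r v b) ∨ (r u b ∧ r v a)

theorem MergeRel.equivalence {α : Type*} {r : α → α → Prop} (h : Equivalence r) (a b : α) :
    Equivalence (MergeRel r a b) where
  refl x := Or.inl (h.refl x)
  symm := by
    rintro x y (g | ⟨g₁, g₂⟩ | ⟨g₁, g₂⟩)
    exacts [Or.inl (h.symm g), Or.inr (Or.inr ⟨g₂, g₁⟩), Or.inr (Or.inl ⟨g₂, g₁⟩)]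
  trans := by
    rintro x y z (g | ⟨g₁, g₂⟩ | ⟨g₁, g₂⟩) (k | ⟨k₁, k₂⟩ | ⟨k₁, k₂⟩)
    · exact Or.inl (h.trans g k)
    · exact Or.inr (Or.inl ⟨h.trans g k₁, k₂⟩)
    · exact Or.inr (Or.inr ⟨h.trans g k₁, k₂⟩)
    · exact Or.inr (Or.inl ⟨g₁, h.trans (h.symm k) g₂⟩)
    · exact Or.inl (h.trans g₁ (h.trans (h.symm k₁) (h.trans g₂ (h.symm k₂))))
    · exact Or.inl (h.trans g₁ (h.symm k₂))
    · exact Or.inr (Or.inr ⟨g₁, h.trans (h.symm k) g₂⟩)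
    · exact Or.inl (h.trans g₁ (h.symm k₂))
    · exact Or.inl (h.trans g₁ (h.trans (h.symm k₁) (h.trans g₂ (h.symm k₂))))

/-- The equivalence relation which has `p` as one class and restricts to `r` off `p`. -/
def SplitRel {α : Type*} (p : α → Prop) (r : α → α → Prop) (u v : α) : Prop :=
  (p u ∧ p v) ∨ (¬ p u ∧ ¬ p v ∧ r u v)

theorem SplitRel.equivalence {α : Type*} {r : α → α → Prop} (h : Equivalence r) (p : α → Prop) :
    Equivalence (SplitRel p r) where
  refl x := (em (p x)).imp (fun hx => ⟨hx, hx⟩) fun hx => ⟨hx, hx, h.refl x⟩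
  symm := Or.imp And.symm fun ⟨hx, hy, hr⟩ => ⟨hy, hx, h.symm hr⟩
  trans := by
    rintro x y z (⟨hx, hy⟩ | ⟨hx, hy, hr⟩) (⟨hy', hz⟩ | ⟨hy', hz, hr'⟩)
    exacts [Or.inl ⟨hx, hz⟩, absurd hy hy', absurd hy' hy, Or.inr ⟨hx, hz, h.trans hr hr'⟩]

/-! ### Connectivity after multiplication by an elementary diagram -/

section Cap

open OkadaDiagram

variable {N : ℕ} {C D F : OkadaDiagram N} {i : ℕ} (hi : 1 ≤ i ∧ i < N)

/-- The vertex is one of the two ends of the arc attached on the right by `G i`. -/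
def OnCap (v : Node3 N) : Prop := v = inSnd (hiNode i hi) ∨ v = inSnd (loNode i hi)

theorem not_onCap_inFst (u : Node N) : ¬ OnCap hi (inFst u) := by
  rintro (h | h) <;> exact inFst_ne_inSnd_inr _ _ h

theorem onCap_inSnd {u : Node N} : OnCap hi (inSnd u) ↔ u = hiNode i hi ∨ u = loNode i hi := by
  simp only [OnCap, inSnd_injective.eq_iff]

theorem onCap_inOuter {u : Node N} : OnCap hi (inOuter u) ↔ u = hiNode i hi ∨ u = loNode i hi := by
  have hhi : inSnd (hiNode i hi) = inOuter (hiNode i hi) := rfl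
  have hlo : inSnd (loNode i hi) = inOuter (loNode i hi) := rfl
  simp only [OnCap, hhi, hlo, inOuter_injective.eq_iff]

theorem partner_loNode_ne (hl : D.partner (hiNode i hi) ≠ loNode i hi) :
    D.partner (loNode i hi) ≠ hiNode i hi :=
  fun e => hl (D.partner_eq_comm.1 e)

theorem not_onCap_partner_hiNode (hl : D.partner (hiNode i hi) ≠ loNode i hi) :
    ¬ OnCap hi (inSnd (D.partner (hiNode i hi))) := by
  rw [onCap_inSnd]
  exact not_or.2 ⟨D.partner_ne _, hl⟩

theorem not_onCap_partner_loNode (hl : D.partner (hiNode i hi) ≠ loNode i hi) :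
    ¬ OnCap hi (inSnd (D.partner (loNode i hi))) := by
  rw [onCap_inSnd]
  exact not_or.2 ⟨partner_loNode_ne hi hl, D.partner_ne _⟩

theorem reachable_mulElem_cap (C D : OkadaDiagram N) :
    (concatGraph C (D.mulElem i hi)).Reachable (inSnd (hiNode i hi)) (inSnd (loNode i hi)) :=
  D.mulElem_partner_hiNode hi ▸ reachable_inSnd C (D.mulElem i hi) (hiNode i hi)

open Classical in
/-- Moves the ends of the cap along their arcs in `D`, and fixes all other vertices. -/
noncomputable def offCap (D : OkadaDiagram N) (w : Node3 N) : Node3 N :=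
  if w = inSnd (hiNode i hi) then inSnd (D.partner (hiNode i hi))
  else if w = inSnd (loNode i hi) then inSnd (D.partner (loNode i hi)) else w

theorem offCap_of_not_onCap {w : Node3 N} (hw : ¬ OnCap hi w) : offCap hi D w = w := by
  rw [OnCap, not_or] at hw
  rw [offCap, if_neg hw.1, if_neg hw.2]

theorem offCap_hiNode :
    offCap hi D (inSnd (hiNode i hi)) = inSnd (D.partner (hiNode i hi)) := if_pos rfl

theorem offCap_loNode :
    offCap hi D (inSnd (loNode i hi)) = inSnd (D.partner (loNode i hi)) := by
  rw [offCap, if_neg (inSnd_injective.ne (hiNode_ne_loNode hi).symm), if_pos rfl]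

theorem reachable_offCap_inSnd (hl : D.partner (hiNode i hi) ≠ loNode i hi) (u : Node N) :
    (concatGraph C (D.mulElem i hi)).Reachable (offCap hi D (inSnd u))
      (offCap hi D (inSnd (D.partner u))) := by
  have hP := offCap_of_not_onCap (D := D) hi (not_onCap_partner_hiNode hi hl)
  have hQ := offCap_of_not_onCap (D := D) hi (not_onCap_partner_loNode hi hl)
  by_cases h₁ : u = hiNode i hi
  · rw [h₁, offCap_hiNode, hP]
  by_cases h₂ : u = loNode i hi
  · rw [h₂, offCap_loNode, hQ]
  by_cases h₃ : D.partner u = hiNode i hi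
  · rw [h₃, ← D.partner_eq_comm.1 h₃, offCap_hiNode, hP]
  by_cases h₄ : D.partner u = loNode i hi
  · rw [h₄, ← D.partner_eq_comm.1 h₄, offCap_loNode, hQ]
  rw [offCap_of_not_onCap hi (by rw [onCap_inSnd]; exact not_or.2 ⟨h₁, h₂⟩),
    offCap_of_not_onCap hi (by rw [onCap_inSnd]; exact not_or.2 ⟨h₃, h₄⟩),
    ← D.mulElem_partner_of_ne h₁ h₂ h₃ h₄]
  exact reachable_inSnd C (D.mulElem i hi) u

theorem reachable_mulElem_of_reachable (hl : D.partner (hiNode i hi) ≠ loNode i hi)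
    {u v : Node3 N} (hu : ¬ OnCap hi u) (hv : ¬ OnCap hi v)
    (h : (concatGraph C D).Reachable u v) : (concatGraph C (D.mulElem i hi)).Reachable u v := by
  have hE := reachable_equivalence C (D.mulElem i hi)
  have hoff := rel_of_reachable (R := fun u v =>
    (concatGraph C (D.mulElem i hi)).Reachable (offCap hi D u) (offCap hi D v))
    ⟨fun _ => hE.refl _, hE.symm, hE.trans⟩
    (fun u => by
      rw [offCap_of_not_onCap hi (not_onCap_inFst hi _),
        offCap_of_not_onCap hi (not_onCap_inFst hi _)]
      exact reachable_inFst _ _ _)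
    (reachable_offCap_inSnd hi hl) h
  rwa [offCap_of_not_onCap hi hu, offCap_of_not_onCap hi hv] at hoff

theorem splitRel_of_reachable_mulElem (hl : D.partner (hiNode i hi) ≠ loNode i hi) {u v : Node3 N}
    (h : (concatGraph C (D.mulElem i hi)).Reachable u v) :
    SplitRel (OnCap hi) (MergeRel (concatGraph C D).Reachable (inSnd (hiNode i hi))
      (inSnd (loNode i hi))) u v := by
  have hE := reachable_equivalence C D
  refine rel_of_reachable (SplitRel.equivalence (MergeRel.equivalence hE _ _) (OnCap hi))
    (fun u => Or.inr ⟨not_onCap_inFst hi _, not_onCap_inFst hi _, Or.inl (reachable_inFst _ _ _)⟩)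
    (fun u => ?_) h
  have rA := hE.symm (reachable_inSnd C D (hiNode i hi))
  have rB := hE.symm (reachable_inSnd C D (loNode i hi))
  have cP := not_onCap_partner_hiNode hi hl
  have cQ := not_onCap_partner_loNode hi hl
  rw [mulElem_partner]
  split_ifs with h₁ h₂ h₃ h₄
  · exact Or.inl ⟨Or.inl (by rw [h₁]), Or.inr rfl⟩
  · exact Or.inl ⟨Or.inr (by rw [h₂]), Or.inl rfl⟩
  · rw [h₃]
    exact Or.inr ⟨cP, cQ, Or.inr (Or.inl ⟨rA, rB⟩)⟩
  · rw [h₄]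
    exact Or.inr ⟨cQ, cP, Or.inr (Or.inr ⟨rB, rA⟩)⟩
  · refine Or.inr ⟨?_, ?_, Or.inl (reachable_inSnd _ _ _)⟩
    · rw [onCap_inSnd]
      exact not_or.2 ⟨h₁, h₂⟩
    · rw [onCap_inSnd]
      exact not_or.2 ⟨fun e => h₃ (D.partner_eq_comm.1 e).symm,
        fun e => h₄ (D.partner_eq_comm.1 e).symm⟩

theorem onCap_congr_mulElem (hl : D.partner (hiNode i hi) ≠ loNode i hi) {u v : Node3 N}
    (h : (concatGraph C (D.mulElem i hi)).Reachable u v) : OnCap hi u ↔ OnCap hi v := by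
  rcases splitRel_of_reachable_mulElem hi hl h with h | h
  exacts [iff_of_true h.1 h.2, iff_of_false h.1 h.2.1]

theorem reachable_mulElem_iff (hl : D.partner (hiNode i hi) ≠ loNode i hi)
    {u v : Node3 N} (hu : ¬ OnCap hi u) (hv : ¬ OnCap hi v) :
    (concatGraph C (D.mulElem i hi)).Reachable u v ↔
      MergeRel (concatGraph C D).Reachable (inSnd (hiNode i hi)) (inSnd (loNode i hi)) u v := by
  constructor
  · intro h
    rcases splitRel_of_reachable_mulElem hi hl h with h | h
    exacts [absurd h.1 hu, h.2.2]
  · have hE := reachable_equivalence C D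
    have hE' := reachable_equivalence C (D.mulElem i hi)
    have rA := reachable_inSnd C D (hiNode i hi)
    have rB := reachable_inSnd C D (loNode i hi)
    have cP := not_onCap_partner_hiNode hi hl
    have cQ := not_onCap_partner_loNode hi hl
    have hPQ := reachable_inSnd C (D.mulElem i hi) (D.partner (hiNode i hi))
    rw [mulElem_partner_partner_hiNode hl] at hPQ
    have lift := fun {u v} => reachable_mulElem_of_reachable (C := C) hi hl (u := u) (v := v)
    rintro (h | ⟨h₁, h₂⟩ | ⟨h₁, h₂⟩)
    · exact lift hu hv h
    · exact hE'.trans (lift hu cP (hE.trans h₁ rA))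
        (hE'.trans hPQ (hE'.symm (lift hv cQ (hE.trans h₂ rB))))
    · exact hE'.trans (lift hu cQ (hE.trans h₁ rB))
        (hE'.trans (hE'.symm hPQ) (hE'.symm (lift hv cP (hE.trans h₂ rA))))

end Cap

section Height

open OkadaDiagram

variable {N : ℕ} {C D F : OkadaDiagram N} {i : ℕ} (hi : 1 ≤ i ∧ i < N)

theorem inSnd_hiNode : inSnd (hiNode i hi) = inOuter (hiNode i hi) := rfl

theorem inSnd_loNode : inSnd (loNode i hi) = inOuter (loNode i hi) := rfl

theorem concatGraph_mulElem_of_loop (hl : D.partner (hiNode i hi) = loNode i hi) :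
    concatGraph C (D.mulElem i hi) = concatGraph C D := by
  unfold concatGraph
  rw [mulElem_partner_of_loop hl]

theorem onCap_congr_of_loop (hl : D.partner (hiNode i hi) = loNode i hi) {u v : Node3 N}
    (h : (concatGraph C D).Reachable u v) : OnCap hi u ↔ OnCap hi v := by
  have hl' := D.partner_eq_comm.1 hl
  refine rel_of_reachable (R := fun u v => OnCap hi u ↔ OnCap hi v)
    ⟨fun _ => Iff.rfl, Iff.symm, Iff.trans⟩ (fun u => ?_) (fun u => ?_) h
  · exact iff_of_false (not_onCap_inFst hi _) (not_onCap_inFst hi _)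
  · rw [onCap_inSnd, onCap_inSnd, D.partner_eq_comm, hl, D.partner_eq_comm, hl', or_comm,
      @eq_comm _ u, @eq_comm _ u]

theorem heightAt_onCap_of_loop (hl : D.partner (hiNode i hi) = loNode i hi) {v : Node3 N}
    (hv : OnCap hi v) : heightAt C D v = D.label (hiNode i hi) := by
  have hlab : D.label (loNode i hi) = D.label (hiNode i hi) := by rw [← hl, D.label_partner]
  have hr : (concatGraph C D).Reachable (inSnd (hiNode i hi)) v := by
    rcases hv with rfl | rfl
    exacts [SimpleGraph.Reachable.rfl, hl ▸ reachable_inSnd C D (hiNode i hi)]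
  refine eq_of_forall_le_iff fun t => ?_
  rw [le_heightAt]
  refine ⟨fun h => h.2 _ hr, fun h => ⟨fun u hu => ?_, fun u hu => ?_⟩⟩
  · exact absurd ((onCap_congr_of_loop hi hl hu).2 hv) (not_onCap_inFst hi _)
  · rcases (onCap_inSnd hi).1 ((onCap_congr_of_loop hi hl hu).2 hv) with rfl | rfl
    exacts [h, hlab ▸ h]

theorem reachable_mulElem_iff_of_not_reachable {v : Node3 N}
    (hA : ¬ (concatGraph C D).Reachable v (inSnd (hiNode i hi)))
    (hB : ¬ (concatGraph C D).Reachable v (inSnd (loNode i hi))) (u : Node3 N) :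
    (concatGraph C (D.mulElem i hi)).Reachable u v ↔ (concatGraph C D).Reachable u v := by
  have hE := reachable_equivalence C D
  have hv : ¬ OnCap hi v := by
    rintro (rfl | rfl)
    exacts [hA (hE.refl _), hB (hE.refl _)]
  by_cases hl : D.partner (hiNode i hi) = loNode i hi
  · rw [concatGraph_mulElem_of_loop hi hl]
  by_cases hu : OnCap hi u
  · refine iff_of_false (fun h => hv ((onCap_congr_mulElem hi hl h).1 hu)) (fun h => ?_)
    rcases hu with rfl | rfl
    exacts [hA (hE.symm h), hB (hE.symm h)]
  · rw [reachable_mulElem_iff hi hl hu hv]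
    refine ⟨fun h => ?_, Or.inl⟩
    rcases h with h | h | h
    exacts [h, absurd h.2 hB, absurd h.2 hA]

theorem heightAt_mulElem_of_not_reachable {v : Node3 N}
    (hA : ¬ (concatGraph C D).Reachable v (inSnd (hiNode i hi)))
    (hB : ¬ (concatGraph C D).Reachable v (inSnd (loNode i hi))) :
    heightAt C (D.mulElem i hi) v = heightAt C D v := by
  have hE := reachable_equivalence C D
  refine eq_of_forall_le_iff fun t => ?_
  simp only [le_heightAt, reachable_mulElem_iff_of_not_reachable hi hA hB]
  refine and_congr_right fun _ => forall_congr' fun u => imp_congr_right fun hu => ?_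
  have hu' := hE.trans (hE.symm (reachable_inSnd C D u)) hu
  rw [D.mulElem_label_of_ne (hi := hi)]
  · rintro rfl
    exact hA (hE.symm hu)
  · rintro rfl
    exact hB (hE.symm hu)
  · intro e
    exact hA (hE.symm (e ▸ hu'))
  · intro e
    exact hB (hE.symm (e ▸ hu'))

theorem reachable_mulElem_iff_of_reachable (hl : D.partner (hiNode i hi) ≠ loNode i hi)
    {u v : Node3 N} (hu : ¬ OnCap hi u) (hv : ¬ OnCap hi v)
    (hAB : (concatGraph C D).Reachable v (inSnd (hiNode i hi)) ∨
      (concatGraph C D).Reachable v (inSnd (loNode i hi))) :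
    (concatGraph C (D.mulElem i hi)).Reachable u v ↔
      (concatGraph C D).Reachable u (inSnd (hiNode i hi)) ∨
      (concatGraph C D).Reachable u (inSnd (loNode i hi)) := by
  have hE := reachable_equivalence C D
  rw [reachable_mulElem_iff hi hl hu hv]
  constructor
  · rintro (h | h | h)
    exacts [hAB.imp (hE.trans h) (hE.trans h), Or.inl h.1, Or.inr h.1]
  · rintro (h | h) <;> rcases hAB with g | g
    exacts [Or.inl (hE.trans h (hE.symm g)), Or.inr (Or.inl ⟨h, g⟩), Or.inr (Or.inr ⟨h, g⟩),
      Or.inl (hE.trans h (hE.symm g))]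

theorem heightAt_mulElem_of_reachable (hl : D.partner (hiNode i hi) ≠ loNode i hi) {v : Node3 N}
    (hv : ¬ OnCap hi v)
    (hAB : (concatGraph C D).Reachable v (inSnd (hiNode i hi)) ∨
      (concatGraph C D).Reachable v (inSnd (loNode i hi))) :
    heightAt C (D.mulElem i hi) v =
      min (heightAt C D (inSnd (hiNode i hi))) (heightAt C D (inSnd (loNode i hi))) := by
  have hE := reachable_equivalence C D
  have hr := fun u hu => reachable_mulElem_iff_of_reachable (u := u) hi hl hu hv hAB
  refine eq_of_forall_le_iff fun t => ?_
  simp only [le_min_iff, le_heightAt]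
  constructor
  · rintro ⟨hC, hD⟩
    have hP := hD (D.partner (hiNode i hi)) ((hr _ (not_onCap_partner_hiNode hi hl)).2
      (Or.inl (hE.symm (reachable_inSnd C D _))))
    rw [mulElem_label_partner_hiNode hl, le_min_iff] at hP
    have hD' : ∀ u, ((concatGraph C D).Reachable (inSnd u) (inSnd (hiNode i hi)) ∨
        (concatGraph C D).Reachable (inSnd u) (inSnd (loNode i hi))) → t ≤ D.label u := by
      intro u hu
      by_cases hc : u = hiNode i hi ∨ u = loNode i hi
      · rcases hc with rfl | rfl
        exacts [hP.1, hP.2]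
      · exact (hD u ((hr _ (by rwa [onCap_inSnd])).2 hu)).trans (D.mulElem_label_le hc)
    exact ⟨⟨fun u hu => hC u ((hr _ (not_onCap_inFst hi _)).2 (Or.inl hu)),
      fun u hu => hD' u (Or.inl hu)⟩,
      ⟨fun u hu => hC u ((hr _ (not_onCap_inFst hi _)).2 (Or.inr hu)),
      fun u hu => hD' u (Or.inr hu)⟩⟩
  · rintro ⟨⟨hC, hD⟩, hC', hD'⟩
    refine ⟨fun u hu => ((hr _ (not_onCap_inFst hi _)).1 hu).elim (hC u) (hC' u), fun u hu => ?_⟩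
    have hc : ¬ OnCap hi (inSnd u) := fun h => hv ((onCap_congr_mulElem hi hl hu).1 h)
    exact (le_min (((hr _ hc).1 hu).elim (hD u) (hD' u))
      (le_min (hD _ (hE.refl _)) (hD' _ (hE.refl _)))).trans
      (D.min_label_le_mulElem_label (by rwa [onCap_inSnd] at hc))

end Height

/-! ### Composition with a product by an elementary diagram -/

section Composition

open OkadaDiagram

variable {N : ℕ} {C D F : OkadaDiagram N} {i : ℕ} (hi : 1 ≤ i ∧ i < N)

theorem IsComposition.label_eq_heightAt (h : IsComposition C D F) (u : Node N) :
    F.label u = heightAt C D (inOuter u) := h.2 u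

theorem IsComposition.loop (h : IsComposition C D F) (hl : D.partner (hiNode i hi) = loNode i hi) :
    F.partner (hiNode i hi) = loNode i hi ∧ F.label (hiNode i hi) = D.label (hiNode i hi) := by
  have hr := reachable_inSnd C D (hiNode i hi)
  rw [hl, inSnd_hiNode, inSnd_loNode, h.reachable_iff] at hr
  refine ⟨hr.resolve_left (hiNode_ne_loNode hi), ?_⟩
  rw [h.label_eq_heightAt]
  exact heightAt_onCap_of_loop hi hl (Or.inl rfl)

theorem IsComposition.not_reachable_of_ne (h : IsComposition C D F) {u : Node N}
    (hu : ¬ (u = hiNode i hi ∨ u = loNode i hi))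
    (hu' : ¬ (u = F.partner (hiNode i hi) ∨ u = F.partner (loNode i hi))) :
    ¬ (concatGraph C D).Reachable (inOuter u) (inSnd (hiNode i hi)) ∧
    ¬ (concatGraph C D).Reachable (inOuter u) (inSnd (loNode i hi)) := by
  rw [inSnd_hiNode, inSnd_loNode, h.reachable_iff, h.reachable_iff, F.partner_eq_comm,
    F.partner_eq_comm (v := loNode i hi), @eq_comm _ _ u, @eq_comm _ _ u]
  tauto

/-- The partner map of `F · G i` off the cap, in the form in which it is compared with
`reachable_mulElem_iff`. -/
theorem mulElem_partner_eq_iff (F : OkadaDiagram N) {u v : Node N}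
    (hu : ¬ (u = hiNode i hi ∨ u = loNode i hi)) (hv : ¬ (v = hiNode i hi ∨ v = loNode i hi)) :
    (F.mulElem i hi).partner u = v ↔ MergeRel (fun u v => F.partner u = v)
      (hiNode i hi) (loNode i hi) u v := by
  rw [not_or] at hu hv
  rw [mulElem_partner, if_neg hu.1, if_neg hu.2]
  have hv₁ := F.partner_eq_comm (u := v) (v := hiNode i hi)
  have hv₂ := F.partner_eq_comm (u := v) (v := loNode i hi)
  rw [MergeRel, hv₁, hv₂]
  split_ifs with h₁ h₂
  · simp only [h₁, F.partner_partner, Ne.symm hv.1, hiNode_ne_loNode, true_and, false_and,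
      false_or, or_false]
  · simp only [h₂, F.partner_partner, Ne.symm hv.2, (hiNode_ne_loNode hi).symm, true_and, false_and,
      false_or]
  · rw [← F.partner_inj, F.partner_partner] at h₁ h₂
    simp only [h₁, h₂, false_and, or_false]

theorem IsComposition.partner_mulElem_iff (h : IsComposition C D F) {u v : Node N} (huv : u ≠ v) :
    (F.mulElem i hi).partner u = v ↔
      (concatGraph C (D.mulElem i hi)).Reachable (inOuter u) (inOuter v) := by
  by_cases hl : D.partner (hiNode i hi) = loNode i hi
  · rw [concatGraph_mulElem_of_loop hi hl, mulElem_partner_of_loop (h.loop hi hl).1]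
    exact h.1 u v huv
  by_cases hu : u = hiNode i hi ∨ u = loNode i hi
  · have hcap := reachable_mulElem_cap hi C D
    refine ⟨?_, fun hr => ?_⟩
    · rcases hu with rfl | rfl
      · rw [mulElem_partner_hiNode]
        exact fun e => e ▸ hcap
      · rw [mulElem_partner_loNode]
        exact fun e => e ▸ hcap.symm
    · have hv := (onCap_inOuter hi).1
        ((onCap_congr_mulElem hi hl hr).1 ((onCap_inOuter hi).2 hu))
      rcases hu with rfl | rfl
      · rw [mulElem_partner_hiNode]
        exact (hv.resolve_left huv.symm).symm
      · rw [mulElem_partner_loNode]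
        exact (hv.resolve_right huv.symm).symm
  by_cases hv : v = hiNode i hi ∨ v = loNode i hi
  · refine iff_of_false (fun e => hu ?_) (fun hr => hu ?_)
    · rcases hv with rfl | rfl
      · rw [OkadaDiagram.partner_eq_comm, mulElem_partner_hiNode] at e
        exact Or.inr e.symm
      · rw [OkadaDiagram.partner_eq_comm, mulElem_partner_loNode] at e
        exact Or.inl e.symm
    · rwa [← onCap_inOuter, onCap_congr_mulElem hi hl hr, onCap_inOuter]
  rw [reachable_mulElem_iff hi hl (by rwa [onCap_inOuter]) (by rwa [onCap_inOuter]),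
    mulElem_partner_eq_iff hi F hu hv]
  rw [not_or] at hu hv
  simp only [MergeRel, inSnd_hiNode, inSnd_loNode, h.reachable_iff, hu.1, hu.2, hv.1, hv.2,
    false_or, huv]

theorem IsComposition.label_mulElem (h : IsComposition C D F) (u : Node N) :
    (F.mulElem i hi).label u = heightAt C (D.mulElem i hi) (inOuter u) := by
  by_cases hu : u = hiNode i hi ∨ u = loNode i hi
  · rw [mulElem_label_of_mem_cap F hu, heightAt_onCap_of_loop hi (mulElem_partner_hiNode D hi)
      ((onCap_inOuter hi).2 hu), mulElem_label_of_mem_cap D (Or.inl rfl)]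
  rw [mulElem_label, if_neg hu]
  split_ifs with hF
  · have hl : D.partner (hiNode i hi) ≠ loNode i hi := by
      intro hl
      have hhi := (h.loop hi hl).1
      rw [hhi, F.partner_eq_comm.1 hhi] at hF
      exact hu hF.symm
    have hr : (concatGraph C D).Reachable (inOuter u) (inSnd (hiNode i hi)) ∨
        (concatGraph C D).Reachable (inOuter u) (inSnd (loNode i hi)) := by
      rw [inSnd_hiNode, inSnd_loNode, h.reachable_iff, h.reachable_iff, F.partner_eq_comm,
        F.partner_eq_comm (v := loNode i hi)]
      exact hF.imp (fun e => Or.inr e.symm) (fun e => Or.inr e.symm)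
    rw [heightAt_mulElem_of_reachable hi hl (by rwa [onCap_inOuter]) hr, inSnd_hiNode,
      inSnd_loNode, ← h.label_eq_heightAt, ← h.label_eq_heightAt]
  · have hr := h.not_reachable_of_ne hi hu hF
    rw [heightAt_mulElem_of_not_reachable hi hr.1 hr.2, h.label_eq_heightAt]

theorem IsComposition.mulElem (h : IsComposition C D F) :
    IsComposition C (D.mulElem i hi) (F.mulElem i hi) :=
  ⟨fun _ _ huv => h.partner_mulElem_iff hi huv, h.label_mulElem hi⟩

end Composition

/-! ### Loops after multiplication by an elementary diagram -/

section Loops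

open OkadaDiagram

variable {N : ℕ} {C D F : OkadaDiagram N} {i : ℕ} (hi : 1 ≤ i ∧ i < N)

theorem loopSets_subset_loopSets_mulElem {k : ℕ} :
    loopSets C D k ⊆ loopSets C (D.mulElem i hi) k := by
  rintro S ⟨v, rfl, hinner, hk⟩
  have hA := fun g => hinner (hiNode i hi) (SimpleGraph.Reachable.symm g)
  have hB := fun g => hinner (loNode i hi) (SimpleGraph.Reachable.symm g)
  have hr := reachable_mulElem_iff_of_not_reachable hi hA hB
  refine ⟨v, by simp only [hr], fun u hu => hinner u ((hr _).1 hu), ?_⟩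
  rw [heightAt_mulElem_of_not_reachable hi hA hB, hk]

theorem mem_loopSets_of_not_reachable {k : ℕ} {v : Node3 N}
    (hinner : ∀ u, ¬ (concatGraph C (D.mulElem i hi)).Reachable (inOuter u) v)
    (hk : heightAt C (D.mulElem i hi) v = k)
    (hA : ¬ (concatGraph C D).Reachable v (inSnd (hiNode i hi)))
    (hB : ¬ (concatGraph C D).Reachable v (inSnd (loNode i hi))) :
    {w | (concatGraph C (D.mulElem i hi)).Reachable w v} ∈ loopSets C D k := by
  have hr := reachable_mulElem_iff_of_not_reachable hi hA hB
  refine ⟨v, by simp only [hr], fun u hu => hinner u ((hr _).2 hu), ?_⟩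
  rw [← heightAt_mulElem_of_not_reachable hi hA hB, hk]

theorem not_onCap_of_not_reachable {G : SimpleGraph (Node3 N)} {v : Node3 N}
    (h : ∀ u, ¬ G.Reachable (inOuter u) v) : ¬ OnCap hi v := by
  rintro (rfl | rfl)
  exacts [h (hiNode i hi) SimpleGraph.Reachable.rfl, h (loNode i hi) SimpleGraph.Reachable.rfl]

theorem loopSets_mulElem_of_loop (hl : D.partner (hiNode i hi) = loNode i hi) (k : ℕ) :
    loopSets C (D.mulElem i hi) k = loopSets C D k := by
  refine Set.Subset.antisymm ?_ (loopSets_subset_loopSets_mulElem hi)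
  rintro S ⟨v, rfl, hinner, hk⟩
  have hinner' := concatGraph_mulElem_of_loop hi hl ▸ hinner
  exact mem_loopSets_of_not_reachable hi hinner hk (fun g => hinner' (hiNode i hi) g.symm)
    (fun g => hinner' (loNode i hi) g.symm)

theorem IsComposition.loopSets_mulElem_of_ne (h : IsComposition C D F)
    (hl : D.partner (hiNode i hi) ≠ loNode i hi) (hF : F.partner (hiNode i hi) ≠ loNode i hi)
    (k : ℕ) : loopSets C (D.mulElem i hi) k = loopSets C D k := by
  have hE := reachable_equivalence C D
  refine Set.Subset.antisymm ?_ (loopSets_subset_loopSets_mulElem hi)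
  rintro S ⟨v, rfl, hinner, hk⟩
  have hout : ∀ u, ¬ OnCap hi (inOuter u) → ¬ (concatGraph C D).Reachable (inOuter u) v :=
    fun u hu g => hinner u ((reachable_mulElem_iff hi hl hu
      (not_onCap_of_not_reachable hi hinner)).2 (Or.inl g))
  have hA : (concatGraph C D).Reachable (inOuter (F.partner (hiNode i hi)))
      (inSnd (hiNode i hi)) := h.reachable_iff.2 (Or.inr (F.partner_partner _))
  have hB : (concatGraph C D).Reachable (inOuter (F.partner (loNode i hi)))
      (inSnd (loNode i hi)) := h.reachable_iff.2 (Or.inr (F.partner_partner _))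
  refine mem_loopSets_of_not_reachable hi hinner hk
    (fun g => hout _ ?_ (hE.trans hA (hE.symm g))) (fun g => hout _ ?_ (hE.trans hB (hE.symm g)))
  · rw [onCap_inOuter]
    exact not_or.2 ⟨F.partner_ne _, hF⟩
  · rw [onCap_inOuter]
    exact not_or.2 ⟨partner_loNode_ne hi hF, F.partner_ne _⟩

/-- The vertex set of the loop which appears when `G i` closes up the arc of `C ∘ D` through its
cap. -/
def closedLoop (C D : OkadaDiagram N) : Set (Node3 N) :=
  {w | ¬ OnCap hi w ∧ (concatGraph C D).Reachable w (inSnd (hiNode i hi))}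

theorem partner_hiNode_mem_closedLoop (hl : D.partner (hiNode i hi) ≠ loNode i hi) :
    inSnd (D.partner (hiNode i hi)) ∈ closedLoop hi C D :=
  ⟨not_onCap_partner_hiNode hi hl, (reachable_inSnd C D _).symm⟩

theorem IsComposition.inOuter_notMem_closedLoop (h : IsComposition C D F)
    (hF : F.partner (hiNode i hi) = loNode i hi) (u : Node N) :
    inOuter u ∉ closedLoop hi C D := by
  rintro ⟨hcap, hr⟩
  rw [inSnd_hiNode, h.reachable_iff, F.partner_eq_comm, hF] at hr
  exact hcap ((onCap_inOuter hi).2 (hr.imp id Eq.symm))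

theorem IsComposition.component_eq_closedLoop (h : IsComposition C D F)
    (hl : D.partner (hiNode i hi) ≠ loNode i hi) (hF : F.partner (hiNode i hi) = loNode i hi)
    {v : Node3 N} (hv : v ∈ closedLoop hi C D) :
    {w | (concatGraph C (D.mulElem i hi)).Reachable w v} = closedLoop hi C D := by
  have hE := reachable_equivalence C D
  have hAB : (concatGraph C D).Reachable (inSnd (hiNode i hi)) (inSnd (loNode i hi)) :=
    h.reachable_iff.2 (Or.inr hF)
  ext w
  by_cases hw : OnCap hi w
  · exact iff_of_false (fun g => hv.1 ((onCap_congr_mulElem hi hl g).1 hw)) fun g => g.1 hw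
  · rw [Set.mem_ofPred_eq, reachable_mulElem_iff_of_reachable hi hl hw hv.1 (Or.inl hv.2)]
    exact ⟨fun g => ⟨hw, g.elim _root_.id fun g => hE.trans g (hE.symm hAB)⟩, fun g => Or.inl g.2⟩

theorem IsComposition.heightAt_closedLoop (h : IsComposition C D F)
    (hl : D.partner (hiNode i hi) ≠ loNode i hi) (hF : F.partner (hiNode i hi) = loNode i hi)
    {v : Node3 N} (hv : v ∈ closedLoop hi C D) :
    heightAt C (D.mulElem i hi) v = F.label (hiNode i hi) := by
  have hAB : (concatGraph C D).Reachable (inSnd (hiNode i hi)) (inSnd (loNode i hi)) :=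
    h.reachable_iff.2 (Or.inr hF)
  rw [heightAt_mulElem_of_reachable hi hl hv.1 (Or.inl hv.2), ← heightAt_congr hAB, min_self,
    h.label_eq_heightAt, inSnd_hiNode]

theorem closedLoop_notMem_loopSets (hl : D.partner (hiNode i hi) ≠ loNode i hi) (k : ℕ) :
    closedLoop hi C D ∉ loopSets C D k := by
  have hE := reachable_equivalence C D
  have hP := partner_hiNode_mem_closedLoop (C := C) hi hl
  rintro ⟨v, hS, hinner, -⟩
  exact hinner (hiNode i hi) (hE.trans (hE.symm hP.2) (hS.subset hP))

theorem IsComposition.loopSets_mulElem_of_eq (h : IsComposition C D F)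
    (hl : D.partner (hiNode i hi) ≠ loNode i hi) (hF : F.partner (hiNode i hi) = loNode i hi)
    (k : ℕ) : loopSets C (D.mulElem i hi) k =
      if F.label (hiNode i hi) = k then insert (closedLoop hi C D) (loopSets C D k)
      else loopSets C D k := by
  have hE := reachable_equivalence C D
  have hAB : (concatGraph C D).Reachable (inSnd (hiNode i hi)) (inSnd (loNode i hi)) :=
    h.reachable_iff.2 (Or.inr hF)
  have hP := partner_hiNode_mem_closedLoop (C := C) hi hl
  refine Set.Subset.antisymm ?_ ?_
  · rintro S ⟨v, rfl, hinner, hk⟩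
    by_cases hA : (concatGraph C D).Reachable v (inSnd (hiNode i hi))
    · have hv : v ∈ closedLoop hi C D := ⟨not_onCap_of_not_reachable hi hinner, hA⟩
      rw [← hk, h.heightAt_closedLoop hi hl hF hv, if_pos rfl,
        h.component_eq_closedLoop hi hl hF hv]
      exact Set.mem_insert _ _
    · have hmem := mem_loopSets_of_not_reachable hi hinner hk hA
        (fun g => hA (hE.trans g (hE.symm hAB)))
      split_ifs
      exacts [Set.mem_insert_of_mem _ hmem, hmem]
  · split_ifs with hk
    · have hcomp := h.component_eq_closedLoop hi hl hF hP
      refine Set.insert_subset ⟨_, hcomp.symm, fun u hu => ?_, ?_⟩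
        (loopSets_subset_loopSets_mulElem hi)
      · exact h.inOuter_notMem_closedLoop hi hF u (hcomp.subset hu)
      · rw [h.heightAt_closedLoop hi hl hF hP, hk]
    · exact loopSets_subset_loopSets_mulElem hi

/-- A loop of `[C ∘ D] · G i` is either a loop of `D · G i` or a loop of `C ∘ (D · G i)` which is
not a loop of `C ∘ D`. -/
theorem loopCount_mulElem (h : IsComposition C D F) (k : ℕ) :
    loopCount C (D.mulElem i hi) k + D.loopAt i hi k = loopCount C D k + F.loopAt i hi k := by
  rw [loopCount_eq_ncard_loopSets, loopCount_eq_ncard_loopSets]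
  by_cases hl : D.partner (hiNode i hi) = loNode i hi
  · rw [loopSets_mulElem_of_loop hi hl, loopAt, loopAt, (h.loop hi hl).2]
    simp only [hl, (h.loop hi hl).1]
  rw [show D.loopAt i hi k = 0 from if_neg fun g => hl g.1, add_zero]
  by_cases hF : F.partner (hiNode i hi) = loNode i hi
  · rw [h.loopSets_mulElem_of_eq hi hl hF, loopAt]
    by_cases hk : F.label (hiNode i hi) = k
    · rw [if_pos hk, if_pos ⟨hF, hk⟩,
        Set.ncard_insert_of_notMem (closedLoop_notMem_loopSets hi hl k) (Set.toFinite _)]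
    · rw [if_neg hk, if_neg (fun g => hk g.2), add_zero]
  · rw [h.loopSets_mulElem_of_ne hi hl hF, loopAt, if_neg fun g => hF g.1, add_zero]

end Loops

/-! ### The unit -/

section Identity

open OkadaDiagram

variable {N : ℕ}

/-- The retraction of the concatenation with the identity diagram onto the nodes of the first
diagram. -/
def retract : Node3 N → Node N
  | Sum.inl a => Sum.inl a
  | Sum.inr (Sum.inl a) => Sum.inr a
  | Sum.inr (Sum.inr a) => Sum.inr a

theorem retract_inFst (u : Node N) : retract (inFst u) = u := by rcases u with u | u <;> rfl

theorem retract_inOuter (u : Node N) : retract (inOuter u) = u := by rcases u with u | u <;> rfl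

theorem OkadaDiagram.eq_or_partner_eq_equivalence (C : OkadaDiagram N) :
    Equivalence fun u v => u = v ∨ C.partner u = v := by
  refine ⟨fun _ => Or.inl rfl, fun h => h.imp Eq.symm C.partner_eq_comm.1, ?_⟩
  rintro u v w (rfl | rfl) h
  · exact h
  · rw [C.partner_partner] at h
    exact h.symm

theorem reachable_inFst_retract (C : OkadaDiagram N) (p : Node3 N) :
    (concatGraph C (OkadaDiagram.id N)).Reachable p (inFst (retract p)) := by
  rcases p with a | a | a
  · exact SimpleGraph.Reachable.rfl
  · exact SimpleGraph.Reachable.rfl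
  · exact reachable_inSnd C (OkadaDiagram.id N) (Sum.inr a)

theorem reachable_id_iff (C : OkadaDiagram N) {p q : Node3 N} :
    (concatGraph C (OkadaDiagram.id N)).Reachable p q ↔
      retract p = retract q ∨ C.partner (retract p) = retract q := by
  constructor
  · refine rel_of_reachable (R := fun p q => retract p = retract q ∨
      C.partner (retract p) = retract q) (C.eq_or_partner_eq_equivalence.comap retract) ?_ ?_
    · intro u
      exact Or.inr (by rw [retract_inFst, retract_inFst])
    · rintro (u | u) <;> exact Or.inl rfl
  · have hq := (reachable_inFst_retract C q).symm
    rintro (h | h)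
    · exact (reachable_inFst_retract C p).trans (h ▸ hq)
    · exact (reachable_inFst_retract C p).trans ((reachable_inFst _ _ _).trans (h ▸ hq))

theorem label_eq_heightAt_id (C : OkadaDiagram N) (u : Node N) :
    C.label u = heightAt C (OkadaDiagram.id N) (inOuter u) := by
  refine eq_of_forall_le_iff fun t => ?_
  simp only [le_heightAt, reachable_id_iff, retract_inFst, retract_inOuter]
  refine ⟨fun h => ?_, fun h => h.1 u (Or.inl rfl)⟩
  have hC : ∀ v, v = u ∨ C.partner v = u → t ≤ C.label v := by
    rintro v (rfl | rfl)
    · exact h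
    · rwa [C.label_partner] at h
  refine ⟨hC, fun v hv => ?_⟩
  have hv' : (OkadaDiagram.id N).label v = (retract (inSnd v)).level := by
    rcases v with v | v <;> rfl
  rw [hv']
  exact (hC _ hv).trans (C.label_le_level _)

theorem isComposition_id (C : OkadaDiagram N) : IsComposition C (OkadaDiagram.id N) C := by
  refine ⟨fun u v huv => ?_, label_eq_heightAt_id C⟩
  rw [reachable_id_iff, retract_inOuter, retract_inOuter, or_iff_right huv]

theorem loopCount_id (C : OkadaDiagram N) (k : ℕ) : loopCount C (OkadaDiagram.id N) k = 0 := by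
  have hempty : loopSets C (OkadaDiagram.id N) k = ∅ := by
    rw [Set.eq_empty_iff_forall_notMem]
    rintro S ⟨v, -, h, -⟩
    exact h (retract v) (by rw [reachable_id_iff, retract_inOuter]; exact Or.inl rfl)
  rw [loopCount_eq_ncard_loopSets, hempty, Set.ncard_empty]

variable {i : ℕ} (hi : 1 ≤ i ∧ i < N)

theorem id_partner_hiNode_ne : (OkadaDiagram.id N).partner (hiNode i hi) ≠ loNode i hi := by
  simp [OkadaDiagram.id, hiNode, loNode, Node.mirror]

theorem loopAt_id (k : ℕ) : (OkadaDiagram.id N).loopAt i hi k = 0 :=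
  if_neg fun h => id_partner_hiNode_ne hi h.1

theorem isComposition_elem (C : OkadaDiagram N) : IsComposition C (elem i hi) (C.mulElem i hi) := by
  rw [← id_mulElem]
  exact (isComposition_id C).mulElem hi

theorem loopCount_elem (C : OkadaDiagram N) (k : ℕ) :
    loopCount C (elem i hi) k = C.loopAt i hi k := by
  have h := loopCount_mulElem hi (isComposition_id C) k
  rwa [id_mulElem, loopAt_id, loopCount_id, zero_add, add_zero] at h

end Identity

/-! ### Boxes and the exponents of the parameters `y` -/

section Boxes

open OkadaDiagram

variable {N : ℕ}

theorem even_card_of_involutive {α : Type*} {s : Finset α} {f : α → α}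
    (hf : Function.Involutive f) (hne : ∀ a, f a ≠ a) (hs : ∀ a ∈ s, f a ∈ s) : Even s.card := by
  have hsum : ∑ _u ∈ s, (1 : ZMod 2) = 0 :=
    Finset.sum_involution (fun u _ => f u) (fun _ _ => by decide) (fun u _ _ => hne u) hs
      (fun u _ => hf u)
  rwa [Finset.sum_const, nsmul_one, ZMod.natCast_eq_zero_iff_even] at hsum

theorem sum_add_sum_eq_of_forall_notMem {α M : Type*} [Fintype α] [AddCommMonoid M]
    (s : Finset α) {f g : α → M} (h : ∀ a ∉ s, f a = g a) :
    ∑ a, f a + ∑ a ∈ s, g a = ∑ a, g a + ∑ a ∈ s, f a := by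
  classical
  rw [← Finset.sum_add_sum_compl s f, ← Finset.sum_add_sum_compl s g,
    Finset.sum_congr rfl fun a ha => h a (Finset.mem_compl.1 ha)]
  abel

/-- The indicator of the rows from `a` to `b - 1`. -/
def rows (k a b : ℕ) : ℕ := if a ≤ k ∧ k < b then 1 else 0

theorem rows_add {k a b c : ℕ} (hab : a ≤ b) (hbc : b ≤ c) :
    rows k a b + rows k b c = rows k a c := by
  unfold rows
  split_ifs <;> omega

theorem rows_self (k a : ℕ) : rows k a a = 0 := if_neg fun h => h.2.not_ge h.1

/-- The number of passages of strands through row `k`, which is twice the number of boxes of `D`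
in row `k`: a strand of label `h` starting at level `l` descends through the rows from `h` to
`l - 1`. -/
def passages (D : OkadaDiagram N) (k : ℕ) : ℕ := ∑ u : Node N, rows k (D.label u) u.level

theorem passages_eq_card (D : OkadaDiagram N) (k : ℕ) : passages D k =
    (Finset.univ.filter fun u : Node N => D.label u ≤ k ∧ k < u.level).card :=
  (Finset.card_filter _ _).symm

theorem even_passages (D : OkadaDiagram N) (k : ℕ) : Even (passages D k) := by
  have hlevel : Even (Finset.univ.filter fun u : Node N => k < u.level).card :=
    even_card_of_involutive Node.mirror_mirror (OkadaDiagram.id N).partner_ne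
      fun u hu => by simpa [Node.level_mirror] using hu
  have hlabel : Even (Finset.univ.filter fun u : Node N => k < D.label u).card :=
    even_card_of_involutive D.partner_partner D.partner_ne
      fun u hu => by simpa [D.label_partner] using hu
  have hsum : passages D k + (Finset.univ.filter fun u : Node N => k < D.label u).card =
      (Finset.univ.filter fun u : Node N => k < u.level).card := by
    rw [passages, Finset.card_filter, Finset.card_filter, ← Finset.sum_add_distrib]
    refine Finset.sum_congr rfl fun u _ => ?_
    have := D.label_le_level u
    unfold rows
    split_ifs <;> omega
  rw [← hsum, Nat.even_add] at hlevel
  exact hlevel.2 hlabel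

theorem two_mul_boxCount (D : OkadaDiagram N) (k : ℕ) : 2 * boxCount D k = passages D k := by
  rw [boxCount, ← passages_eq_card, Nat.two_mul_div_two_of_even (even_passages D k)]

theorem passages_id (k : ℕ) : passages (OkadaDiagram.id N) k = 0 :=
  Finset.sum_eq_zero fun u _ => rows_self k u.level

variable {i : ℕ} (hi : 1 ≤ i ∧ i < N)

theorem level_hiNode : (hiNode i hi).level = i + 1 := rfl

theorem level_loNode : (loNode i hi).level = i := Nat.sub_add_cancel hi.1

theorem label_hiNode_le (D : OkadaDiagram N) : D.label (hiNode i hi) ≤ i + 1 := D.label_le_level _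

theorem label_loNode_le (D : OkadaDiagram N) : D.label (loNode i hi) ≤ i :=
  (D.label_le_level _).trans (level_loNode hi).le

theorem label_loNode_of_loop {D : OkadaDiagram N} (hl : D.partner (hiNode i hi) = loNode i hi) :
    D.label (loNode i hi) = D.label (hiNode i hi) := by rw [← hl, D.label_partner]

theorem passages_mulElem_of_loop {D : OkadaDiagram N}
    (hl : D.partner (hiNode i hi) = loNode i hi) (k : ℕ) :
    passages D k + 2 * rows k i (i + 1) =
      passages (D.mulElem i hi) k + 2 * rows k (D.label (hiNode i hi)) (i + 1) := by
  have hoff : ∀ u ∉ ({hiNode i hi, loNode i hi} : Finset (Node N)),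
      rows k (D.label u) u.level = rows k ((D.mulElem i hi).label u) u.level := by
    intro u hu
    rw [Finset.mem_insert, Finset.mem_singleton] at hu
    rw [mulElem_label, if_neg hu, if_neg]
    rwa [hl, D.partner_eq_comm.1 hl, or_comm]
  have hsum := sum_add_sum_eq_of_forall_notMem _ hoff
  rw [Finset.sum_pair (hiNode_ne_loNode hi), Finset.sum_pair (hiNode_ne_loNode hi),
    mulElem_label_of_mem_cap D (Or.inl rfl), mulElem_label_of_mem_cap D (Or.inr rfl),
    label_loNode_of_loop hi hl, level_hiNode, level_loNode, rows_self] at hsum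
  have hle := label_loNode_le hi D
  rw [label_loNode_of_loop hi hl] at hle
  have hrow := rows_add (k := k) hle (Nat.le_add_right i 1)
  unfold passages
  omega

theorem rows_add_rows_min {k i x y p q : ℕ} (hx : x ≤ i + 1) (hy : y ≤ i) (hp : x ≤ p)
    (hq : y ≤ q) :
    rows k x (i + 1) + rows k y i + rows k x p + rows k y q + rows k i (i + 1) =
      rows k (min x y) p + rows k (min x y) q + 2 * rows k (max x y) (i + 1) := by
  have hyi := rows_add (k := k) hy (Nat.le_add_right i 1)
  rcases le_total x y with hxy | hxy
  · rw [min_eq_left hxy, max_eq_right hxy]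
    have hxq := rows_add (k := k) hxy hq
    have hxi := rows_add (k := k) hxy (hy.trans (Nat.le_add_right i 1))
    omega
  · rw [min_eq_right hxy, max_eq_left hxy]
    have hyp := rows_add (k := k) hxy hp
    have hyi' := rows_add (k := k) hxy hx
    omega

theorem passages_mulElem_of_ne {D : OkadaDiagram N}
    (hl : D.partner (hiNode i hi) ≠ loNode i hi) (k : ℕ) :
    passages D k + 2 * rows k i (i + 1) = passages (D.mulElem i hi) k +
      2 * rows k (max (D.label (hiNode i hi)) (D.label (loNode i hi))) (i + 1) := by
  have hne := hiNode_ne_loNode hi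
  have hlo := partner_loNode_ne hi hl
  have hoff : ∀ u ∉ ({hiNode i hi, loNode i hi, D.partner (hiNode i hi),
      D.partner (loNode i hi)} : Finset (Node N)),
      rows k (D.label u) u.level = rows k ((D.mulElem i hi).label u) u.level := by
    intro u hu
    simp only [Finset.mem_insert, Finset.mem_singleton, not_or] at hu
    rw [mulElem_label, if_neg (not_or.2 ⟨hu.1, hu.2.1⟩), if_neg (not_or.2 hu.2.2)]
  have hA : hiNode i hi ∉ ({loNode i hi, D.partner (hiNode i hi), D.partner (loNode i hi)} :
      Finset (Node N)) := by
    simp only [Finset.mem_insert, Finset.mem_singleton, not_or]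
    exact ⟨hne, (D.partner_ne _).symm, hlo.symm⟩
  have hB : loNode i hi ∉ ({D.partner (hiNode i hi), D.partner (loNode i hi)} :
      Finset (Node N)) := by
    simp only [Finset.mem_insert, Finset.mem_singleton, not_or]
    exact ⟨hl.symm, (D.partner_ne _).symm⟩
  have hP : (D.mulElem i hi).label (D.partner (hiNode i hi)) =
      min (D.label (hiNode i hi)) (D.label (loNode i hi)) := by
    rw [mulElem_label, if_neg (not_or.2 ⟨D.partner_ne _, hl⟩), if_pos (Or.inl rfl)]
  have hQ : (D.mulElem i hi).label (D.partner (loNode i hi)) =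
      min (D.label (hiNode i hi)) (D.label (loNode i hi)) := by
    rw [mulElem_label, if_neg (not_or.2 ⟨hlo, D.partner_ne _⟩), if_pos (Or.inr rfl)]
  have hsum := sum_add_sum_eq_of_forall_notMem _ hoff
  simp only [Finset.sum_insert hA, Finset.sum_insert hB, Finset.sum_pair (D.partner_inj.not.2 hne),
    hP, hQ, mulElem_label_of_mem_cap D (Or.inl rfl), mulElem_label_of_mem_cap D (Or.inr rfl),
    level_hiNode, level_loNode, D.label_partner, rows_self] at hsum
  have hrows := rows_add_rows_min (k := k) (label_hiNode_le hi D) (label_loNode_le hi D)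
    ((D.label_partner (hiNode i hi)).symm.le.trans (D.label_le_level _))
    ((D.label_partner (loNode i hi)).symm.le.trans (D.label_le_level _))
  unfold passages
  omega

/-- The lowest row in which the rewriting of the composition of `D` and `G i` loses a box, other
than the one lost with a loop. -/
def dropRow (D : OkadaDiagram N) : ℕ :=
  if D.partner (hiNode i hi) = loNode i hi then D.label (hiNode i hi) + 1
  else max (D.label (hiNode i hi)) (D.label (loNode i hi))

theorem label_hiNode_parity_of_loop {D : OkadaDiagram N}
    (hl : D.partner (hiNode i hi) = loNode i hi) : D.label (hiNode i hi) % 2 = i % 2 := by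
  have hle := D.label_le (hiNode i hi)
  have hparity := D.label_parity (hiNode i hi)
  rw [hl, level_hiNode, level_loNode] at hle hparity
  omega

theorem one_le_dropRow (D : OkadaDiagram N) : 1 ≤ dropRow hi D := by
  have := D.one_le_label (hiNode i hi)
  unfold dropRow
  split_ifs <;> omega

theorem dropRow_le (D : OkadaDiagram N) : dropRow hi D ≤ i + 1 := by
  have hA := label_hiNode_le hi D
  have hB := label_loNode_le hi D
  unfold dropRow
  split_ifs with hl
  · rw [← label_loNode_of_loop hi hl]
    omega
  · omega

theorem dropRow_parity (D : OkadaDiagram N) : dropRow hi D % 2 = (i + 1) % 2 := by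
  unfold dropRow
  split_ifs with hl
  · have := label_hiNode_parity_of_loop hi hl
    omega
  · have hne : D.partnerAt (2 * N - 1 - i) ≠ 2 * N - 1 - i + 1 := by
      rw [← pos_loNode hi, ← pos_hiNode hi, partnerAt_pos]
      exact fun e => hl (Node.pos_injective e)
    have hmax := (D.isArcSystem.min_max_label_parity (by omega) hne).2
    rw [← pos_loNode hi, ← pos_hiNode hi, labelAt_pos, labelAt_pos, pos_hiNode] at hmax
    omega

/-- A box is added in row `i`, one is lost in the row of the loop (if there is one), and one in each
of the rows from `dropRow` to `i`. -/
theorem passages_mulElem (D : OkadaDiagram N) (k : ℕ) :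
    passages D k + 2 * rows k i (i + 1) = passages (D.mulElem i hi) k + 2 * D.loopAt i hi k +
      2 * rows k (dropRow hi D) (i + 1) := by
  by_cases hl : D.partner (hiNode i hi) = loNode i hi
  · have hdrop := dropRow_le hi D
    rw [dropRow, if_pos hl] at hdrop ⊢
    have hloop : D.loopAt i hi k = rows k (D.label (hiNode i hi)) (D.label (hiNode i hi) + 1) := by
      simp only [loopAt, hl, true_and, rows, Nat.lt_succ_iff, le_antisymm_iff]
    rw [passages_mulElem_of_loop hi hl, hloop, add_assoc, ← mul_add,
      rows_add (Nat.le_add_right _ 1) hdrop]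
  · rw [passages_mulElem_of_ne hi hl, dropRow, if_neg hl, loopAt, if_neg fun g => hl g.1, mul_zero,
      add_zero]

/-- The exponent of `y k` in the product of `D` and `G i`. -/
def elemExp (D : OkadaDiagram N) (k : ℕ) : ℕ :=
  if dropRow hi D ≤ k ∧ k < i ∧ (k + dropRow hi D) % 2 = 0 then 1 else 0

theorem elemExp_zero (D : OkadaDiagram N) : elemExp hi D 0 = 0 := by
  have := one_le_dropRow hi D
  exact if_neg fun h => by omega

theorem elemExp_succ_add (D : OkadaDiagram N) (k : ℕ) :
    elemExp hi D (k + 1) + elemExp hi D k = rows (k + 1) (dropRow hi D) (i + 1) := by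
  have := one_le_dropRow hi D
  have := dropRow_parity hi D
  unfold elemExp rows
  split_ifs <;> omega

/-- `M k` is the exponent of `y k` in the product of `C` and `D`, whose composition is `F`. The
equation is twice the recursion defining `yCount`, written without subtraction. -/
def IsYExp (C D F : OkadaDiagram N) (M : ℕ → ℕ) : Prop :=
  M 0 = 0 ∧ ∀ k, passages C (k + 1) + passages D (k + 1) = passages F (k + 1) +
    2 * loopCount C D (k + 1) + 2 * M (k + 1) + 2 * M k

theorem IsYExp.yCount_eq {C D F : OkadaDiagram N} {M : ℕ → ℕ} (h : IsYExp C D F M) (k : ℕ) :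
    yCount C D F k = M k := by
  induction k with
  | zero => rw [h.1]; rfl
  | succ k ih =>
    have hk := h.2 k
    simp only [← two_mul_boxCount] at hk
    rw [yCount, ih]
    omega

theorem isYExp_id (C : OkadaDiagram N) : IsYExp C (OkadaDiagram.id N) C fun _ => 0 :=
  ⟨rfl, fun k => by simp only [passages_id, loopCount_id, mul_zero, add_zero]⟩

theorem dropRow_id : dropRow hi (OkadaDiagram.id N) = i + 1 := by
  rw [dropRow, if_neg (id_partner_hiNode_ne hi)]
  exact max_eq_left ((label_loNode_le hi _).trans (Nat.le_add_right i 1))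

theorem passages_elem (k : ℕ) : passages (elem i hi) k = 2 * rows k i (i + 1) := by
  have h := passages_mulElem hi (OkadaDiagram.id N) k
  rw [passages_id, loopAt_id, id_mulElem, dropRow_id, rows_self] at h
  omega

theorem isYExp_elem (C : OkadaDiagram N) :
    IsYExp C (elem i hi) (C.mulElem i hi) (elemExp hi C) := by
  refine ⟨elemExp_zero hi C, fun k => ?_⟩
  have hpassages := passages_mulElem hi C (k + 1)
  have hexp := elemExp_succ_add hi C k
  rw [passages_elem, loopCount_elem]
  omega

section MulElem

variable {C D F : OkadaDiagram N} {M M' : ℕ → ℕ}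

theorem IsYExp.balance (h : IsYExp C D F M) (hF : IsComposition C D F) (k : ℕ) :
    passages C (k + 1) + passages (D.mulElem i hi) (k + 1) +
        2 * (elemExp hi D (k + 1) + elemExp hi D k) =
      passages (F.mulElem i hi) (k + 1) + 2 * loopCount C (D.mulElem i hi) (k + 1) +
        2 * (M (k + 1) + M k) + 2 * (elemExp hi F (k + 1) + elemExp hi F k) := by
  have hD := passages_mulElem hi D (k + 1)
  have hFk := passages_mulElem hi F (k + 1)
  have hloop := loopCount_mulElem hi hF (k + 1)
  have hk := h.2 k
  rw [elemExp_succ_add, elemExp_succ_add]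
  omega

theorem IsYExp.mulElem (hF : IsComposition C D F) (h : IsYExp C D F M) (hzero : M' 0 = 0)
    (hM : ∀ k, M' k + elemExp hi D k = M k + elemExp hi F k) :
    IsYExp C (D.mulElem i hi) (F.mulElem i hi) M' := by
  refine ⟨hzero, fun k => ?_⟩
  have hbal := h.balance hi hF k
  have hsucc := hM (k + 1)
  have hk := hM k
  omega

theorem elemExp_add (hF : IsComposition C D F) (h : IsYExp C D F M)
    (h' : IsYExp C (D.mulElem i hi) (F.mulElem i hi) M') (k : ℕ) :
    M' k + elemExp hi D k = M k + elemExp hi F k := by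
  induction k with
  | zero => rw [h.1, h'.1, elemExp_zero, elemExp_zero]
  | succ k ih =>
    have hbal := h.balance hi hF k
    have hk := h'.2 k
    omega

end MulElem

end Boxes

/-! ### Insertion of an arc joining two adjacent positions -/

/-- The increasing map of positions which skips `a` and `a + 1`. -/
def skip (a k : ℕ) : ℕ := if k < a then k else k + 2

/-- The left inverse of `skip a`. -/
def unskip (a k : ℕ) : ℕ := if k < a then k else k - 2

theorem unskip_skip (a k : ℕ) : unskip a (skip a k) = k := by
  unfold skip unskip; split_ifs <;> omega

theorem skip_unskip {a k : ℕ} (h₁ : k ≠ a) (h₂ : k ≠ a + 1) : skip a (unskip a k) = k := by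
  unfold skip unskip; split_ifs <;> omega

theorem skip_of_lt {a k : ℕ} (h : k < a) : skip a k = k := if_pos h

theorem skip_of_le {a k : ℕ} (h : a ≤ k) : skip a k = k + 2 := if_neg h.not_gt

theorem skip_ne (a k : ℕ) : skip a k ≠ a := by
  unfold skip; split_ifs <;> omega

theorem skip_ne_succ (a k : ℕ) : skip a k ≠ a + 1 := by
  unfold skip; split_ifs <;> omega

theorem skip_lt_skip {a k m : ℕ} : skip a k < skip a m ↔ k < m := by
  unfold skip; split_ifs <;> omega

theorem skip_inj {a k m : ℕ} : skip a k = skip a m ↔ k = m := by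
  unfold skip; split_ifs <;> omega

theorem skip_mod_two (a k : ℕ) : skip a k % 2 = k % 2 := by
  unfold skip; split_ifs <;> omega

theorem max_skip_mod_two (a k m : ℕ) : max (skip a k) (skip a m) % 2 = max k m % 2 := by
  have hmono : Monotone (skip a) := fun x y hxy => by
    unfold skip; split_ifs <;> omega
  rw [← hmono.map_max, skip_mod_two]

theorem skip_lt_iff {M a k : ℕ} (ha : a ≤ 2 * M) : skip a k < 2 * (M + 1) ↔ k < 2 * M := by
  unfold skip; split_ifs <;> omega

theorem skip_mem_uIoo {a u v y : ℕ} :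
    skip a y ∈ Set.uIoo (skip a u) (skip a v) ↔ y ∈ Set.uIoo u v := by
  simp only [mem_uIoo_iff, skip_lt_skip]

theorem skip_succ_self (a : ℕ) : skip (a + 1) a = a := skip_of_lt (Nat.lt_succ_self a)

theorem skip_succ_of_ne {a k : ℕ} (h : k ≠ a) : skip (a + 1) k = skip a k := by
  unfold skip; split_ifs <;> omega

theorem eq_or_eq_or_exists_eq_skip (a k : ℕ) : k = a ∨ k = a + 1 ∨ ∃ m, k = skip a m := by
  by_cases h₁ : k = a
  · exact Or.inl h₁
  by_cases h₂ : k = a + 1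
  · exact Or.inr (Or.inl h₂)
  exact Or.inr (Or.inr ⟨_, (skip_unskip h₁ h₂).symm⟩)

theorem forall_of_forall_skip {M a : ℕ} (ha : a ≤ 2 * M) {Q : ℕ → Prop} (left : Q a)
    (right : Q (a + 1)) (hskip : ∀ k < 2 * M, Q (skip a k)) : ∀ k < 2 * (M + 1), Q k := by
  intro k hk
  rcases eq_or_eq_or_exists_eq_skip a k with rfl | rfl | ⟨m, rfl⟩
  exacts [left, right, hskip m ((skip_lt_iff ha).1 hk)]

/-- The matching with an additional arc joining `a` and `a + 1`. -/
def insertPartner (P : ℕ → ℕ) (a k : ℕ) : ℕ :=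
  if k = a then a + 1 else if k = a + 1 then a else skip a (P (unskip a k))

/-- The labels after the insertion of an arc of label `s` joining `a` and `a + 1`. -/
def insertLabel (L : ℕ → ℕ) (a s k : ℕ) : ℕ := if k = a ∨ k = a + 1 then s else L (unskip a k)

section InsertPartner

variable (P L : ℕ → ℕ) (a s k : ℕ)

theorem insertPartner_left : insertPartner P a a = a + 1 := if_pos rfl

theorem insertPartner_right : insertPartner P a (a + 1) = a := by
  rw [insertPartner, if_neg a.succ_ne_self, if_pos rfl]

theorem insertPartner_skip : insertPartner P a (skip a k) = skip a (P k) := by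
  rw [insertPartner, if_neg (skip_ne a k), if_neg (skip_ne_succ a k), unskip_skip]

theorem insertPartner_add_two : insertPartner P a (a + 2) = skip a (P a) := by
  rw [← insertPartner_skip, skip_of_le le_rfl]

theorem insertLabel_left : insertLabel L a s a = s := if_pos (Or.inl rfl)

theorem insertLabel_right : insertLabel L a s (a + 1) = s := if_pos (Or.inr rfl)

theorem insertLabel_skip : insertLabel L a s (skip a k) = L k := by
  rw [insertLabel, if_neg (not_or.2 ⟨skip_ne a k, skip_ne_succ a k⟩), unskip_skip]

theorem insertLabel_add_two : insertLabel L a s (a + 2) = L a := by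
  rw [← insertLabel_skip L a s a, skip_of_le le_rfl]

end InsertPartner

namespace IsArcSystem

variable {M a s : ℕ} {P L : ℕ → ℕ}

theorem insertPartner_noncrossing (h : IsArcSystem M P L) (ha : a ≤ 2 * M) :
    ∀ u < 2 * (M + 1), ∀ v < 2 * (M + 1), v ∈ Set.uIoo u (insertPartner P a u) →
      insertPartner P a v ∈ Set.uIoo u (insertPartner P a u) := by
  have hsucc : ∀ u v, a + 1 ∈ Set.uIoo (skip a u) (skip a v) ↔ a ∈ Set.uIoo (skip a u) (skip a v) :=
    fun u v => mem_uIoo_succ_iff (skip_ne a u) (skip_ne_succ a u) (skip_ne a v) (skip_ne_succ a v)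
  refine forall_of_forall_skip ha ?_ ?_ fun u hu => forall_of_forall_skip ha ?_ ?_ fun v hv => ?_
  · rw [insertPartner_left]
    exact fun v _ hv => absurd hv notMem_uIoo_succ
  · rw [insertPartner_right, Set.uIoo_comm]
    exact fun v _ hv => absurd hv notMem_uIoo_succ
  · rw [insertPartner_left, insertPartner_skip]
    exact (hsucc _ _).2
  · rw [insertPartner_right, insertPartner_skip]
    exact (hsucc _ _).1
  · rw [insertPartner_skip, insertPartner_skip, skip_mem_uIoo, skip_mem_uIoo]
    exact h.noncrossing u hu v hv

theorem label_lt_of_mem_uIoo_skip (h : IsArcSystem M P L) (ha : a + s = 2 * M + 1) {k : ℕ}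
    (hk : k < 2 * M)
    (hmem : a ∈ Set.uIoo (skip a k) (skip a (P k)) ∨ a + 1 ∈ Set.uIoo (skip a k) (skip a (P k))) :
    L k < s := by
  have hle := h.le k hk
  have hlt := h.lt k hk
  have hle' := h.le (P k) hlt
  rw [h.label_partner k hk] at hle'
  simp only [mem_uIoo_iff, skip] at hmem
  split_ifs at hmem <;> omega

theorem insertLabel_nested (h : IsArcSystem M P L) (ha : a + s = 2 * M + 1)
    (ha' : a ≤ 2 * M) :
    ∀ u < 2 * (M + 1), ∀ v < 2 * (M + 1), v ∈ Set.uIoo u (insertPartner P a u) →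
      insertLabel L a s u < insertLabel L a s v := by
  refine forall_of_forall_skip ha' ?_ ?_ fun u hu => forall_of_forall_skip ha' ?_ ?_ fun v hv => ?_
  · rw [insertPartner_left]
    exact fun v _ hv => absurd hv notMem_uIoo_succ
  · rw [insertPartner_right, Set.uIoo_comm]
    exact fun v _ hv => absurd hv notMem_uIoo_succ
  · rw [insertPartner_skip, insertLabel_skip, insertLabel_left]
    exact fun hm => h.label_lt_of_mem_uIoo_skip ha hu (Or.inl hm)
  · rw [insertPartner_skip, insertLabel_skip, insertLabel_right]
    exact fun hm => h.label_lt_of_mem_uIoo_skip ha hu (Or.inr hm)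
  · rw [insertPartner_skip, insertLabel_skip, insertLabel_skip, skip_mem_uIoo]
    exact h.nested u hu v hv

theorem insertLabel_le (h : IsArcSystem M P L) (hs : s ≤ M + 1) (ha : a + s = 2 * M + 1)
    (ha' : a ≤ 2 * M) : ∀ k < 2 * (M + 1),
      insertLabel L a s k ≤ k + 1 ∧ insertLabel L a s k ≤ 2 * (M + 1) - k := by
  refine forall_of_forall_skip ha' ?_ ?_ fun k hk => ?_
  · rw [insertLabel_left]; omega
  · rw [insertLabel_right]; omega
  · rw [insertLabel_skip]
    have := h.le k hk
    unfold skip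
    split_ifs <;> omega

theorem insert (h : IsArcSystem M P L) (hs : 1 ≤ s) (hsM : s ≤ M + 1) (ha : a + s = 2 * M + 1) :
    IsArcSystem (M + 1) (insertPartner P a) (insertLabel L a s) := by
  have ha' : a ≤ 2 * M := by omega
  refine ⟨forall_of_forall_skip ha' ?_ ?_ fun k hk => ?_,
    forall_of_forall_skip ha' ?_ ?_ fun k hk => ?_,
    forall_of_forall_skip ha' ?_ ?_ fun k hk => ?_, h.insertPartner_noncrossing ha',
    forall_of_forall_skip ha' ?_ ?_ fun k hk => ?_,
    forall_of_forall_skip ha' ?_ ?_ fun k hk => ?_, h.insertLabel_le hsM ha ha',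
    forall_of_forall_skip ha' ?_ ?_ fun k hk => ?_, h.insertLabel_nested ha ha'⟩
  all_goals simp only [insertPartner_left, insertPartner_right, insertPartner_skip,
    insertLabel_left, insertLabel_right, insertLabel_skip, skip_mod_two, max_skip_mod_two]
  case refine_1 | refine_2 | refine_4 | refine_5 | refine_16 | refine_17 => omega
  · exact (skip_lt_iff ha').2 (h.lt k hk)
  · exact h.partner_parity k hk
  · rw [h.partner_partner k hk]
  · exact h.label_partner k hk
  · exact hs
  · exact hs
  · exact h.one_le k hk
  · exact h.label_parity k hk

end IsArcSystem

theorem surgeryPartner_insertPartner {P : ℕ → ℕ} {c : ℕ} (hP : Function.Involutive P)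
    (hc : P c ≠ c) :
    surgeryPartner (insertPartner P c) (c + 1) (c + 2) = insertPartner P (c + 1) := by
  funext k
  unfold surgeryPartner
  rw [insertPartner_right, insertPartner_add_two]
  rcases eq_or_eq_or_exists_eq_skip (c + 1) k with rfl | rfl | ⟨m, rfl⟩
  · rw [if_pos rfl, insertPartner_left]
  · rw [if_neg (Nat.succ_ne_self _), if_pos rfl, insertPartner_right]
  rw [if_neg (skip_ne _ _), if_neg (skip_ne_succ _ _), insertPartner_skip]
  by_cases hm : m = c
  · rw [hm, skip_succ_self, if_pos rfl, skip_succ_of_ne hc]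
  rw [skip_succ_of_ne hm, if_neg (skip_ne _ _), insertPartner_skip]
  by_cases hmc : m = P c
  · rw [if_pos (skip_inj.2 hmc), hmc, hP, skip_succ_self]
  · rw [if_neg (skip_inj.not.2 hmc), skip_succ_of_ne fun e => hmc (hP.eq_iff.1 e)]

theorem surgeryLabel_insertPartner {P L : ℕ → ℕ} {c s : ℕ} (hL : L (P c) = L c)
    (hle : L c ≤ s + 1) :
    surgeryLabel (insertPartner P c) (insertLabel L c (s + 1)) (c + 1) (c + 2) s =
      insertLabel L (c + 1) s := by
  funext k
  unfold surgeryLabel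
  rw [insertPartner_right, insertPartner_add_two, insertLabel_right, insertLabel_add_two,
    min_eq_right hle]
  rcases eq_or_eq_or_exists_eq_skip (c + 1) k with rfl | rfl | ⟨m, rfl⟩
  · rw [if_pos (Or.inl rfl), insertLabel_left]
  · rw [if_pos (Or.inr rfl), insertLabel_right]
  rw [if_neg (not_or.2 ⟨skip_ne _ _, skip_ne_succ _ _⟩), insertLabel_skip]
  by_cases hm : m = c
  · rw [hm, skip_succ_self, if_pos (Or.inl rfl)]
  rw [skip_succ_of_ne hm, insertLabel_skip]
  by_cases hmc : m = P c
  · rw [if_pos (Or.inr (skip_inj.2 hmc)), hmc, hL]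
  · rw [if_neg (not_or.2 ⟨skip_ne _ _, skip_inj.not.2 hmc⟩)]

theorem surgeryPartner_insertPartner_skip (P : ℕ → ℕ) (a b c : ℕ) :
    surgeryPartner (insertPartner P c) (skip c a) (skip c b) =
      insertPartner (surgeryPartner P a b) c := by
  funext k
  unfold surgeryPartner
  rw [insertPartner_skip, insertPartner_skip]
  rcases eq_or_eq_or_exists_eq_skip c k with rfl | rfl | ⟨m, rfl⟩
  · simp only [(skip_ne _ _).symm, if_false, insertPartner_left]
  · simp only [(skip_ne_succ _ _).symm, if_false, insertPartner_right]
  · simp only [insertPartner_skip, skip_inj, apply_ite (skip c)]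

theorem surgeryLabel_insertPartner_skip (P L : ℕ → ℕ) (a b c i s : ℕ) :
    surgeryLabel (insertPartner P c) (insertLabel L c s) (skip c a) (skip c b) i =
      insertLabel (surgeryLabel P L a b i) c s := by
  funext k
  unfold surgeryLabel
  rw [insertPartner_skip, insertPartner_skip, insertLabel_skip, insertLabel_skip]
  rcases eq_or_eq_or_exists_eq_skip c k with rfl | rfl | ⟨m, rfl⟩
  · simp only [(skip_ne _ _).symm, or_self, if_false, insertLabel_left]
  · simp only [(skip_ne_succ _ _).symm, or_self, if_false, insertLabel_right]
  · simp only [insertLabel_skip, skip_inj]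

namespace OkadaDiagram

variable {M : ℕ}

theorem partnerAt_involutive (D : OkadaDiagram M) : Function.Involutive D.partnerAt := fun k => by
  rcases lt_or_ge k (2 * M) with hk | hk
  · exact D.isArcSystem.partner_partner k hk
  · rw [D.partnerAt_of_le hk, D.partnerAt_of_le hk]

theorem ext_at {D E : OkadaDiagram M} (hp : D.partnerAt = E.partnerAt)
    (hl : D.labelAt = E.labelAt) : D = E :=
  ext_pos (fun k _ => congrFun hp k) fun k _ => congrFun hl k

/-- The insertion of an arc of label `s` joining the right nodes of levels `s` and `s + 1` (or
the two nodes of level `s = M + 1`). The other arcs keep their labels and relative positions. -/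
def insert (D : OkadaDiagram M) (s : ℕ) (hs : 1 ≤ s ∧ s ≤ M + 1) : OkadaDiagram (M + 1) :=
  (D.isArcSystem.insert hs.1 hs.2 (show 2 * M + 1 - s + s = 2 * M + 1 by omega)).toDiagram

theorem partnerAt_insert (D : OkadaDiagram M) {s a : ℕ} (hs : 1 ≤ s ∧ s ≤ M + 1)
    (ha : a + s = 2 * M + 1) : (D.insert s hs).partnerAt = insertPartner D.partnerAt a := by
  obtain rfl : a = 2 * M + 1 - s := by omega
  funext k
  rcases lt_or_ge k (2 * (M + 1)) with hk | hk
  · exact partnerAt_toDiagram _ hk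
  · obtain ⟨m, rfl⟩ := Nat.exists_eq_add_of_le' (show 2 ≤ k by omega)
    rw [partnerAt_of_le _ hk, ← skip_of_le (show 2 * M + 1 - s ≤ m by omega), insertPartner_skip,
      D.partnerAt_of_le (by omega)]

theorem labelAt_insert (D : OkadaDiagram M) {s a : ℕ} (hs : 1 ≤ s ∧ s ≤ M + 1)
    (ha : a + s = 2 * M + 1) : (D.insert s hs).labelAt = insertLabel D.labelAt a s := by
  obtain rfl : a = 2 * M + 1 - s := by omega
  funext k
  rcases lt_or_ge k (2 * (M + 1)) with hk | hk
  · exact labelAt_toDiagram _ hk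
  · obtain ⟨m, rfl⟩ := Nat.exists_eq_add_of_le' (show 2 ≤ k by omega)
    rw [labelAt_of_le _ hk, ← skip_of_le (show 2 * M + 1 - s ≤ m by omega), insertLabel_skip,
      D.labelAt_of_le (by omega)]

theorem label_insert_hiNode (D : OkadaDiagram M) {s : ℕ} (hs : 1 ≤ s ∧ s < M + 1) :
    (D.insert (s + 1) ⟨s.succ_pos, hs.2⟩).label (hiNode s hs) = s + 1 := by
  rw [← labelAt_pos, D.labelAt_insert _ (show 2 * M - s + (s + 1) = 2 * M + 1 by omega),
    pos_hiNode, show 2 * (M + 1) - 1 - s = 2 * M - s + 1 by omega, insertLabel_right]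

theorem mulElem_insert (D : OkadaDiagram M) {s : ℕ} (hs : 1 ≤ s ∧ s < M + 1) :
    (D.insert (s + 1) ⟨s.succ_pos, hs.2⟩).mulElem s hs = D.insert s ⟨hs.1, hs.2.le⟩ := by
  obtain ⟨c, hc⟩ : ∃ c, c + s = 2 * M := ⟨2 * M - s, by omega⟩
  have hcM : c < 2 * M := by omega
  have hle := (D.isArcSystem.le c hcM).2
  have hmul : c + 1 + s + 1 = 2 * (M + 1) := by omega
  apply ext_at
  · rw [partnerAt_mulElem _ hs hmul, D.partnerAt_insert _ (show c + (s + 1) = 2 * M + 1 by omega),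
      D.partnerAt_insert _ (show c + 1 + s = 2 * M + 1 by omega)]
    exact surgeryPartner_insertPartner D.partnerAt_involutive (D.isArcSystem.partner_ne hcM)
  · rw [labelAt_mulElem _ hs hmul, D.partnerAt_insert _ (show c + (s + 1) = 2 * M + 1 by omega),
      D.labelAt_insert _ (show c + (s + 1) = 2 * M + 1 by omega),
      D.labelAt_insert _ (show c + 1 + s = 2 * M + 1 by omega)]
    exact surgeryLabel_insertPartner (D.isArcSystem.label_partner c hcM) (by omega)

/-- The addition of a propagating arc of maximal label. -/
def extend (D : OkadaDiagram M) : OkadaDiagram (M + 1) := D.insert (M + 1) ⟨M.succ_pos, le_rfl⟩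

theorem partnerAt_extend (D : OkadaDiagram M) : D.extend.partnerAt = insertPartner D.partnerAt M :=
  D.partnerAt_insert _ (by omega)

theorem labelAt_extend (D : OkadaDiagram M) : D.extend.labelAt = insertLabel D.labelAt M (M + 1) :=
  D.labelAt_insert _ (by omega)

theorem partnerAt_id (N : ℕ) {k : ℕ} (hk : k < 2 * N) :
    (OkadaDiagram.id N).partnerAt k = 2 * N - 1 - k := by
  have hmirror : (Node.ofPos k hk).mirror.pos + (Node.ofPos k hk).pos + 1 = 2 * N := by
    have := Node.pos_mirror (Node.ofPos k hk)
    omega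
  rw [Node.pos_ofPos] at hmirror
  rw [partnerAt, dif_pos hk]
  change (Node.ofPos k hk).mirror.pos = _
  omega

theorem labelAt_id (N : ℕ) {k : ℕ} (hk : k < 2 * N) :
    (OkadaDiagram.id N).labelAt k = min (k + 1) (2 * N - k) := by
  rw [labelAt, dif_pos hk]
  change (Node.ofPos k hk).level = _
  rw [Node.level_eq, Node.pos_ofPos]

theorem extend_id : (OkadaDiagram.id M).extend = OkadaDiagram.id (M + 1) := by
  apply ext_pos <;> intro k hk <;>
    [rw [partnerAt_extend, partnerAt_id _ hk]; rw [labelAt_extend, labelAt_id _ hk]] <;>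
    revert k <;> refine forall_of_forall_skip (a := M) (by omega) ?_ ?_ fun k hk => ?_
  · rw [insertPartner_left]; omega
  · rw [insertPartner_right]; omega
  · rw [insertPartner_skip, partnerAt_id _ hk]; unfold skip; split_ifs <;> omega
  · rw [insertLabel_left]; omega
  · rw [insertLabel_right]; omega
  · rw [insertLabel_skip, labelAt_id _ hk]; unfold skip; split_ifs <;> omega

theorem mulElem_extend (D : OkadaDiagram M) {i : ℕ} (hi : 1 ≤ i ∧ i < M) :
    D.extend.mulElem i ⟨hi.1, hi.2.trans M.lt_succ_self⟩ = (D.mulElem i hi).extend := by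
  obtain ⟨a, ha⟩ : ∃ a, a + i + 1 = 2 * M := ⟨2 * M - 1 - i, by omega⟩
  have hmul : skip M a + i + 1 = 2 * (M + 1) := by rw [skip_of_le (by omega)]; omega
  have hsucc : skip M a + 1 = skip M (a + 1) := by
    rw [skip_of_le (by omega), skip_of_le (by omega)]
  apply ext_at
  · rw [partnerAt_mulElem _ _ hmul, partnerAt_extend, partnerAt_extend, D.partnerAt_mulElem hi ha,
      hsucc, surgeryPartner_insertPartner_skip]
  · rw [labelAt_mulElem _ _ hmul, partnerAt_extend, labelAt_extend, labelAt_extend,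
      D.labelAt_mulElem hi ha, hsucc, surgeryLabel_insertPartner_skip]

theorem label_extend_hiNode (D : OkadaDiagram M) {i : ℕ} (hi : 1 ≤ i ∧ i < M) :
    D.extend.label (hiNode i ⟨hi.1, hi.2.trans M.lt_succ_self⟩) = D.label (hiNode i hi) := by
  rw [← labelAt_pos, labelAt_extend, ← labelAt_pos, pos_hiNode, pos_hiNode,
    show 2 * (M + 1) - 1 - i = 2 * M - 1 - i + 2 by omega, ← skip_of_le (a := M) (by omega),
    insertLabel_skip]

end OkadaDiagram

/-! ### Every diagram is a reduced product of elementary diagrams -/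

namespace IsArcSystem

variable {M a : ℕ} {P L : ℕ → ℕ}

section Innermost

-- The position `a + 1` is the first one on the right such that its label is its level.

variable (h : IsArcSystem (M + 1) P L) (ha : a ≤ 2 * M)
  (hlast : L (a + 1) + a = 2 * M + 1)
  (hfirst : ∀ k, M + 1 ≤ k → k ≤ a → L k + k < 2 * (M + 1))
include h ha hlast hfirst

theorem label_add_le_of_innermost {k : ℕ} (hk : k < a) : L k + k ≤ 2 * M := by
  have hkM : k < 2 * (M + 1) := by omega
  by_contra hlarge
  have hle := h.le k hkM
  have hPlt := h.lt k hkM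
  have hPle := h.le _ hPlt
  have hpar := h.label_parity k hkM
  have hne := h.partner_ne hkM
  have hpp := h.partner_parity k hkM
  have hlabel := h.label_partner k hkM
  have hk' : M ≤ k := by omega
  have hfk := hfirst k
  have hPk : P k = k + 1 := by omega
  rw [hPk] at hlabel
  have := hfirst (k + 1)
  omega

variable (hM : M ≤ a)
include hM

theorem partner_eq_of_innermost : P (a + 1) = a := by
  have hlt : a + 1 < 2 * (M + 1) := by omega
  have hle := h.le _ (h.lt _ hlt)
  rw [h.label_partner _ hlt] at hle
  have hne := h.partner_ne hlt
  by_contra hPa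
  have hmem : a ∈ Set.uIoo (a + 1) (P (a + 1)) := by
    rw [mem_uIoo_iff]; omega
  have hnested := h.nested _ hlt a (by omega) hmem
  have hla := h.le a (by omega)
  have := hfirst a
  omega

theorem skip_unskip_partner_of_innermost {k : ℕ} (hk : k < 2 * M) :
    skip a (unskip a (P (skip a k))) = P (skip a k) := by
  have hPa := h.partner_eq_of_innermost ha hlast hfirst hM
  have hlt : skip a k < 2 * (M + 1) := (skip_lt_iff ha).2 hk
  refine skip_unskip (fun e => skip_ne_succ a k ?_) fun e => skip_ne a k ?_
  · rwa [← h.partner_inj hlt (by omega), hPa]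
  · rw [(h.partner_eq_iff hlt (by omega)).1 e, hPa]

theorem delete :
    IsArcSystem M (fun k => unskip a (P (skip a k))) (fun k => L (skip a k)) := by
  have hlt : ∀ k < 2 * M, skip a k < 2 * (M + 1) := fun k => (skip_lt_iff ha).2
  have hskip : ∀ k < 2 * M, skip a (unskip a (P (skip a k))) = P (skip a k) := fun k hk =>
    h.skip_unskip_partner_of_innermost ha hlast hfirst hM hk
  constructor <;> intro k hk
  case lt => exact (skip_lt_iff ha).1 (by rw [hskip k hk]; exact h.lt _ (hlt k hk))
  case partner_parity =>
    rw [← skip_mod_two a, hskip k hk, ← skip_mod_two a k]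
    exact h.partner_parity _ (hlt k hk)
  case partner_partner => rw [hskip k hk, h.partner_partner _ (hlt k hk), unskip_skip]
  case noncrossing =>
    intro v hv hmem
    rw [← skip_mem_uIoo (a := a), hskip k hk] at hmem ⊢
    rw [hskip v hv]
    exact h.noncrossing _ (hlt k hk) _ (hlt v hv) hmem
  case label_partner => rw [hskip k hk, h.label_partner _ (hlt k hk)]
  case one_le => exact h.one_le _ (hlt k hk)
  case le =>
    have hle := h.le _ (hlt k hk)
    have hsmall : k < a → L k + k ≤ 2 * M := h.label_add_le_of_innermost ha hlast hfirst
    unfold skip at hle ⊢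
    split_ifs at hle ⊢ <;> omega
  case label_parity => rw [← max_skip_mod_two a k, hskip k hk, h.label_parity _ (hlt k hk)]
  case nested =>
    intro v hv hmem
    rw [← skip_mem_uIoo (a := a), hskip k hk] at hmem
    exact h.nested _ (hlt k hk) _ (hlt v hv) hmem

end Innermost

end IsArcSystem

namespace OkadaDiagram

variable {M : ℕ}

theorem exists_innermost (E : OkadaDiagram (M + 1)) :
    ∃ a, M ≤ a ∧ a ≤ 2 * M ∧ E.labelAt (a + 1) + a = 2 * M + 1 ∧
      ∀ k, M + 1 ≤ k → k ≤ a → E.labelAt k + k < 2 * (M + 1) := by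
  have h := E.isArcSystem
  have hone := h.one_le (2 * M + 1) (by omega)
  have hend := h.le (2 * M + 1) (by omega)
  have hex : ∃ k, M + 1 ≤ k ∧ k < 2 * (M + 1) ∧ E.labelAt k + k = 2 * (M + 1) :=
    ⟨2 * M + 1, by omega, by omega, by omega⟩
  obtain ⟨hM, hlt, heq⟩ := Nat.find_spec hex
  obtain ⟨a, ha⟩ := Nat.exists_eq_add_of_le' (show 1 ≤ Nat.find hex by omega)
  rw [ha] at hM hlt heq
  refine ⟨a, by omega, by omega, by omega, fun k hMk hka => ?_⟩
  have hmin := Nat.find_min hex (show k < Nat.find hex by omega)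
  have hle := h.le k (by omega)
  omega

theorem exists_eq_insert (E : OkadaDiagram (M + 1)) :
    ∃ (D : OkadaDiagram M) (s : ℕ) (hs : 1 ≤ s ∧ s ≤ M + 1), E = D.insert s hs := by
  obtain ⟨a, hM, ha, hlast, hfirst⟩ := E.exists_innermost
  have h := E.isArcSystem
  have hPa := h.partner_eq_of_innermost ha hlast hfirst hM
  have hPa' : E.partnerAt a = a + 1 := ((h.partner_eq_iff (by omega) (by omega)).1 hPa).symm
  refine ⟨(h.delete ha hlast hfirst hM).toDiagram, E.labelAt (a + 1), ⟨by omega, by omega⟩,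
    ext_pos ?_ ?_⟩
  · rw [partnerAt_insert _ _ (show a + E.labelAt (a + 1) = 2 * M + 1 by omega)]
    refine forall_of_forall_skip ha ?_ ?_ fun k hk => ?_
    · rw [insertPartner_left, hPa']
    · rw [insertPartner_right, hPa]
    · rw [insertPartner_skip, partnerAt_toDiagram _ hk,
        h.skip_unskip_partner_of_innermost ha hlast hfirst hM hk]
  · rw [labelAt_insert _ _ (show a + E.labelAt (a + 1) = 2 * M + 1 by omega)]
    refine forall_of_forall_skip ha ?_ ?_ fun k hk => ?_
    · rw [insertLabel_left, ← hPa', h.label_partner a (by omega)]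
    · rw [insertLabel_right]
    · rw [insertLabel_skip, labelAt_toDiagram _ hk]

/-- `D` is the product of the elementary diagrams with indices in `w`, where no multiplication
produces a loop or a factor `y k`. -/
inductive Reduced (N : ℕ) : List ℕ → OkadaDiagram N → Prop
  | nil : Reduced N [] (OkadaDiagram.id N)
  | snoc (w : List ℕ) (D : OkadaDiagram N) (i : ℕ) (hi : 1 ≤ i ∧ i < N) :
      Reduced N w D → D.label (hiNode i hi) = i + 1 → Reduced N (w ++ [i]) (D.mulElem i hi)

theorem Reduced.extend {w : List ℕ} {D : OkadaDiagram M} (h : Reduced M w D) :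
    Reduced (M + 1) w D.extend := by
  induction h with
  | nil => rw [extend_id]; exact Reduced.nil
  | snoc w D i hi _ hlabel ih =>
    rw [← mulElem_extend]
    exact Reduced.snoc w _ i _ ih (by rw [label_extend_hiNode _ hi, hlabel])

theorem Reduced.insert {w : List ℕ} {D : OkadaDiagram M} (h : Reduced M w D) (c : ℕ) (hc : c ≤ M) :
    Reduced (M + 1) (w ++ (List.range c).map (fun k => M - k))
      (D.insert (M + 1 - c) ⟨by omega, by omega⟩) := by
  induction c with
  | zero => rw [List.range_zero, List.map_nil, List.append_nil]; exact h.extend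
  | succ c ih =>
    have hs : 1 ≤ M - c ∧ M - c < M + 1 := by omega
    have hred := ih (by omega)
    simp only [show M + 1 - c = M - c + 1 by omega] at hred
    simp only [show M + 1 - (c + 1) = M - c by omega]
    rw [← mulElem_insert D hs, List.range_succ, List.map_append, ← List.append_assoc]
    exact Reduced.snoc _ _ _ _ hred (label_insert_hiNode D hs)

theorem exists_reduced {N : ℕ} (D : OkadaDiagram N) : ∃ w, Reduced N w D := by
  induction N with
  | zero =>
    have : D = OkadaDiagram.id 0 := ext_pos (fun k hk => by omega) (fun k hk => by omega)
    exact ⟨[], this ▸ Reduced.nil⟩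
  | succ M ih =>
    obtain ⟨D', s, hs, rfl⟩ := D.exists_eq_insert
    obtain ⟨w, hw⟩ := ih D'
    have hred := hw.insert (M + 1 - s) (by omega)
    simp only [show M + 1 - (M + 1 - s) = s by omega] at hred
    exact ⟨_, hred⟩

end OkadaDiagram

/-! ### The product of the diagram algebra -/

section DiagramAlgebra

open OkadaDiagram

variable {K : Type*} [Field K] {N : ℕ}

namespace OkadaDiagram

section Propagating

variable {D : OkadaDiagram N} {i : ℕ} (hi : 1 ≤ i ∧ i < N) (h : D.label (hiNode i hi) = i + 1)
include h

theorem loopAt_of_label_hiNode (k : ℕ) : D.loopAt i hi k = 0 := by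
  refine if_neg fun hloop => ?_
  have := label_hiNode_parity_of_loop hi hloop.1
  omega

theorem elemExp_of_label_hiNode (k : ℕ) : elemExp hi D k = 0 := by
  refine if_neg fun hk => ?_
  have := label_loNode_le hi D
  unfold dropRow at hk
  split_ifs at hk <;> omega

end Propagating

theorem exists_isComposition (C D : OkadaDiagram N) :
    ∃ F M, IsComposition C D F ∧ IsYExp C D F M := by
  obtain ⟨w, hw⟩ := D.exists_reduced
  induction hw with
  | nil => exact ⟨C, _, isComposition_id C, isYExp_id C⟩
  | snoc _ D i hi _ hlabel ih =>
    obtain ⟨F, M, hF, hM⟩ := ih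
    refine ⟨F.mulElem i hi, fun k => M k + elemExp hi F k, hF.mulElem hi,
      hM.mulElem hi hF ?_ fun k => ?_⟩
    · rw [hM.1, elemExp_zero]
    · rw [elemExp_of_label_hiNode hi hlabel, add_zero]

end OkadaDiagram

variable (x y : ℕ → K)

/-- The monomial with the exponents `l k` of `x k` and `m k` of `y k`. -/
noncomputable def diagramCoeff (N : ℕ) (l m : ℕ → ℕ) : K :=
  (∏ k ∈ Finset.Icc 1 (N - 1), x k ^ l k) * ∏ k ∈ Finset.Icc 1 (N - 2), y k ^ m k

theorem diagramCoeff_mul (l m l' m' : ℕ → ℕ) :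
    diagramCoeff x y N l m * diagramCoeff x y N l' m' =
      diagramCoeff x y N (fun k => l k + l' k) fun k => m k + m' k := by
  simp only [diagramCoeff, pow_add, Finset.prod_mul_distrib]
  ring

theorem diagramCoeff_zero : diagramCoeff x y N (fun _ => 0) (fun _ => 0) = 1 := by
  simp [diagramCoeff]

theorem diagramCoeff_single_left {i : ℕ} (hi : 1 ≤ i ∧ i < N) :
    diagramCoeff x y N (fun k => if i = k then 1 else 0) (fun _ => 0) = x i := by
  simp only [diagramCoeff, pow_ite, pow_one, pow_zero, Finset.prod_ite_eq, Finset.prod_const_one,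
    mul_one]
  exact if_pos (Finset.mem_Icc.2 (by omega))

theorem diagramCoeff_single_right {i : ℕ} (hi : 1 ≤ i ∧ i + 1 < N) :
    diagramCoeff x y N (fun _ => 0) (fun k => if i = k then 1 else 0) = y i := by
  simp only [diagramCoeff, pow_ite, pow_one, pow_zero, Finset.prod_ite_eq, Finset.prod_const_one,
    one_mul]
  exact if_pos (Finset.mem_Icc.2 (by omega))

theorem diagramMul_eq {C D F : OkadaDiagram N} {M : ℕ → ℕ} (h : IsComposition C D F)
    (hM : IsYExp C D F M) :
    diagramMul x y C D = Finsupp.single F (diagramCoeff x y N (loopCount C D) M) := by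
  have hex : ∃ E, IsComposition C D E := ⟨F, h⟩
  rw [diagramMul, dif_pos hex, hex.choose_spec.unique h]
  simp only [hM.yCount_eq, diagramCoeff]

theorem diagramMul_id (C : OkadaDiagram N) :
    diagramMul x y C (OkadaDiagram.id N) = Finsupp.single C 1 := by
  rw [diagramMul_eq x y (isComposition_id C) (isYExp_id C), funext (loopCount_id C),
    diagramCoeff_zero]

theorem diagramMul_elem (C : OkadaDiagram N) {i : ℕ} (hi : 1 ≤ i ∧ i < N) :
    diagramMul x y C (elem i hi) = Finsupp.single (C.mulElem i hi)
      (diagramCoeff x y N (C.loopAt i hi) (elemExp hi C)) := by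
  rw [diagramMul_eq x y (isComposition_elem hi C) (isYExp_elem hi C),
    funext (loopCount_elem hi C)]

namespace OkArc

/-- The product `OkArc.mul` of the diagram algebra as a bilinear map. -/
noncomputable def mulHom : OkArc K N →ₗ[K] OkArc K N →ₗ[K] OkArc K N :=
  Finsupp.linearCombination K fun C => Finsupp.linearCombination K fun D => diagramMul x y C D

theorem mulHom_apply (v w : OkArc K N) : mulHom x y v w = OkArc.mul x y v w := by
  simp only [mulHom, OkArc.mul, Finsupp.linearCombination_apply, Finsupp.sum,
    LinearMap.sum_apply, LinearMap.smul_apply, Finset.smul_sum, smul_smul]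

theorem mulHom_single (C D : OkadaDiagram N) (a b : K) :
    mulHom x y (Finsupp.single C a) (Finsupp.single D b) = (a * b) • diagramMul x y C D := by
  simp only [mulHom, Finsupp.linearCombination_single, LinearMap.smul_apply, smul_smul]

theorem mulHom_id (v : OkArc K N) : mulHom x y v (Finsupp.single (OkadaDiagram.id N) 1) = v := by
  suffices h : (mulHom x y).flip (Finsupp.single (OkadaDiagram.id N) 1) = LinearMap.id from
    LinearMap.congr_fun h v
  refine Finsupp.lhom_ext fun C a => ?_
  rw [LinearMap.flip_apply, mulHom_single, diagramMul_id, mul_one, Finsupp.smul_single,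
    smul_eq_mul, mul_one, LinearMap.id_apply]

/-- The multiplication by `G i` on the right. -/
noncomputable def mulElem (i : ℕ) (hi : 1 ≤ i ∧ i < N) : Module.End K (OkArc K N) :=
  (mulHom x y).flip (Finsupp.single (elem i hi) 1)

variable {i : ℕ} (hi : 1 ≤ i ∧ i < N)

theorem mulElem_apply (v : OkArc K N) :
    mulElem x y i hi v = mulHom x y v (Finsupp.single (elem i hi) 1) := rfl

theorem mulElem_single (D : OkadaDiagram N) (a : K) :
    mulElem x y i hi (Finsupp.single D a) = Finsupp.single (D.mulElem i hi)
      (a * diagramCoeff x y N (D.loopAt i hi) (elemExp hi D)) := by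
  rw [mulElem_apply, mulHom_single, diagramMul_elem, mul_one, Finsupp.smul_single, smul_eq_mul]

theorem mulElem_single_of_label_hiNode {D : OkadaDiagram N} (h : D.label (hiNode i hi) = i + 1)
    (a : K) : mulElem x y i hi (Finsupp.single D a) = Finsupp.single (D.mulElem i hi) a := by
  rw [mulElem_single, funext (loopAt_of_label_hiNode hi h), funext (elemExp_of_label_hiNode hi h),
    diagramCoeff_zero, mul_one]

theorem mulElem_mulHom (v w : OkArc K N) :
    mulElem x y i hi (mulHom x y v w) = mulHom x y v (mulElem x y i hi w) := by
  suffices h : (mulHom x y).compr₂ (mulElem x y i hi) = (mulHom x y).compl₂ (mulElem x y i hi) from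
    LinearMap.congr_fun (LinearMap.congr_fun h v) w
  refine Finsupp.lhom_ext fun C a => Finsupp.lhom_ext fun D b => ?_
  obtain ⟨F, M, hF, hM⟩ := exists_isComposition C D
  obtain ⟨F', M', hF', hM'⟩ := exists_isComposition C (D.mulElem i hi)
  obtain rfl := hF'.unique (hF.mulElem hi)
  have hx : (fun k => loopCount C D k + F.loopAt i hi k) =
      fun k => D.loopAt i hi k + loopCount C (D.mulElem i hi) k := funext fun k => by
    rw [← loopCount_mulElem hi hF k, add_comm]
  have hy : (fun k => M k + elemExp hi F k) = fun k => elemExp hi D k + M' k := funext fun k => by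
    rw [← elemExp_add hi hF hM hM' k, add_comm]
  rw [LinearMap.compr₂_apply, LinearMap.compl₂_apply, mulHom_single, mulElem_single,
    mulHom_single, map_smul, diagramMul_eq x y hF hM, diagramMul_eq x y hF' hM', mulElem_single,
    Finsupp.smul_single, Finsupp.smul_single, smul_eq_mul, smul_eq_mul, mul_assoc a, mul_assoc a,
    mul_assoc b, diagramCoeff_mul, diagramCoeff_mul, hx, hy]

end OkArc

end DiagramAlgebra

/-! ### The homomorphism from the Okada algebra -/

namespace OkadaDiagram

variable {N i : ℕ}

theorem mulElem_eq_self {D : OkadaDiagram N} {hi : 1 ≤ i ∧ i < N}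
    (hp : D.partner (hiNode i hi) = loNode i hi) (hl : D.label (hiNode i hi) = i) :
    D.mulElem i hi = D := by
  have hl' : D.label (loNode i hi) = i := by rw [← hp, D.label_partner, hl]
  refine OkadaDiagram.ext (mulElem_partner_of_loop hp) (funext fun u => ?_)
  by_cases hu : u = hiNode i hi ∨ u = loNode i hi
  · rw [mulElem_label_of_mem_cap D hu]
    rcases hu with rfl | rfl <;> simp only [hl, hl']
  · rw [mulElem_label, if_neg hu, if_neg]
    rwa [D.partner_eq_comm.1 hp, hp, or_comm]

section Contract

variable {D : OkadaDiagram N} {hi : 1 ≤ i ∧ i < N} {hj : 1 ≤ i + 1 ∧ i + 1 < N}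

theorem hiNode_succ_ne_loNode : hiNode (i + 1) hj ≠ loNode i hi := by
  simp only [hiNode, loNode, ne_eq, Sum.inr.injEq, Fin.mk.injEq]
  omega

theorem mulElem_partner_hiNode_succ_ne :
    (D.mulElem i hi).partner (hiNode (i + 1) hj) ≠ loNode (i + 1) hj := fun hloop =>
  hiNode_succ_ne_loNode (((D.mulElem i hi).partner_eq_comm.1 hloop).symm.trans
    (D.mulElem_partner_hiNode hi))

variable (hp : D.partner (hiNode (i + 1) hj) = loNode (i + 1) hj)
include hp

theorem mulElem_partner_hiNode_succ :
    (D.mulElem i hi).partner (hiNode (i + 1) hj) = D.partner (loNode i hi) := by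
  have hp' : D.partner (hiNode i hi) = hiNode (i + 1) hj := D.partner_eq_comm.1 hp
  rw [← hp', mulElem_partner_partner_hiNode (hp' ▸ hiNode_succ_ne_loNode)]

theorem mulElem_label_hiNode_succ (hl : D.label (hiNode (i + 1) hj) = i + 1) :
    (D.mulElem i hi).label (hiNode (i + 1) hj) = D.label (loNode i hi) := by
  have hp' : D.partner (hiNode i hi) = hiNode (i + 1) hj := D.partner_eq_comm.1 hp
  have hl' : D.label (hiNode i hi) = i + 1 := by rw [← hl, ← hp', D.label_partner]
  have hle := label_loNode_le hi D
  rw [← hp', mulElem_label_partner_hiNode (hp' ▸ hiNode_succ_ne_loNode), hl',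
    min_eq_right (by omega)]

theorem mulElem_mulElem_succ (hl : D.label (hiNode (i + 1) hj) = i + 1) :
    (D.mulElem i hi).mulElem (i + 1) hj = D := by
  have hp' : D.partner (loNode (i + 1) hj) = hiNode (i + 1) hj := D.partner_eq_comm.1 hp
  have hl' : D.label (loNode (i + 1) hj) = i + 1 := by rw [← hp, D.label_partner, hl]
  have hpA := mulElem_partner_hiNode_succ (hi := hi) hp
  have hlA := mulElem_label_hiNode_succ (hi := hi) hp hl
  have hpB : (D.mulElem i hi).partner (loNode (i + 1) hj) = loNode i hi :=
    D.mulElem_partner_hiNode hi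
  have hlB : (D.mulElem i hi).label (loNode (i + 1) hj) = i :=
    D.mulElem_label_of_mem_cap (Or.inl rfl)
  have hle := label_loNode_le hi D
  have hB : hiNode i hi = loNode (i + 1) hj := rfl
  refine OkadaDiagram.ext (funext fun u => ?_) (funext fun u => ?_)
  · rw [mulElem_partner, hpA, hpB, mulElem_partner, hB, hp']
    grind [D.partner_partner]
  · rw [mulElem_label, hlA, hlB, hpA, hpB, mulElem_label, hB, hl', hp']
    grind [D.label_partner]

end Contract

section Elem

variable (hi : 1 ≤ i ∧ i < N)

theorem elem_partner_hiNode : (elem i hi).partner (hiNode i hi) = loNode i hi := by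
  rw [← id_mulElem, mulElem_partner_hiNode]

theorem elem_label_hiNode : (elem i hi).label (hiNode i hi) = i := by
  rw [← id_mulElem, mulElem_label_of_mem_cap _ (Or.inl rfl)]

theorem elem_partner_of_ne {k : ℕ} (hk : k < N) (h : ¬ (k + 1 = i ∨ k = i)) :
    (elem i hi).partner (Sum.inr ⟨k, hk⟩) = Sum.inl ⟨k, hk⟩ :=
  if_neg h

theorem elem_label_of_ne {k : ℕ} (hk : k < N) (h : k ≠ i) :
    (elem i hi).label (Sum.inr ⟨k, hk⟩) = k + 1 :=
  if_neg h

end Elem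

theorem elem_mulElem_comm {j : ℕ} (hi : 1 ≤ i ∧ i < N) (hj : 1 ≤ j ∧ j < N)
    (h : i + 2 ≤ j) : (elem i hi).mulElem j hj = (elem j hj).mulElem i hi := by
  apply OkadaDiagram.ext <;> funext u
  · rw [mulElem_partner, mulElem_partner, hiNode, loNode, hiNode, loNode,
      elem_partner_of_ne hi hj.2 (by omega), elem_partner_of_ne hi _ (by omega),
      elem_partner_of_ne hj hi.2 (by omega), elem_partner_of_ne hj _ (by omega)]
    rcases u with ⟨u, hu⟩ | ⟨u, hu⟩ <;>
      simp only [elem, elemPartner, elemSwap, reduceCtorEq, if_false, Sum.inl.injEq,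
        Sum.inr.injEq, Fin.mk.injEq] <;>
      split_ifs <;> first | rfl | (exfalso; omega)
  · rw [mulElem_label, mulElem_label, hiNode, loNode, hiNode, loNode,
      elem_partner_of_ne hi hj.2 (by omega), elem_partner_of_ne hi _ (by omega),
      elem_partner_of_ne hj hi.2 (by omega), elem_partner_of_ne hj _ (by omega),
      elem_label_of_ne hi hj.2 (by omega), elem_label_of_ne hi _ (by omega),
      elem_label_of_ne hj hi.2 (by omega), elem_label_of_ne hj _ (by omega)]
    rcases u with ⟨u, hu⟩ | ⟨u, hu⟩ <;>
      simp only [elem, elemLabel, reduceCtorEq, or_self, if_false, Sum.inl.injEq,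
        Sum.inr.injEq, Fin.mk.injEq] <;>
      split_ifs <;> omega

end OkadaDiagram

section Theta

open OkadaDiagram

variable {K : Type*} [Field K] {N : ℕ} (x y : ℕ → K)

namespace OkArc

variable {i : ℕ} (hi : 1 ≤ i ∧ i < N)

theorem mulElem_sq (v : OkArc K N) :
    mulElem x y i hi (mulElem x y i hi v) = x i • mulElem x y i hi v := by
  have hloop : (elem i hi).loopAt i hi = fun k => if i = k then 1 else 0 := by
    funext k
    simp only [loopAt, elem_partner_hiNode, elem_label_hiNode, true_and]
  have hexp : elemExp hi (elem i hi) = fun _ => 0 := by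
    funext k
    rw [elemExp, dropRow, if_pos (elem_partner_hiNode hi), elem_label_hiNode, if_neg (by omega)]
  rw [mulElem_apply x y hi v, mulElem_mulHom, mulElem_single, hloop, hexp,
    diagramCoeff_single_left x y hi,
    mulElem_eq_self (elem_partner_hiNode hi) (elem_label_hiNode hi), one_mul, ← map_smul,
    Finsupp.smul_single, smul_eq_mul, mul_one]

theorem mulElem_comm {j : ℕ} (hj : 1 ≤ j ∧ j < N) (h : i + 2 ≤ j) (v : OkArc K N) :
    mulElem x y i hi (mulElem x y j hj v) = mulElem x y j hj (mulElem x y i hi v) := by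
  rw [mulElem_apply x y hj v, mulElem_mulHom, mulElem_apply x y hi v, mulElem_mulHom,
    mulElem_single_of_label_hiNode x y hi (elem_label_of_ne hj _ (by omega)),
    mulElem_single_of_label_hiNode x y hj (elem_label_of_ne hi _ (by omega)),
    elem_mulElem_comm hi hj h]

theorem mulElem_contract (hj : 1 ≤ i + 1 ∧ i + 1 < N) (v : OkArc K N) :
    mulElem x y (i + 1) hj (mulElem x y i hi (mulElem x y (i + 1) hj v)) =
      y i • mulElem x y (i + 1) hj v := by
  have hp := elem_partner_hiNode hj
  have hl := elem_label_hiNode hj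
  have hloop : ((elem (i + 1) hj).mulElem i hi).loopAt (i + 1) hj = fun _ => 0 :=
    funext fun k => if_neg fun h => mulElem_partner_hiNode_succ_ne h.1
  have hdrop : dropRow hj ((elem (i + 1) hj).mulElem i hi) = i := by
    have hlo : ((elem (i + 1) hj).mulElem i hi).label (loNode (i + 1) hj) = i :=
      mulElem_label_of_mem_cap (hi := hi) _ (Or.inl rfl)
    rw [dropRow, if_neg mulElem_partner_hiNode_succ_ne, mulElem_label_hiNode_succ hp hl, hlo,
      max_eq_right (label_loNode_le hi _)]
  have hexp : elemExp hj ((elem (i + 1) hj).mulElem i hi) = fun k => if i = k then 1 else 0 := by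
    funext k
    rw [elemExp, hdrop]
    split_ifs <;> omega
  rw [mulElem_apply x y hj v, mulElem_mulHom, mulElem_mulHom,
    mulElem_single_of_label_hiNode x y hi (elem_label_of_ne hj _ (by omega)), mulElem_single,
    hloop, hexp, diagramCoeff_single_right x y ⟨hi.1, hj.2⟩, mulElem_mulElem_succ hp hl, one_mul,
    ← map_smul, Finsupp.smul_single, smul_eq_mul, mul_one]

end OkArc

namespace OkadaAlgebra

/-- The right action of the free algebra on the diagram algebra in which the `i`-th generator
multiplies by `G i`. -/
noncomputable def freeAction : FreeAlgebra K (GenIdx N) →ₐ[K] (Module.End K (OkArc K N))ᵐᵒᵖ :=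
  FreeAlgebra.lift K fun i => MulOpposite.op (OkArc.mulElem x y i.1 i.2)

theorem freeAction_eq_of_okadaRel {a b : FreeAlgebra K (GenIdx N)} (h : OkadaRel N x y a b) :
    freeAction x y a = freeAction x y b := by
  refine MulOpposite.unop_injective (LinearMap.ext fun v => ?_)
  cases h with
  | sq i =>
    simp only [freeAction, map_mul, map_smul, FreeAlgebra.lift_ι_apply]
    exact OkArc.mulElem_sq x y i.2 v
  | comm i j h =>
    simp only [freeAction, map_mul, FreeAlgebra.lift_ι_apply]
    rcases h with h | h
    · exact (OkArc.mulElem_comm x y i.2 j.2 h v).symm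
    · exact OkArc.mulElem_comm x y j.2 i.2 h v
  | contract i j h =>
    obtain ⟨j, hj⟩ := j
    obtain rfl : j = i.1 + 1 := h
    simp only [freeAction, map_mul, map_smul, FreeAlgebra.lift_ι_apply]
    exact OkArc.mulElem_contract x y i.2 hj v

/-- The right action of the Okada algebra on the diagram algebra. -/
noncomputable def action : OkadaAlgebra N x y →ₐ[K] (Module.End K (OkArc K N))ᵐᵒᵖ :=
  RingQuot.liftAlgHom K ⟨freeAction x y, fun _ _ => freeAction_eq_of_okadaRel x y⟩

theorem action_gen {i : ℕ} (hi : 1 ≤ i ∧ i < N) :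
    action x y (gen N x y i) = MulOpposite.op (OkArc.mulElem x y i hi) := by
  rw [gen, dif_pos hi, action, RingQuot.liftAlgHom_mkAlgHom_apply, freeAction,
    FreeAlgebra.lift_ι_apply]

variable {x y} in
theorem induction {P : OkadaAlgebra N x y → Prop} (algebraMap : ∀ r : K, P (algebraMap K _ r))
    (gen : ∀ i, 1 ≤ i ∧ i < N → P (gen N x y i)) (mul : ∀ a b, P a → P b → P (a * b))
    (add : ∀ a b, P a → P b → P (a + b)) (a : OkadaAlgebra N x y) : P a := by
  obtain ⟨b, rfl⟩ := RingQuot.mkAlgHom_surjective K (OkadaRel N x y) a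
  induction b using FreeAlgebra.induction with
  | grade0 r => rw [AlgHom.commutes]; exact algebraMap r
  | grade1 i =>
    have := gen i.1 i.2
    rwa [OkadaAlgebra.gen, dif_pos i.2] at this
  | mul a b ha hb => rw [map_mul]; exact mul _ _ ha hb
  | add a b ha hb => rw [map_add]; exact add _ _ ha hb

/-- Associativity of `v · w · a`. This replaces the associativity of the diagram algebra. -/
theorem action_mulHom (a : OkadaAlgebra N x y) (v w : OkArc K N) :
    (action x y a).unop (OkArc.mulHom x y v w) = OkArc.mulHom x y v ((action x y a).unop w) := by
  induction a using OkadaAlgebra.induction generalizing w with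
  | algebraMap r =>
    rw [AlgHom.commutes, MulOpposite.algebraMap_apply, MulOpposite.unop_op,
      Module.algebraMap_end_apply, Module.algebraMap_end_apply, map_smul]
  | gen i hi => rw [action_gen x y hi, MulOpposite.unop_op, OkArc.mulElem_mulHom]
  | mul a b ha hb =>
    rw [map_mul, MulOpposite.unop_mul, Module.End.mul_apply, Module.End.mul_apply, ha, hb]
  | add a b ha hb =>
    rw [map_add, MulOpposite.unop_add, LinearMap.add_apply, LinearMap.add_apply, ha, hb, map_add]

/-- The homomorphism `Θ`: the action of the Okada algebra on the identity diagram. -/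
noncomputable def theta : OkadaAlgebra N x y →ₗ[K] OkArc K N :=
  LinearMap.applyₗ (Finsupp.single (OkadaDiagram.id N) (1 : K)) ∘ₗ
    (MulOpposite.opLinearEquiv K).symm.toLinearMap ∘ₗ (action x y).toLinearMap

theorem theta_apply (a : OkadaAlgebra N x y) :
    theta x y a = (action x y a).unop (Finsupp.single (OkadaDiagram.id N) 1) := rfl

theorem isTheta_theta : IsTheta x y (theta (N := N) x y) := by
  refine ⟨?_, fun a b => ?_, fun i hi => ?_⟩
  · rw [theta_apply, map_one, MulOpposite.unop_one, Module.End.one_apply]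
  · rw [← OkArc.mulHom_apply, theta_apply x y b, ← action_mulHom, OkArc.mulHom_id, theta_apply,
      theta_apply, map_mul, MulOpposite.unop_mul, Module.End.mul_apply]
  · rw [theta_apply, action_gen x y hi, MulOpposite.unop_op,
      OkArc.mulElem_single_of_label_hiNode x y hi rfl, id_mulElem]

end OkadaAlgebra

variable {x y}

theorem IsTheta.unique {Θ Θ' : OkadaAlgebra N x y →ₗ[K] OkArc K N} (h : IsTheta x y Θ)
    (h' : IsTheta x y Θ') : Θ = Θ' := by
  refine LinearMap.ext fun a => ?_
  induction a using OkadaAlgebra.induction with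
  | algebraMap r => rw [Algebra.algebraMap_eq_smul_one, map_smul, map_smul, h.1, h'.1]
  | gen i hi => rw [h.2.2 i hi, h'.2.2 i hi]
  | mul a b ha hb => rw [h.2.1, h'.2.1, ha, hb]
  | add a b ha hb => rw [map_add, map_add, ha, hb]

theorem existsUnique_isTheta : ∃! Θ : OkadaAlgebra N x y →ₗ[K] OkArc K N, IsTheta x y Θ :=
  ⟨_, OkadaAlgebra.isTheta_theta x y, fun _ h => h.unique (OkadaAlgebra.isTheta_theta x y)⟩

theorem IsTheta.map_reduced {Θ : OkadaAlgebra N x y →ₗ[K] OkArc K N} (h : IsTheta x y Θ)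
    {w : List ℕ} {D : OkadaDiagram N} (hw : Reduced N w D) :
    Θ (w.map (OkadaAlgebra.gen N x y)).prod = Finsupp.single D 1 := by
  induction hw with
  | nil => exact h.1
  | snoc w D i hi _ hlabel ih =>
    rw [List.map_append, List.prod_append, h.2.1, ih, List.map_singleton, List.prod_singleton,
      h.2.2 i hi, ← OkArc.mulHom_apply, ← OkArc.mulElem_apply,
      OkArc.mulElem_single_of_label_hiNode x y hi hlabel]

end Theta

/-! ### A half diagram is determined by its chain -/

namespace HalfDiagram

variable {N : ℕ}

theorem val_restrict_partner (H : HalfDiagram N) {r : ℕ} (hr : r ≤ N) (a : Fin r) :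
    ((H.restrict r hr).partner a).val =
      if (H.partner (a.castLE hr)).val < r then (H.partner (a.castLE hr)).val else a.val := by
  simp only [restrict]
  split_ifs <;> rfl

theorem restrict_self (H : HalfDiagram N) : H.restrict N le_rfl = H := by
  refine HalfDiagram.ext (funext fun a => ?_) rfl
  exact dif_pos (H.partner a).isLt

theorem restrict_restrict (H : HalfDiagram N) {r s : ℕ} (hs : s ≤ N) (hr : r ≤ s) :
    (H.restrict s hs).restrict r hr = H.restrict r (hr.trans hs) := by
  refine HalfDiagram.ext (funext fun a => Fin.ext ?_) rfl
  have ha := a.isLt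
  simp only [val_restrict_partner, Fin.castLE_castLE, Fin.val_castLE]
  split_ifs <;> omega

theorem HasChain.restrict {H : HalfDiagram N} {C : ℕ → FibSet} (h : H.HasChain C) {s : ℕ}
    (hs : s ≤ N) : (H.restrict s hs).HasChain C := fun r hr => by
  rw [restrict_restrict]
  exact h r (hr.trans hs)

theorem mem_propLabels {H : HalfDiagram N} {h : ℕ} :
    h ∈ H.propLabels ↔ ∃ a, H.partner a = a ∧ H.label a = h := by
  simp only [propLabels, Finset.mem_image, Finset.mem_filter, Finset.mem_univ, true_and]

theorem mem_propLabels_restrict (H : HalfDiagram N) {r : ℕ} (hr : r ≤ N) {h : ℕ} :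
    h ∈ (H.restrict r hr).propLabels ↔
      ∃ a : Fin N, a.val < r ∧ (H.partner a = a ∨ r ≤ (H.partner a).val) ∧ H.label a = h := by
  have hfix (a : Fin r) : (H.restrict r hr).partner a = a ↔
      H.partner (a.castLE hr) = a.castLE hr ∨ r ≤ (H.partner (a.castLE hr)).val := by
    rw [Fin.ext_iff, val_restrict_partner, Fin.ext_iff, Fin.val_castLE]
    split_ifs <;> omega
  simp only [mem_propLabels, hfix]
  exact ⟨fun ⟨a, ha, hl⟩ => ⟨a.castLE hr, a.isLt, ha, hl⟩,
    fun ⟨a, har, ha, hl⟩ => ⟨⟨a.val, har⟩, ha, hl⟩⟩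

theorem eq_of_label_eq {H : HalfDiagram N} {a c : Fin N} (ha : H.partner a = a)
    (hc : H.partner c = c) (h : H.label a = H.label c) : a = c := by
  rcases lt_trichotomy a c with hac | hac | hca
  · exact absurd h (H.label_half c a ha hac).ne
  · exact hac
  · exact absurd h (H.label_half a c hc hca).ne'

section Last

variable {H H' : HalfDiagram (N + 1)}

theorem partner_castSucc (a : Fin N) :
    H.partner a.castSucc = if H.partner (Fin.last N) = a.castSucc then Fin.last N
      else ((H.restrict N N.le_succ).partner a).castSucc := by
  split_ifs with hlast
  · rw [← hlast, H.partner_partner]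
  · have hne : H.partner a.castSucc ≠ Fin.last N := fun h =>
      hlast (by rw [← h, H.partner_partner])
    exact Fin.ext ((H.val_restrict_partner _ a).trans (if_pos (Fin.val_lt_last hne))).symm

theorem ext_last (hR : H.restrict N N.le_succ = H'.restrict N N.le_succ)
    (hp : H.partner (Fin.last N) = H'.partner (Fin.last N))
    (hl : H.label (Fin.last N) = H'.label (Fin.last N)) : H = H' := by
  refine HalfDiagram.ext (funext fun a => ?_) (funext fun a => ?_) <;>
    induction a using Fin.lastCases with
    | last => assumption
    | cast a => ?_
  · rw [partner_castSucc, partner_castSucc, hR, hp]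
  · exact congrFun (congrArg label hR) a

theorem label_last_notMem_propLabels (hlast : H.partner (Fin.last N) = Fin.last N) :
    H.label (Fin.last N) ∉ (H.restrict N N.le_succ).propLabels := by
  rw [mem_propLabels]
  rintro ⟨a, ha, hl⟩
  have hac : H.partner a.castSucc = a.castSucc := by
    rw [partner_castSucc, if_neg (by rw [hlast]; exact a.castSucc_lt_last.ne'), ha]
  exact a.castSucc_lt_last.ne (eq_of_label_eq hac hlast hl)

theorem propLabels_of_half (hlast : H.partner (Fin.last N) = Fin.last N) :
    H.propLabels = insert (H.label (Fin.last N)) (H.restrict N N.le_succ).propLabels := by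
  ext h
  have hne (a : Fin N) : Fin.last N ≠ a.castSucc := a.castSucc_lt_last.ne'
  simp only [mem_propLabels, Finset.mem_insert, Fin.exists_fin_succ', partner_castSucc, hlast,
    hne, if_false, Fin.castSucc_inj, true_and]
  rw [or_comm, eq_comm]
  rfl

variable {c : Fin N}

theorem restrict_partner_of_partner_last (hc : H.partner (Fin.last N) = c.castSucc) :
    (H.restrict N N.le_succ).partner c = c := by
  refine Fin.ext ((H.val_restrict_partner _ c).trans (if_neg ?_))
  change ¬ (H.partner c.castSucc).val < N
  rw [← hc, H.partner_partner, Fin.val_last]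
  exact lt_irrefl N

theorem restrict_partner_of_half {a : Fin N} (ha : H.partner a.castSucc = a.castSucc) :
    (H.restrict N N.le_succ).partner a = a := by
  have hval : H.partner (a.castLE N.le_succ) = a.castSucc := ha
  refine Fin.ext ((H.val_restrict_partner _ a).trans ?_)
  rw [hval, Fin.val_castSucc, ite_self]

theorem label_notMem_propLabels (hc : H.partner (Fin.last N) = c.castSucc) :
    (H.restrict N N.le_succ).label c ∉ H.propLabels := by
  rw [mem_propLabels]
  rintro ⟨b, hb, hl⟩
  induction b using Fin.lastCases with
  | last => exact c.castSucc_lt_last.ne (hc.symm.trans hb)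
  | cast a =>
    obtain rfl : a = c := eq_of_label_eq (restrict_partner_of_half hb)
      (restrict_partner_of_partner_last hc) hl
    rw [← hc, H.partner_partner] at hb
    exact a.castSucc_lt_last.ne' (hb.trans hc)

theorem insert_propLabels_of_partner_last (hc : H.partner (Fin.last N) = c.castSucc) :
    insert ((H.restrict N N.le_succ).label c) H.propLabels =
      (H.restrict N N.le_succ).propLabels := by
  ext h
  simp only [Finset.mem_insert, mem_propLabels]
  constructor
  · rintro (rfl | ⟨b, hb, hl⟩)
    · exact ⟨c, restrict_partner_of_partner_last hc, rfl⟩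
    · induction b using Fin.lastCases with
      | last => exact absurd (hc.symm.trans hb) c.castSucc_lt_last.ne
      | cast a => exact ⟨a, restrict_partner_of_half hb, hl⟩
  · rintro ⟨a, ha, rfl⟩
    by_cases hac : c = a
    · exact Or.inl (congrArg _ hac.symm)
    · refine Or.inr ⟨a.castSucc, ?_, rfl⟩
      rw [partner_castSucc, hc, if_neg (fun h => hac (Fin.castSucc_inj.1 h)), ha]

theorem card_propLabels_of_half (hlast : H.partner (Fin.last N) = Fin.last N) :
    H.propLabels.card = (H.restrict N N.le_succ).propLabels.card + 1 := by
  rw [propLabels_of_half hlast, Finset.card_insert_of_notMem (label_last_notMem_propLabels hlast)]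

theorem card_propLabels_of_partner_last (hc : H.partner (Fin.last N) = c.castSucc) :
    H.propLabels.card + 1 = (H.restrict N N.le_succ).propLabels.card := by
  rw [← insert_propLabels_of_partner_last hc,
    Finset.card_insert_of_notMem (label_notMem_propLabels hc)]

theorem label_last_of_partner_last (hc : H.partner (Fin.last N) = c.castSucc) :
    H.label (Fin.last N) = (H.restrict N N.le_succ).label c := by
  rw [← H.label_partner, hc]
  rfl

-- A half arc at the last node adds its label to the half arc labels of the `N`-restriction, and a
-- full arc removes its label from them: so the half arc labels tell the arc at the last node.
theorem eq_of_restrict_eq (hR : H.restrict N N.le_succ = H'.restrict N N.le_succ)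
    (hl : H.propLabels = H'.propLabels) : H = H' := by
  rcases Fin.eq_castSucc_or_eq_last (H.partner (Fin.last N)) with ⟨c, hc⟩ | hc <;>
    rcases Fin.eq_castSucc_or_eq_last (H'.partner (Fin.last N)) with ⟨c', hc'⟩ | hc'
  · have hlabel : (H.restrict N N.le_succ).label c = (H.restrict N N.le_succ).label c' := by
      have hins := (insert_propLabels_of_partner_last hc).trans
        (hR ▸ (insert_propLabels_of_partner_last hc').symm)
      rw [← hl] at hins
      exact (Finset.insert_inj (label_notMem_propLabels hc)).1 hins
    obtain rfl : c = c' := eq_of_label_eq (restrict_partner_of_partner_last hc)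
      (hR ▸ restrict_partner_of_partner_last hc') hlabel
    refine ext_last hR (hc.trans hc'.symm) ?_
    rw [label_last_of_partner_last hc, label_last_of_partner_last hc', hR]
  · have := card_propLabels_of_partner_last hc
    have := card_propLabels_of_half hc'
    rw [← hR, ← hl] at this
    omega
  · have := card_propLabels_of_half hc
    have := card_propLabels_of_partner_last hc'
    rw [← hR, ← hl] at this
    omega
  · refine ext_last hR (hc.trans hc'.symm) ?_
    have hins := (propLabels_of_half hc).symm.trans (hl.trans (propLabels_of_half hc'))
    rw [← hR] at hins
    exact (Finset.insert_inj (label_last_notMem_propLabels hc)).1 hins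

end Last

theorem HasChain.propLabels_eq {H : HalfDiagram N} {C : ℕ → FibSet} (h : H.HasChain C) :
    H.propLabels = (C N).carrier := by
  rw [(h N le_rfl).2, restrict_self]

theorem HasChain.unique {H H' : HalfDiagram N} {C : ℕ → FibSet} (h : H.HasChain C)
    (h' : H'.HasChain C) : H = H' := by
  induction N with
  | zero => exact HalfDiagram.ext (funext fun a => a.elim0) (funext fun a => a.elim0)
  | succ N ih =>
    exact eq_of_restrict_eq (ih (h.restrict _) (h'.restrict _))
      (h.propLabels_eq.trans h'.propLabels_eq.symm)

end HalfDiagram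

/-! ### A diagram is determined by its halves -/

section Gluing

variable {N : ℕ} {D E : OkadaDiagram N}

theorem OkadaDiagram.mirror_mirror (D : OkadaDiagram N) : D.mirror.mirror = D := by
  apply OkadaDiagram.ext <;> funext u <;> simp [OkadaDiagram.mirror, Node.mirror_mirror]

theorem OkadaDiagram.ket_mirror (D : OkadaDiagram N) : D.mirror.ket = D.bra := by
  rw [OkadaDiagram.ket, D.mirror_mirror]

theorem leftPartner_eq_of_inl {a b : Fin N} (h : D.partner (Sum.inl a) = Sum.inl b) :
    leftPartner D a = b := by simp [leftPartner, h]

theorem leftPartner_eq_of_inr {a b : Fin N} (h : D.partner (Sum.inl a) = Sum.inr b) :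
    leftPartner D a = a := by simp [leftPartner, h]

theorem OkadaDiagram.ket_partner_of_inl {a b : Fin N} (h : D.partner (Sum.inr b) = Sum.inl a) :
    D.ket.partner b = b :=
  leftPartner_eq_of_inr (D := D.mirror) (b := a) (congrArg Node.mirror h)

theorem partner_inl_of_bra_eq (h : D.bra = E.bra) {a b : Fin N}
    (hab : D.partner (Sum.inl a) = Sum.inl b) : E.partner (Sum.inl a) = Sum.inl b := by
  have hleft : leftPartner D a = leftPartner E a := congrFun (congrArg HalfDiagram.partner h) a
  rw [leftPartner_eq_of_inl hab] at hleft
  subst hleft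
  rcases leftPartner_cases E a with ⟨hE, -⟩ | ⟨c, -, hE, -⟩
  · exact hE
  · rw [hE] at hab
    exact absurd hab (D.partner_ne _)

-- The two ends of a propagating arc have the same label, and the labels of the half arcs of a half
-- diagram are distinct.
theorem partner_eq_of_bra_eq_of_ket_eq (h : D.bra = E.bra) (h' : D.ket = E.ket) (a : Fin N) :
    D.partner (Sum.inl a) = E.partner (Sum.inl a) := by
  have hl : ∀ a, D.label (Sum.inl a) = E.label (Sum.inl a) :=
    congrFun (congrArg HalfDiagram.label h)
  have hr : ∀ a, D.label (Sum.inr a) = E.label (Sum.inr a) :=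
    congrFun (congrArg HalfDiagram.label h')
  rcases hD : D.partner (Sum.inl a) with b | b
  · exact (partner_inl_of_bra_eq h hD).symm
  rcases hE : E.partner (Sum.inl a) with c | c
  · rw [partner_inl_of_bra_eq h.symm hE] at hD
    cases hD
  have hb : E.ket.partner b = b := by
    rw [← h', OkadaDiagram.ket_partner_of_inl (a := a) (by rw [← hD, D.partner_partner])]
  have hc : E.ket.partner c = c :=
    OkadaDiagram.ket_partner_of_inl (a := a) (by rw [← hE, E.partner_partner])
  have hlabel : E.label (Sum.inr b) = E.label (Sum.inr c) := by
    rw [← hE, E.label_partner, ← hl, ← hr, ← hD, D.label_partner]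
  exact congrArg Sum.inr (HalfDiagram.eq_of_label_eq hb hc hlabel)

theorem IsGluing.unique {L R : HalfDiagram N} (h : IsGluing L R D) (h' : IsGluing L R E) :
    D = E := by
  have hb : D.bra = E.bra := h.1.trans h'.1.symm
  have hk : D.ket = E.ket := h.2.trans h'.2.symm
  apply OkadaDiagram.ext <;> funext u <;> rcases u with a | a
  · exact partner_eq_of_bra_eq_of_ket_eq hb hk a
  · have hmirror : (D.partner (Sum.inr a)).mirror = (E.partner (Sum.inr a)).mirror :=
      partner_eq_of_bra_eq_of_ket_eq (D := D.mirror) (E := E.mirror) hk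
        (by rw [D.ket_mirror, E.ket_mirror, hb]) a
    rw [← Node.mirror_mirror (D.partner _), hmirror, Node.mirror_mirror]
  · exact congrFun (congrArg HalfDiagram.label hb) a
  · exact congrFun (congrArg HalfDiagram.label hk) a

theorem IsGluing.mirror {L R : HalfDiagram N} (h : IsGluing L R D) : IsGluing R L D.mirror :=
  ⟨h.2, by rw [D.ket_mirror, h.1]⟩

end Gluing

/-! ### The chains of an insertion -/

namespace OkadaDiagram

section Cut

variable {N : ℕ}

/-- `h` is the label of an arc which joins a position below `c` with one from `c` on. These labels
for `c = r` and `c = 2 * N - r` are the half arc labels of the `r`-restrictions of the halves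
of `D`. -/
def IsCutLabel (D : OkadaDiagram N) (c h : ℕ) : Prop :=
  ∃ k < c, c ≤ D.partnerAt k ∧ D.labelAt k = h

theorem bra_partner_eq_or_le_iff (D : OkadaDiagram N) {r : ℕ} (hr : r ≤ N) (a : Fin N) :
    D.bra.partner a = a ∨ r ≤ (D.bra.partner a).val ↔ r ≤ D.partnerAt a.val := by
  have hpos : D.partnerAt a.val = (D.partner (Sum.inl a)).pos := D.partnerAt_pos (Sum.inl a)
  rw [hpos]
  change leftPartner D a = a ∨ r ≤ (leftPartner D a).val ↔ _
  rcases leftPartner_cases D a with ⟨hD, hne⟩ | ⟨b, hD, hfix, -⟩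
  · rw [hD, or_iff_right hne]
    rfl
  · have := b.isLt
    simp only [hD, hfix, true_or, true_iff, Node.pos]
    omega

theorem mem_propLabels_bra (D : OkadaDiagram N) {r : ℕ} (hr : r ≤ N) {h : ℕ} :
    h ∈ (D.bra.restrict r hr).propLabels ↔ D.IsCutLabel r h := by
  have hlabel (a : Fin N) : D.bra.label a = D.labelAt a.val := (D.labelAt_pos (Sum.inl a)).symm
  simp only [HalfDiagram.mem_propLabels_restrict, bra_partner_eq_or_le_iff D hr, hlabel]
  exact ⟨fun ⟨a, ha⟩ => ⟨a.val, ha⟩, fun ⟨k, hk, hk'⟩ => ⟨⟨k, by omega⟩, hk, hk'⟩⟩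

theorem partnerAt_mirror (D : OkadaDiagram N) {k : ℕ} (hk : k < 2 * N) :
    D.mirror.partnerAt k + D.partnerAt (2 * N - 1 - k) = 2 * N - 1 := by
  obtain ⟨u, rfl⟩ : ∃ u : Node N, u.pos = k := ⟨_, Node.pos_ofPos k hk⟩
  have hu := Node.pos_mirror u
  rw [partnerAt_pos, show 2 * N - 1 - u.pos = u.mirror.pos by omega, partnerAt_pos]
  exact Node.pos_mirror (D.partner u.mirror)

theorem labelAt_mirror (D : OkadaDiagram N) {k : ℕ} (hk : k < 2 * N) :
    D.mirror.labelAt k = D.labelAt (2 * N - 1 - k) := by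
  obtain ⟨u, rfl⟩ : ∃ u : Node N, u.pos = k := ⟨_, Node.pos_ofPos k hk⟩
  have hu := Node.pos_mirror u
  rw [labelAt_pos, show 2 * N - 1 - u.pos = u.mirror.pos by omega, labelAt_pos]
  rfl

theorem IsCutLabel.of_mirror {D : OkadaDiagram N} {c h : ℕ} (hc : c ≤ 2 * N)
    (hD : D.mirror.IsCutLabel c h) : D.IsCutLabel (2 * N - c) h := by
  obtain ⟨k, hk, hk', rfl⟩ := hD
  have hpartner := D.partnerAt_mirror (show k < 2 * N by omega)
  have hlt : 2 * N - 1 - k < 2 * N := by omega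
  rw [labelAt_mirror _ (by omega)]
  refine ⟨D.partnerAt (2 * N - 1 - k), by omega, ?_, D.isArcSystem.label_partner _ hlt⟩
  rw [D.isArcSystem.partner_partner _ hlt]
  omega

theorem mem_propLabels_ket (D : OkadaDiagram N) {r : ℕ} (hr : r ≤ N) {h : ℕ} :
    h ∈ (D.ket.restrict r hr).propLabels ↔ D.IsCutLabel (2 * N - r) h := by
  rw [OkadaDiagram.ket, mem_propLabels_bra]
  refine ⟨IsCutLabel.of_mirror (by omega), fun hD => ?_⟩
  rw [show r = 2 * N - (2 * N - r) by omega]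
  exact IsCutLabel.of_mirror (by omega) (by rwa [D.mirror_mirror])

theorem hasChain_bra_iff {D : OkadaDiagram N} {C : ℕ → FibSet} : D.bra.HasChain C ↔
    ∀ r ≤ N, (C r).rank = r ∧ ∀ h, h ∈ (C r).carrier ↔ D.IsCutLabel r h := by
  refine forall₂_congr fun r hr => and_congr_right fun _ => ?_
  simp only [Finset.ext_iff, mem_propLabels_bra]

theorem hasChain_ket_iff {D : OkadaDiagram N} {C : ℕ → FibSet} : D.ket.HasChain C ↔
    ∀ r ≤ N, (C r).rank = r ∧ ∀ h, h ∈ (C r).carrier ↔ D.IsCutLabel (2 * N - r) h := by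
  refine forall₂_congr fun r hr => and_congr_right fun _ => ?_
  simp only [Finset.ext_iff, mem_propLabels_ket]

end Cut

section InsertCut

variable {M s a c d h : ℕ} (D : OkadaDiagram M) (hs : 1 ≤ s ∧ s ≤ M + 1)

theorem isCutLabel_insert_iff (ha : a + s = 2 * M + 1) (hcd : ∀ k, skip a k < d ↔ k < c) :
    (D.insert s hs).IsCutLabel d h ↔ (d = a + 1 ∧ h = s) ∨ D.IsCutLabel c h := by
  simp only [IsCutLabel, D.partnerAt_insert hs ha, D.labelAt_insert hs ha]
  constructor
  · rintro ⟨k, hk, hk', rfl⟩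
    rcases eq_or_eq_or_exists_eq_skip a k with rfl | rfl | ⟨m, rfl⟩
    · rw [insertPartner_left] at hk'
      exact Or.inl ⟨by omega, insertLabel_left _ _ _⟩
    · rw [insertPartner_right] at hk'
      omega
    · rw [insertPartner_skip, ← not_lt, hcd, not_lt] at hk'
      exact Or.inr ⟨m, (hcd m).1 hk, hk', (insertLabel_skip _ _ _ _).symm⟩
  · rintro (⟨rfl, rfl⟩ | ⟨k, hk, hk', rfl⟩)
    · exact ⟨a, a.lt_succ_self, (insertPartner_left _ _).ge, insertLabel_left _ _ _⟩
    · refine ⟨skip a k, (hcd k).2 hk, ?_, insertLabel_skip _ _ _ _⟩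
      rwa [insertPartner_skip, ← not_lt, hcd, not_lt]

theorem isCutLabel_insert_of_le (ha : a + s = 2 * M + 1) (hc : c ≤ a) :
    (D.insert s hs).IsCutLabel c h ↔ D.IsCutLabel c h := by
  rw [isCutLabel_insert_iff D hs ha (c := c) fun k => by unfold skip; split_ifs <;> omega,
    or_iff_right (by omega)]

theorem isCutLabel_insert_of_ge (ha : a + s = 2 * M + 1) (hc : a ≤ c) :
    (D.insert s hs).IsCutLabel (c + 2) h ↔ D.IsCutLabel c h := by
  rw [isCutLabel_insert_iff D hs ha (c := c) fun k => by unfold skip; split_ifs <;> omega,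
    or_iff_right (by omega)]

theorem isCutLabel_insert_self (ha : a + s = 2 * M + 1) :
    (D.insert s hs).IsCutLabel (a + 1) h ↔ h = s ∨ D.IsCutLabel a h := by
  rw [isCutLabel_insert_iff D hs ha (c := a) fun k => by unfold skip; split_ifs <;> omega,
    and_iff_right rfl]

end InsertCut

end OkadaDiagram

/-! ### Permutations and growth diagrams -/

section Growth

variable {N : ℕ} (σ : Equiv.Perm (Fin N))

theorem fominRule_comm (m : Prop) (t p q : FibSet) : fominRule m t p q = fominRule m t q p := by
  unfold fominRule
  split_ifs <;> simp_all

theorem fominRule_self_left {m : Prop} (hm : ¬ m) (t q : FibSet) : fominRule m t t q = q := by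
  unfold fominRule
  split_ifs <;> simp_all

theorem fominRule_self_right {m : Prop} (hm : ¬ m) (t p : FibSet) : fominRule m t p t = p := by
  rw [fominRule_comm, fominRule_self_left hm]

theorem fominRule_of_ne {m : Prop} {t p q : FibSet} (hp : p ≠ t) (hq : q ≠ t) :
    fominRule m t p q = t.addTwo := by
  rw [fominRule, if_neg fun h => hp h.1, if_neg hp, if_neg hq]

theorem fominGrowth_zero_left (j : ℕ) : fominGrowth σ 0 j = FibSet.empty := by rw [fominGrowth]

theorem fominGrowth_zero_right (i : ℕ) : fominGrowth σ i 0 = FibSet.empty := by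
  cases i <;> rw [fominGrowth]

theorem fominGrowth_succ (i j : ℕ) :
    fominGrowth σ (i + 1) (j + 1) = fominRule (∃ h : i < N, (σ ⟨i, h⟩).val = j)
      (fominGrowth σ i j) (fominGrowth σ i (j + 1)) (fominGrowth σ (i + 1) j) := by
  rw [fominGrowth]

theorem fominGrowth_inv (i j : ℕ) : fominGrowth σ⁻¹ i j = fominGrowth σ j i := by
  induction i generalizing j with
  | zero => rw [fominGrowth_zero_left, fominGrowth_zero_right]
  | succ i ihi =>
    induction j with
    | zero => rw [fominGrowth_zero_left, fominGrowth_zero_right]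
    | succ j ihj =>
      rw [fominGrowth_succ, fominGrowth_succ, ihi, ihi, ihj, fominRule_comm]
      congr 1
      refine propext ⟨?_, ?_⟩
      · rintro ⟨h, rfl⟩
        exact ⟨Fin.isLt _, by simp⟩
      · rintro ⟨h, rfl⟩
        exact ⟨Fin.isLt _, by simp⟩

theorem fominP_inv : fominP σ⁻¹ = fominQ σ := funext fun j => fominGrowth_inv σ N j

theorem fominQ_inv : fominQ σ⁻¹ = fominP σ := funext fun i => fominGrowth_inv σ i N

/-- The word in the indices of the generators whose product is the basis element of the Okada
algebra assigned to `σ`. -/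
def permWord : List ℕ :=
  ((List.finRange N).map fun i => (List.range (permCode σ i)).map fun k => i.val - k).flatten

theorem permElem_eq {K : Type*} [Field K] (x y : ℕ → K) :
    OkadaAlgebra.permElem x y σ = ((permWord σ).map (OkadaAlgebra.gen N x y)).prod := by
  rw [OkadaAlgebra.permElem, permWord, List.map_flatten, List.prod_flatten, List.map_map,
    List.map_map]
  simp only [Function.comp_def, List.map_map]

end Growth

/-- The permutation `τ` is obtained from `σ` by deleting its largest value, which `σ` takes
at `a`. -/
structure IsDeletion {M : ℕ} (σ : Equiv.Perm (Fin (M + 1))) (a : Fin (M + 1))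
    (τ : Equiv.Perm (Fin M)) : Prop where
  apply_self : σ a = Fin.last M
  apply_succAbove : ∀ k, σ (a.succAbove k) = (τ k).castSucc

theorem exists_isDeletion {M : ℕ} (σ : Equiv.Perm (Fin (M + 1))) : ∃ a τ, IsDeletion σ a τ := by
  obtain ⟨a, ha⟩ := σ.surjective (Fin.last M)
  have hne : ∀ k, σ (a.succAbove k) ≠ Fin.last M := fun k h =>
    a.succAbove_ne k (σ.injective (h.trans ha.symm))
  have hinj : Function.Injective fun k => (σ (a.succAbove k)).castPred (hne k) := fun k m h =>
    Fin.succAbove_right_injective (σ.injective (Fin.castPred_inj.1 h))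
  exact ⟨a, Equiv.ofBijective _ (Finite.injective_iff_bijective.1 hinj), ha, fun k => by simp⟩

namespace IsDeletion

variable {M : ℕ} {σ : Equiv.Perm (Fin (M + 1))} {a : Fin (M + 1)} {τ : Equiv.Perm (Fin M)}

theorem inv_last (hστ : IsDeletion σ a τ) : σ⁻¹ (Fin.last M) = a := by
  rw [Equiv.Perm.inv_eq_iff_eq, hστ.apply_self]

theorem inv_castSucc (hστ : IsDeletion σ a τ) (i : Fin M) :
    σ⁻¹ i.castSucc = a.succAbove (τ⁻¹ i) := by
  rw [Equiv.Perm.inv_eq_iff_eq, hστ.apply_succAbove]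
  simp

theorem permCode_last (hστ : IsDeletion σ a τ) : permCode σ (Fin.last M) = M - a.val := by
  have hcard : (Finset.Ioi a).card = M - a.val := by rw [Fin.card_Ioi]; omega
  rw [permCode, hστ.inv_last, ← hcard, ← Finset.card_map (s := Finset.Ioi a) σ.toEmbedding]
  refine congrArg Finset.card (Finset.ext fun j => ?_)
  simp only [Finset.mem_filter, Finset.mem_univ, true_and, Finset.mem_map_equiv, Finset.mem_Ioi]
  refine ⟨fun h => h.2, fun h => ⟨(Fin.le_last j).lt_of_ne ?_, h⟩⟩
  rintro rfl
  exact h.ne' hστ.inv_last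

theorem permCode_castSucc (hστ : IsDeletion σ a τ) (i : Fin M) :
    permCode σ i.castSucc = permCode τ i := by
  refine (congrArg Finset.card (Finset.ext fun j => ?_)).trans (Finset.card_map Fin.castSuccEmb)
  simp only [Finset.mem_filter, Finset.mem_univ, true_and, Finset.mem_map]
  constructor
  · rintro ⟨hji, hlt⟩
    obtain ⟨j, rfl⟩ := Fin.exists_castSucc_eq.2 (hji.trans (Fin.castSucc_lt_last i)).ne
    rw [hστ.inv_castSucc, hστ.inv_castSucc, Fin.succAbove_lt_succAbove_iff] at hlt
    exact ⟨j, ⟨hji, hlt⟩, rfl⟩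
  · rintro ⟨j, ⟨hji, hlt⟩, rfl⟩
    refine ⟨hji, ?_⟩
    change σ⁻¹ i.castSucc < σ⁻¹ j.castSucc
    rwa [hστ.inv_castSucc, hστ.inv_castSucc, Fin.succAbove_lt_succAbove_iff]

theorem permWord_eq_append (hστ : IsDeletion σ a τ) :
    permWord σ = permWord τ ++ (List.range (M - a.val)).map fun k => M - k := by
  rw [permWord, List.finRange_succ_last, List.map_append, List.flatten_append, List.map_map]
  simp only [Function.comp_def, hστ.permCode_castSucc, List.map_singleton, hστ.permCode_last,
    List.flatten_singleton, Fin.val_last, Fin.val_castSucc]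
  rfl

variable {i j : ℕ}

theorem mark_of_lt (hστ : IsDeletion σ a τ) (hi : i < a.val) :
    (∃ h : i < M + 1, (σ ⟨i, h⟩).val = j) ↔ ∃ h : i < M, (τ ⟨i, h⟩).val = j := by
  have hM : i < M := by have := a.isLt; omega
  have hσ := hστ.apply_succAbove ⟨i, hM⟩
  rw [Fin.succAbove_of_castSucc_lt _ _ hi] at hσ
  have hval : (σ ⟨i, by omega⟩).val = (τ ⟨i, hM⟩).val := congrArg Fin.val hσ
  simp only [hM, exists_true_left, show i < M + 1 by omega, hval]

theorem mark_of_gt (hστ : IsDeletion σ a τ) (hi : a.val ≤ i) :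
    (∃ h : i + 1 < M + 1, (σ ⟨i + 1, h⟩).val = j) ↔ ∃ h : i < M, (τ ⟨i, h⟩).val = j := by
  by_cases hM : i < M
  · have hσ := hστ.apply_succAbove ⟨i, hM⟩
    rw [Fin.succAbove_of_le_castSucc _ _ hi] at hσ
    have hval : (σ ⟨i + 1, by omega⟩).val = (τ ⟨i, hM⟩).val := congrArg Fin.val hσ
    simp only [hM, exists_true_left, show i + 1 < M + 1 by omega, hval]
  · simp only [hM, show ¬ i + 1 < M + 1 by omega, IsEmpty.exists_iff]

theorem mark_self (hστ : IsDeletion σ a τ) :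
    (∃ h : a.val < M + 1, (σ ⟨a.val, h⟩).val = j) ↔ M = j := by
  simp only [Fin.eta, hστ.apply_self, Fin.val_last, a.isLt, exists_true_left]

-- Below the top row the column of `a` has no mark, and a column without a mark repeats the
-- previous one.
theorem fominGrowth_eq (hστ : IsDeletion σ a τ) (hj : j ≤ M) (i : ℕ) :
    fominGrowth σ i j = fominGrowth τ (if i ≤ a.val then i else i - 1) j := by
  induction j generalizing i with
  | zero => rw [fominGrowth_zero_right, fominGrowth_zero_right]
  | succ j ihj =>
    have ihj := fun i => ihj (by omega) i
    induction i with
    | zero => rw [if_pos (Nat.zero_le _), fominGrowth_zero_left, fominGrowth_zero_left]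
    | succ i ihi =>
      rw [fominGrowth_succ, ihj, ihj, ihi]
      rcases lt_trichotomy i a.val with hi | rfl | hi
      · rw [if_pos hi.le, if_pos (Nat.succ_le_of_lt hi), fominGrowth_succ,
          propext (hστ.mark_of_lt hi)]
      · have hmark : ¬ ∃ h : a.val < M + 1, (σ ⟨a.val, h⟩).val = j := by
          rw [hστ.mark_self]
          omega
        rw [if_pos le_rfl, if_neg (by omega), Nat.add_sub_cancel, fominRule_self_right hmark]
      · obtain ⟨i, rfl⟩ : ∃ k, i = k + 1 := ⟨i - 1, by omega⟩
        rw [if_neg (by omega), if_neg (by omega), Nat.add_sub_cancel, Nat.add_sub_cancel,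
          fominGrowth_succ, propext (hστ.mark_of_gt (by omega))]

theorem fominP_eq (hστ : IsDeletion σ a τ) (hj : j ≤ M) : fominP σ j = fominP τ j := by
  have hi : (if M + 1 ≤ a.val then M + 1 else M + 1 - 1) = M := if_neg (by omega)
  rw [fominP, hστ.fominGrowth_eq hj, hi, fominP]

theorem fominGrowth_eq_of_le (hστ : IsDeletion σ a τ) (hi : i ≤ a.val) :
    fominGrowth σ i M = fominQ τ i := by
  rw [hστ.fominGrowth_eq le_rfl, if_pos hi, fominQ]

theorem fominGrowth_succ_eq_of_ge (hστ : IsDeletion σ a τ) (hi : a.val ≤ i) :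
    fominGrowth σ (i + 1) M = fominQ τ i := by
  rw [hστ.fominGrowth_eq le_rfl, if_neg (by omega), Nat.add_sub_cancel, fominQ]

theorem fominQ_of_le (hστ : IsDeletion σ a τ) (hi : i ≤ a.val) : fominQ σ i = fominQ τ i := by
  rw [fominQ, ← hστ.fominGrowth_eq_of_le hi]
  induction i with
  | zero => rw [fominGrowth_zero_left, fominGrowth_zero_left]
  | succ i ih =>
    have hmark : ¬ ∃ h : i < M + 1, (σ ⟨i, h⟩).val = M := by
      rw [hστ.mark_of_lt hi]
      rintro ⟨h, hτ⟩
      exact (Fin.isLt _).ne hτ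
    rw [fominGrowth_succ, ih (by omega), fominRule_self_left hmark]

theorem fominQ_succ_self (hστ : IsDeletion σ a τ) :
    fominQ σ (a.val + 1) = (fominQ τ a.val).addOne := by
  have htop : fominGrowth σ a.val (M + 1) = fominQ τ a.val := hστ.fominQ_of_le le_rfl
  rw [fominQ, fominGrowth_succ, htop, hστ.fominGrowth_eq_of_le le_rfl,
    hστ.fominGrowth_succ_eq_of_ge le_rfl, fominRule, if_pos ⟨rfl, rfl⟩,
    if_pos (hστ.mark_self.2 rfl)]

theorem fominQ_add_two (hστ : IsDeletion σ a τ) (hr : ∀ i ≤ M, (fominQ τ i).rank = i)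
    (hi : a.val ≤ i) (hiM : i < M) : fominQ σ (i + 2) = (fominQ τ i).addTwo := by
  have addTwo_of_rank : ∀ i, a.val ≤ i → i < M → (fominQ σ (i + 1)).rank = i + 1 →
      fominQ σ (i + 2) = (fominQ τ i).addTwo := by
    intro i hi hiM hrank
    have hp : fominGrowth σ (i + 1) (M + 1) ≠ fominQ τ i := fun h => by
      rw [fominQ, h, hr i hiM.le] at hrank; omega
    have hq : fominQ τ (i + 1) ≠ fominQ τ i := fun h => by
      have := congrArg FibSet.rank h
      rw [hr _ hiM.le, hr _ hiM] at this; omega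
    rw [fominQ, fominGrowth_succ, hστ.fominGrowth_succ_eq_of_ge hi,
      hστ.fominGrowth_succ_eq_of_ge (by omega), fominRule_of_ne hp hq]
  refine addTwo_of_rank i hi hiM ?_
  induction i, hi using Nat.le_induction with
  | base => rw [hστ.fominQ_succ_self]; exact congrArg (· + 1) (hr _ hiM.le)
  | succ i hi ih =>
    rw [addTwo_of_rank i hi (by omega) (ih (by omega))]
    exact congrArg (· + 2) (hr i (by omega))

end IsDeletion

/-! ### The correspondence -/

namespace OkadaDiagram

variable {M : ℕ} {σ : Equiv.Perm (Fin (M + 1))} {a : Fin (M + 1)} {τ : Equiv.Perm (Fin M)}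
  {D : OkadaDiagram M}

theorem hasChain_ket_insert (hστ : IsDeletion σ a τ) (hD : D.ket.HasChain (fominQ τ)) :
    (D.insert (a.val + 1) ⟨a.val.succ_pos, a.isLt⟩).ket.HasChain (fominQ σ) := by
  have haM := a.isLt
  obtain ⟨c, hc⟩ : ∃ c, c + (a.val + 1) = 2 * M + 1 := ⟨2 * M - a.val, by omega⟩
  rw [hasChain_ket_iff] at hD ⊢
  intro r hr
  rcases lt_trichotomy r (a.val + 1) with hra | rfl | hra
  · obtain ⟨hrank, hcarrier⟩ := hD r (by omega)
    rw [hστ.fominQ_of_le (by omega), show 2 * (M + 1) - r = 2 * M - r + 2 by omega]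
    exact ⟨hrank, fun l => (hcarrier l).trans (isCutLabel_insert_of_ge D _ hc (by omega)).symm⟩
  · obtain ⟨hrank, hcarrier⟩ := hD a.val (by omega)
    rw [hστ.fominQ_succ_self, show 2 * (M + 1) - (a.val + 1) = c + 1 by omega]
    refine ⟨congrArg (· + 1) hrank, fun l => ?_⟩
    rw [isCutLabel_insert_self D _ hc, FibSet.addOne, Finset.mem_insert, hrank, hcarrier,
      show 2 * M - a.val = c by omega]
  · obtain ⟨i, rfl⟩ : ∃ i, r = i + 2 := ⟨r - 2, by omega⟩
    obtain ⟨hrank, hcarrier⟩ := hD i (by omega)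
    rw [hστ.fominQ_add_two (fun i hi => (hD i hi).1) (by omega) (by omega)]
    refine ⟨congrArg (· + 2) hrank, fun l => ?_⟩
    rw [isCutLabel_insert_of_le D _ hc (by omega), FibSet.addTwo, hcarrier,
      show 2 * (M + 1) - (i + 2) = 2 * M - i by omega]

theorem hasChain_bra_insert (hστ : IsDeletion σ a τ) (hP : D.bra.HasChain (fominP τ))
    (hQ : D.ket.HasChain (fominQ τ)) :
    (D.insert (a.val + 1) ⟨a.val.succ_pos, a.isLt⟩).bra.HasChain (fominP σ) := by
  have haM := a.isLt
  obtain ⟨c, hc⟩ : ∃ c, c + (a.val + 1) = 2 * M + 1 := ⟨2 * M - a.val, by omega⟩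
  rw [hasChain_bra_iff] at hP ⊢
  intro r hr
  rcases Nat.le_succ_iff.1 hr with hrM | rfl
  · obtain ⟨hrank, hcarrier⟩ := hP r hrM
    rw [hστ.fominP_eq hrM]
    exact ⟨hrank, fun l => (hcarrier l).trans (isCutLabel_insert_of_le D _ hc (by omega)).symm⟩
  -- The chains `P` and `Q` have the same last member.
  · have hlast := hasChain_ket_iff.1 (hasChain_ket_insert hστ hQ) (M + 1) le_rfl
    rwa [show 2 * (M + 1) - (M + 1) = M + 1 by omega] at hlast

theorem hasChain_id_zero {C : ℕ → FibSet} (hC : C 0 = FibSet.empty) :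
    (OkadaDiagram.id 0).bra.HasChain C ∧ (OkadaDiagram.id 0).ket.HasChain C := by
  rw [hasChain_bra_iff, hasChain_ket_iff]
  constructor <;>
  · intro r hr
    obtain rfl := Nat.le_zero.1 hr
    rw [hC]
    exact ⟨rfl, fun h => iff_of_false (Finset.notMem_empty h) fun ⟨k, hk, _⟩ => by omega⟩

theorem exists_reduced_permWord {N : ℕ} (σ : Equiv.Perm (Fin N)) :
    ∃ D : OkadaDiagram N, Reduced N (permWord σ) D ∧ D.bra.HasChain (fominP σ) ∧
      D.ket.HasChain (fominQ σ) := by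
  induction N with
  | zero =>
    have hP : fominP σ 0 = FibSet.empty := fominGrowth_zero_left σ 0
    have hQ : fominQ σ 0 = FibSet.empty := fominGrowth_zero_left σ 0
    exact ⟨_, Reduced.nil, (hasChain_id_zero hP).1, (hasChain_id_zero hQ).2⟩
  | succ M ih =>
    obtain ⟨a, τ, hστ⟩ := exists_isDeletion σ
    obtain ⟨D, hw, hP, hQ⟩ := ih τ
    have haM := a.isLt
    refine ⟨_, ?_, hasChain_bra_insert hστ hP hQ, hasChain_ket_insert hστ hQ⟩
    have hins := hw.insert (M - a.val) (by omega)
    simp only [show M + 1 - (M - a.val) = a.val + 1 by omega] at hins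
    rwa [hστ.permWord_eq_append]

end OkadaDiagram

theorem OkArc.mirror_single {K : Type*} [Field K] {N : ℕ} (D : OkadaDiagram N) (a : K) :
    OkArc.mirror (Finsupp.single D a) = Finsupp.single D.mirror a :=
  Finsupp.mapDomain_single

theorem mainTheorem3 {K : Type*} [Field K] (N : ℕ) (x y : ℕ → K) :
    (∃! Θ : OkadaAlgebra N x y →ₗ[K] OkArc K N, IsTheta x y Θ) ∧
    ∀ Θ : OkadaAlgebra N x y →ₗ[K] OkArc K N, IsTheta x y Θ →
      ∀ σ : Equiv.Perm (Fin N),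
        (∃! L : HalfDiagram N, L.HasChain (fominP σ)) ∧
        (∃! R : HalfDiagram N, R.HasChain (fominQ σ)) ∧
        ∀ L R : HalfDiagram N, L.HasChain (fominP σ) → R.HasChain (fominQ σ) →
          (∃! D : OkadaDiagram N, IsGluing L R D) ∧
          (∃! D' : OkadaDiagram N, IsGluing R L D') ∧
          ∀ D D' : OkadaDiagram N, IsGluing L R D → IsGluing R L D' →
            Θ (OkadaAlgebra.permElem x y σ) = Finsupp.single D 1 ∧
            OkArc.mirror (Θ (OkadaAlgebra.permElem x y σ)) =
              Θ (OkadaAlgebra.permElem x y σ⁻¹) ∧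
            Θ (OkadaAlgebra.permElem x y σ⁻¹) = Finsupp.single D' 1 := by
  refine ⟨existsUnique_isTheta, fun Θ hΘ σ => ?_⟩
  obtain ⟨E, hw, hP, hQ⟩ := OkadaDiagram.exists_reduced_permWord σ
  obtain ⟨E', hw', hP', hQ'⟩ := OkadaDiagram.exists_reduced_permWord σ⁻¹
  rw [fominP_inv] at hP'
  rw [fominQ_inv] at hQ'
  refine ⟨⟨_, hP, fun _ h => h.unique hP⟩, ⟨_, hQ, fun _ h => h.unique hQ⟩,
    fun L R hL hR => ?_⟩
  have hg : IsGluing L R E := ⟨hP.unique hL, hQ.unique hR⟩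
  have hg' : IsGluing R L E' := ⟨hP'.unique hR, hQ'.unique hL⟩
  refine ⟨⟨E, hg, fun _ h => h.unique hg⟩, ⟨E', hg', fun _ h => h.unique hg'⟩,
    fun D D' hD hD' => ?_⟩
  obtain rfl := hD.unique hg
  obtain rfl := hD'.unique hg'
  rw [permElem_eq, permElem_eq, hΘ.map_reduced hw, hΘ.map_reduced hw', OkArc.mirror_single,
    hg.mirror.unique hg']
  exact ⟨rfl, rfl, rfl⟩
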